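/- Let $\mathbb D$ be the open unit disk, $dA=\frac1\pi\,dx\,dy$ normalized area measure on $\mathbb D$, and $H(\mathbb D)$ the space of analytic functions on $\mathbb D$. For $0<p<\infty$ and $\alpha>-1$, let $D^p_\alpha$ be the space of all $f\in H(\mathbb D)$ with $$\|f\|_{D^p_\alpha}=\Big(|f(0)|^p+\int_{\mathbb D}|f'(z)|^p(1-|z|^2)^\alpha\,dA(z)\Big)^{1/p}<\infty .$$ For $g\in H(\mathbb D)$ put $(T_gf)(z)=\int_0^z f(w)g'(w)\,dw$ for $f\in H(\mathbb D)$. We say that $T_g:D^p_\alpha\to D^q_\beta$ is bounded if $T_g$ maps $D^p_\alpha$ into $D^q_\beta$ and there is a finite constant $C$ with $\|T_gf\|_{D^q_\beta}\le C\|f\|_{D^p_\alpha}$ for all $f\in D^p_\alpha$. For an interval (arc) $I\subset\partial\mathbb D$ of normalized length $|I|\in(0,1]$, let $S(I)=\{re^{i\theta}: e^{i\theta}\in I,\ 1-|I|\le r<1\}$. For $s>0$, a positive Borel measure $\mu$ on $\mathbb D$ is an $s$-Carleson measure if there is a constant $C>0$ with $\mu(S(I))\le C|I|^s$ for all intervals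 $I\subset\partial\mathbb D$. **Theorem.** Let $\alpha,\beta>-1$, $0<p<q<\infty$ and $g\in H(\mathbb D)$, and let $d\mu(z)=(1-|z|^2)^\beta|g'(z)|^q\,dA(z)$ on $\mathbb D$. 1. If $p<\alpha+2$, then $T_g:D^p_\alpha\to D^q_\beta$ is bounded if and only if $\mu$ is a $\frac{q(\alpha+2-p)}{p}$-Carleson measure. 2. If $p=\alpha+2$, then $T_g:D^p_\alpha\to D^q_\beta$ is bounded if and only if there is a constant $C>0$ such that $\mu(S(I))\le C\big(\log\frac1{|I|}\big)^{(1/p-1)q}$ for all intervals $I\subset\partial\mathbb D$ with $|I|<1$. 3. If $p>\alpha+2$, then $T_g:D^p_\alpha\to D^q_\beta$ is bounded if and only if $\mu$ is a finite measure, and $\mu$ is a finite measure if and only if $g\in D^q_\beta$. -/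

import Mathlib

open MeasureTheory Set
open scoped NNReal ENNReal

noncomputable section

namespace WeightedDirichlet

/-- The open unit disk of the complex plane. -/
def unitDisk : Set ℂ := Metric.ball (0 : ℂ) 1

/-- The space of all analytic functions on the unit disk. A function is represented by any
extension to the plane; only its values on the disk are ever used. -/
def analyticDisk : Set (ℂ → ℂ) := {f | DifferentiableOn ℂ f unitDisk}

/-- The normalized area measure `(1/π) dx dy` on the unit disk. -/
def areaMeasure : Measure ℂ := (ENNReal.ofReal Real.pi)⁻¹ • volume.restrict unitDisk

/-- The weight `(1 - |z|²) ^ α`, which is positive on the unit disk. -/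
def weight (α : ℝ) (z : ℂ) : ℝ≥0∞ := ENNReal.ofReal ((1 - ‖z‖ ^ 2) ^ α)

/-- The (quasi-)norm `(|f(0)|^p + ∫ |f'|^p (1 - |z|²)^α dA)^(1/p)`, possibly infinite. -/
def dirichletNorm (p α : ℝ) (f : ℂ → ℂ) : ℝ≥0∞ :=
  (‖f 0‖ₑ ^ p + ∫⁻ z, ‖deriv f z‖ₑ ^ p * weight α z ∂areaMeasure) ^ (1 / p)

/-- The weighted Dirichlet space. -/
def dirichletSpace (p α : ℝ) : Set (ℂ → ℂ) :=
  {f | f ∈ analyticDisk ∧ dirichletNorm p α f < ⊤}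

/-- The Volterra type operator `(T_g f)(z) = ∫_0^z f(w) g'(w) dw`, the integral being taken
along the segment `w = t z`, `0 ≤ t ≤ 1`. -/
def volterra (g f : ℂ → ℂ) (z : ℂ) : ℂ :=
  ∫ t in (0 : ℝ)..1, f (t * z) * deriv g (t * z) * z

/-- The operator `T` maps the Dirichlet space with parameters `p, α` boundedly into the one with
parameters `q, β`. -/
def IsBoundedOperator (T : (ℂ → ℂ) → ℂ → ℂ) (p α q β : ℝ) : Prop :=
  ∃ C : ℝ≥0, ∀ f ∈ dirichletSpace p α,
    T f ∈ dirichletSpace q β ∧ dirichletNorm q β (T f) ≤ C * dirichletNorm p α f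

/-- The measure `(1 - |z|²)^β |g'(z)|^q dA(z)` on the unit disk. -/
def volterraMeasure (g : ℂ → ℂ) (q β : ℝ) : Measure ℂ :=
  areaMeasure.withDensity fun z => weight β z * ‖deriv g z‖ₑ ^ q

/-- `I` is an interval (arc) of the unit circle, open, closed or half-open, of normalized length
`l` with `0 < l ≤ 1`. -/
def IsArc (I : Set ℂ) (l : ℝ) : Prop :=
  0 < l ∧ l ≤ 1 ∧ ∃ (a : ℝ) (J : Set ℝ),
    Ioo a (a + 2 * Real.pi * l) ⊆ J ∧ J ⊆ Icc a (a + 2 * Real.pi * l) ∧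
      I = (fun t : ℝ => Complex.exp (t * Complex.I)) '' J

/-- The Carleson square `{r w : w ∈ I, 1 - |I| ≤ r < 1}` over an arc `I` of normalized
length `l`. -/
def carlesonSquare (I : Set ℂ) (l : ℝ) : Set ℂ :=
  {z | ∃ r : ℝ, ∃ w ∈ I, 1 - l ≤ r ∧ r < 1 ∧ z = r * w}

/-- `μ` is an `s`-Carleson measure: `μ(S(I)) ≤ C |I|^s` for all arcs `I`. -/
def IsCarleson (s : ℝ) (μ : Measure ℂ) : Prop :=
  ∃ C : ℝ, 0 < C ∧ ∀ (I : Set ℂ) (l : ℝ), IsArc I l →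
    μ (carlesonSquare I l) ≤ ENNReal.ofReal (C * l ^ s)

/-- `μ(S(I)) ≤ C (log (1/|I|))^e` for all arcs `I` with `|I| < 1`. For negative `e`, the
right-hand side is infinite at `|I| = 1`, so that the full circle gives no condition. -/
def IsLogCarleson (e : ℝ) (μ : Measure ℂ) : Prop :=
  ∃ C : ℝ, 0 < C ∧ ∀ (I : Set ℂ) (l : ℝ), IsArc I l → l < 1 →
    μ (carlesonSquare I l) ≤ ENNReal.ofReal (C * Real.log (1 / l) ^ e)

end WeightedDirichlet

end

noncomputable section

namespace WeightedDirichlet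

/-! ### Embedding theorem for dyadic trees -/

/-! Since `(T_g f)' = f g'` and `T_g f` vanishes at the origin, boundedness of `T_g` means exactly
that the Dirichlet space embeds into `L^q(μ)` (`isBoundedOperator_volterra_iff`).

Sufficiency is a problem on a dyadic tree. In the coordinate `z = exp(2πiζ)` the outer part of the
disk is cut into Whitney boxes, and `|f(z)|` is at most a multiple of the norm plus the sum of the
oscillations of `f` over the boxes above `z`. The sub-mean value property of `|f'|^p` and the
bounded overlap of the enlarged boxes give `∑ 2^(-k(α+2-p)) osc^p ≲ ‖f‖^p` (`exists_tree_majorant`).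
What remains is to bound tree sums in `L^q(μ)` when a cell of generation `k` has mass at most
`V^(-q(p-1)/p)`, where `V = v 0 + ... + v k` (`tree_embedding`). Duality and Hölder yield a weak
type bound (`tree_weak_type`). Truncating the sum at dyadic heights makes it a strong one: the
truncations share the energy of the original coefficients, and `p < q` lets their bounds be added.

Geometric `v` gives the case `p < α + 2`; a reduction to larger exponents covers `p ≤ 1`. Constant
`v` gives `p = α + 2`, where `V = k + 1` has the size of `log (1/|I|)`. If `p > α + 2`, the
oscillations decay geometrically, so `f` is bounded by its norm and finiteness of `μ` suffices
(`exists_enorm_le_of_lt`).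

Necessity comes from test functions that are large on `S(I)`. With `ω` an endpoint of `I` and `δ =
|I|`, these are powers of the Cauchy kernel `1 / (ω - (1 - δ) z)`, and its logarithm in the critical
case. Their norms are estimated by summing over dyadic distances from `ω`: the sum is geometric for
the powers, and has about `log (1/δ)` equal terms for the logarithm. In the third case the constant
`1` is enough. -/

lemma sub_mul_rpow_neg_le {V W ε : ℝ} (hV : 0 < V) (hVW : V ≤ W) (hε : 0 < ε) :
    (W - V) * W ^ (-1 - ε) ≤ (V ^ (-ε) - W ^ (-ε)) / ε := by
  have hW : 0 < W := hV.trans_le hVW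
  have hx : 0 < V / W := div_pos hV hW
  have h1 : 1 + ε * (1 - V / W) ≤ (V / W) ^ (-ε) := by
    rw [Real.rpow_def_of_pos hx]
    have h2 := Real.add_one_le_exp (Real.log (V / W) * -ε)
    have h3 := Real.log_le_sub_one_of_pos hx
    nlinarith
  rw [Real.div_rpow hV.le hW.le, le_div_iff₀ (by positivity)] at h1
  have h4 : W ^ (-1 - ε) = W ^ (-ε) / W := by
    rw [show (-1 - ε) = -ε - 1 by ring, Real.rpow_sub_one hW.ne']
  rw [h4, le_div_iff₀ hε]
  have h5 : (1 + ε * (1 - V / W)) * W ^ (-ε) = W ^ (-ε) + (W - V) * (W ^ (-ε) / W) * ε := by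
    field_simp
  linarith

/-- A right-endpoint Riemann sum of the decreasing function `min (M^(-1-ε)) (x^(-1-ε))` is at most
its integral over `(0, ∞)`, which is `M^(-ε) + M^(-ε)/ε`. -/
lemma sum_mul_min_rpow_le {v : ℕ → ℝ} (hv : ∀ k, 0 < v k) {ε M : ℝ} (hε : 0 < ε) (hM : 0 < M)
    (n : ℕ) :
    ∑ k ∈ Finset.range n, v k * min (M ^ (-1 - ε)) ((∑ i ∈ Finset.range (k + 1), v i) ^ (-1 - ε))
      ≤ (1 + 1 / ε) * M ^ (-ε) := by
  set V : ℕ → ℝ := fun k => ∑ i ∈ Finset.range k, v i with hVdef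
  have hV0 : ∀ k, 0 ≤ V k := fun k => Finset.sum_nonneg fun i _ => (hv i).le
  have hVs : ∀ k, V (k + 1) = V k + v k := fun k => Finset.sum_range_succ _ _
  have hMM : M * M ^ (-1 - ε) = M ^ (-ε) := by
    rw [show -ε = 1 + (-1 - ε) by ring, Real.rpow_add hM, Real.rpow_one]
  have anti : ∀ {x y : ℝ}, 0 < x → x ≤ y → y ^ (-1 - ε) ≤ x ^ (-1 - ε) := fun hx hxy =>
    Real.rpow_le_rpow_of_nonpos hx hxy (by linarith)
  -- Below the level `M` the integrand is constant and the bound is linear in `V n`; above it the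
  -- bound telescopes through `V n ^ (-ε)`.
  have key : ∀ n, (V n ≤ M → ∑ k ∈ Finset.range n, v k * min (M ^ (-1 - ε)) (V (k + 1) ^ (-1 - ε))
      ≤ V n * M ^ (-1 - ε)) ∧ (M < V n →
      ∑ k ∈ Finset.range n, v k * min (M ^ (-1 - ε)) (V (k + 1) ^ (-1 - ε))
      ≤ (1 + 1 / ε) * M ^ (-ε) - V n ^ (-ε) / ε) := by
    intro n
    induction n with
    | zero =>
      refine ⟨fun _ => by simp [hVdef], fun h => ?_⟩
      simp [hVdef] at h; linarith
    | succ n ih =>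
      have hvn := hv n
      have hs := hVs n
      constructor
      · intro h
        rw [Finset.sum_range_succ]
        have h1 := ih.1 (by linarith)
        have h2 : v n * min (M ^ (-1 - ε)) (V (n + 1) ^ (-1 - ε)) ≤ v n * M ^ (-1 - ε) :=
          mul_le_mul_of_nonneg_left (min_le_left _ _) hvn.le
        rw [hs] at h2 ⊢; linarith [add_mul (V n) (v n) (M ^ (-1 - ε))]
      · intro h
        rw [Finset.sum_range_succ]
        have h2 : v n * min (M ^ (-1 - ε)) (V (n + 1) ^ (-1 - ε)) ≤ v n * V (n + 1) ^ (-1 - ε) :=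
          mul_le_mul_of_nonneg_left (min_le_right _ _) hvn.le
        have hvn' : v n = V (n + 1) - V n := by linarith
        rcases le_or_gt (V n) M with h3 | h3
        -- The step that crosses `M` is split at `M`: the part below uses the constant value, the
        -- part above the integral comparison.
        · have h1 := ih.1 h3
          have h4 := sub_mul_rpow_neg_le hM h.le hε
          have h5 := anti hM h.le
          have h7 : (1 + 1 / ε) * M ^ (-ε) - V (n + 1) ^ (-ε) / ε
            = M ^ (-ε) + (M ^ (-ε) - V (n + 1) ^ (-ε)) / ε := by ring
          rw [h7, ← hMM]
          rw [← hMM] at h4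
          rw [hvn'] at h2 ⊢
          nlinarith
        · have h1 := ih.2 h3
          have h4 := sub_mul_rpow_neg_le (hM.trans h3) (by linarith : V n ≤ V (n + 1)) hε
          rw [← hvn', sub_div] at h4
          linarith
  have hpos : 0 ≤ 1 / ε * M ^ (-ε) := by positivity
  rcases le_or_gt (V n) M with h | h
  · refine ((key n).1 h).trans ?_
    have : V n * M ^ (-1 - ε) ≤ M * M ^ (-1 - ε) := by gcongr
    rw [hMM] at this
    linarith
  · refine ((key n).2 h).trans ?_
    have : 0 ≤ V n ^ (-ε) / ε := by have := hV0 n; positivity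
    linarith

/-- The family of cells of the `k`-th generation of a tree. -/
def treeCell {X : Type*} (N : X → ℕ) (c : ℕ → X → ℕ) (k j : ℕ) : Set X := {x | k ≤ N x ∧ c k x = j}

lemma tsum_rpow_le_of_le {ι : Type*} (f : ι → ℝ≥0∞) {r M : ℝ≥0∞} {s : ℝ} (hs : 0 ≤ s)
    (hf : ∀ i, f i ≤ M) (hr : ∑' i, f i ≤ r) : ∑' i, f i ^ (1 + s) ≤ M ^ s * r := by
  calc ∑' i, f i ^ (1 + s) ≤ ∑' i, M ^ s * f i := by
        refine ENNReal.tsum_le_tsum fun i => ?_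
        rw [ENNReal.rpow_add_of_nonneg _ _ zero_le_one hs, ENNReal.rpow_one, mul_comm]
        gcongr
        exact hf i
    _ ≤ _ := by rw [ENNReal.tsum_mul_left]; gcongr

lemma tsum_mul_le_Lp_mul_Lq {ι : Type*} (f g : ι → ℝ≥0∞) {p q : ℝ} (hpq : p.HolderConjugate q) :
    ∑' i, f i * g i ≤ (∑' i, f i ^ p) ^ (1 / p) * (∑' i, g i ^ q) ^ (1 / q) := by
  rw [ENNReal.tsum_eq_iSup_sum]
  refine iSup_le fun s => (ENNReal.inner_le_Lp_mul_Lq s f g hpq).trans ?_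
  have := hpq.pos
  have := hpq.symm.pos
  gcongr <;> exact ENNReal.sum_le_tsum _

lemma tsum_treeCell_indicator {X : Type*} (N : X → ℕ) (c : ℕ → X → ℕ) (a : ℕ → ℕ → ℝ≥0∞) (x : X) :
    ∑' k, ∑' j, (treeCell N c k j).indicator (fun _ => a k j) x
      = ∑ k ∈ Finset.range (N x + 1), a k (c k x) := by
  have h1 : ∀ k, ∑' j, (treeCell N c k j).indicator (fun _ => a k j) x
      = if k ≤ N x then a k (c k x) else 0 := by
    intro k
    rw [tsum_eq_single (c k x)]
    · simp [treeCell, indicator_apply]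
    · intro j hj
      simp [treeCell, Ne.symm hj]
  simp_rw [h1]
  rw [tsum_eq_sum (s := Finset.range (N x + 1))]
  · refine Finset.sum_congr rfl fun k hk => if_pos ?_
    simpa [Nat.lt_succ_iff] using hk
  · intro k hk
    refine if_neg ?_
    simpa [Nat.lt_succ_iff] using hk

lemma setLIntegral_tree {X : Type*} [MeasurableSpace X] {μ : Measure X} {N : X → ℕ}
    {c : ℕ → X → ℕ} (hT : ∀ k j, MeasurableSet (treeCell N c k j)) (a : ℕ → ℕ → ℝ≥0∞)
    (E : Set X) :
    ∫⁻ x in E, ∑ k ∈ Finset.range (N x + 1), a k (c k x) ∂μ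
      = ∑' k, ∑' j, a k j * μ.restrict E (treeCell N c k j) := by
  simp_rw [← tsum_treeCell_indicator N c a]
  rw [lintegral_tsum fun k => by
    exact (Measurable.tsum fun j => measurable_const.indicator (hT k j)).aemeasurable]
  refine tsum_congr fun k => ?_
  rw [lintegral_tsum fun j => (measurable_const.indicator (hT k j)).aemeasurable]
  exact tsum_congr fun j => by rw [lintegral_indicator_const (hT k j)]

lemma tsum_measure_treeCell_le {X : Type*} [MeasurableSpace X] {μ : Measure X} {N : X → ℕ}
    {c : ℕ → X → ℕ} (hT : ∀ k j, MeasurableSet (treeCell N c k j)) (k : ℕ) :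
    ∑' j, μ (treeCell N c k j) ≤ μ univ := by
  rw [← measure_iUnion _ (hT k)]
  · exact measure_mono (subset_univ _)
  · intro i j hij
    refine Set.disjoint_left.2 fun x hx hx' => hij (hx.2.symm.trans hx'.2)

/-- Integrating the tree sum over `E` pairs `a` with the masses `ν` of the pieces of `E` in the
cells. Hölder leaves the dual energy of `ν`, which the cell condition bounds by a power of `μ E`
smaller than the one needed to absorb it. -/
lemma tree_weak_type {X : Type*} [MeasurableSpace X] {p q : ℝ} (hp : 1 < p) (hpq : p < q)
    {v : ℕ → ℝ} (hv : ∀ k, 0 < v k) {μ : Measure X} {N : X → ℕ} {c : ℕ → X → ℕ}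
    (hT : ∀ k j, MeasurableSet (treeCell N c k j)) (hμ : μ univ ≠ ⊤)
    (hφ : ∀ k j, μ (treeCell N c k j) ≤
      ENNReal.ofReal ((∑ i ∈ Finset.range (k + 1), v i) ^ (-(q * (p - 1) / p))))
    (a : ℕ → ℕ → ℝ≥0∞) {E : Set X} {t : ℝ≥0∞} (hE : MeasurableSet E)
    (htE : ∀ x ∈ E, t ≤ ∑ k ∈ Finset.range (N x + 1), a k (c k x)) :
    t ^ q * μ E ≤ ENNReal.ofReal (q / (q - p)) ^ (q * (p - 1) / p) *
      (∑' k, ∑' j, ENNReal.ofReal (v k ^ (-(p - 1))) * a k j ^ p) ^ (q / p) := by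
  have hp0 : 0 < p := by linarith
  have hq0 : 0 < q := by linarith
  have hp1 : 0 < p - 1 := by linarith
  have hqp : 0 < q - p := by linarith
  set m := μ E with hm
  have hmtop : m ≠ ⊤ := ne_top_of_le_ne_top hμ (measure_mono (subset_univ _))
  rcases eq_or_ne m 0 with h0 | h0
  · rw [h0]; simp
  set p' := p / (p - 1) with hp'
  have hconj : p.HolderConjugate p' := Real.HolderConjugate.conjExponent hp
  set s := 1 / (p - 1) with hs
  have hs0 : 0 < s := by positivity
  have hp's : p' = 1 + s := by rw [hp', hs]; field_simp; ring
  set e := q * (p - 1) / p with he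
  have he0 : 0 < e := by positivity
  set ε := q / p - 1 with hε
  have hε0 : 0 < ε := by rw [hε, sub_pos, lt_div_iff₀ hp0]; linarith
  set V : ℕ → ℝ := fun k => ∑ i ∈ Finset.range k, v i with hVdef
  have hV : ∀ k, 0 < V (k + 1) := fun k => Finset.sum_pos (fun i _ => hv i) (by simp)
  set ν : ℕ → ℕ → ℝ≥0∞ := fun k j => μ.restrict E (treeCell N c k j) with hν
  have hν1 : ∀ k j, ν k j ≤ ENNReal.ofReal (V (k + 1) ^ (-e)) := fun k j =>
    (Measure.restrict_apply_le _ _).trans (hφ k j)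
  have hν2 : ∀ k j, ν k j ≤ m := fun k j => by
    calc ν k j ≤ μ.restrict E univ := measure_mono (subset_univ _)
      _ = m := by simp [hm]
  have hνs : ∀ k, ∑' j, ν k j ≤ m := fun k => by
    have := tsum_measure_treeCell_le (μ := μ.restrict E) hT k
    simpa [hm] using this
  set mr := m.toReal with hmr
  have hmr0 : 0 < mr := ENNReal.toReal_pos h0 hmtop
  have hmof : m = ENNReal.ofReal mr := (ENNReal.ofReal_toReal hmtop).symm
  have hes : e * s = 1 + ε := by rw [he, hs, hε]; field_simp; ring
  -- In one generation, one factor `ν` is summed to `m` and the other `p' - 1 = s` factors are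
  -- bounded by `min m (V^(-e))`. Since `e * s = 1 + ε`, the sum over generations is a Riemann sum
  -- with `M = m^(-1/e)`.
  have hdual : ∑' k, ∑' j, ENNReal.ofReal (v k) * ν k j ^ p' ≤
      ENNReal.ofReal ((1 + 1 / ε) * mr ^ (ε / e)) * m := by
    have hk : ∀ k, ∑' j, ENNReal.ofReal (v k) * ν k j ^ p' ≤
        ENNReal.ofReal (v k * min ((mr ^ (-1 / e)) ^ (-1 - ε)) (V (k + 1) ^ (-1 - ε))) * m := by
      intro k
      rw [ENNReal.tsum_mul_left, ENNReal.ofReal_mul (hv k).le, mul_assoc, hp's]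
      gcongr
      refine (tsum_rpow_le_of_le (ν k) (M := ENNReal.ofReal (min mr (V (k + 1) ^ (-e)))) hs0.le
        (fun j => ?_) (hνs k)).trans ?_
      · rw [ENNReal.ofReal_min, ← hmof]
        exact le_min (hν2 k j) (hν1 k j)
      · gcongr
        rw [ENNReal.ofReal_rpow_of_nonneg (le_min hmr0.le (Real.rpow_nonneg (hV k).le _)) hs0.le]
        refine ENNReal.ofReal_le_ofReal (le_min ?_ ?_)
        · rw [← Real.rpow_mul hmr0.le]
          have : -1 / e * (-1 - ε) = s := by
            rw [show (-1 - ε) = -(e * s) by rw [hes]; ring]; field_simp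
          rw [this]
          exact Real.rpow_le_rpow (le_min hmr0.le (Real.rpow_nonneg (hV k).le _))
            (min_le_left _ _) hs0.le
        · rw [show (-1 - ε) = (-e) * s by rw [neg_mul, hes]; ring, Real.rpow_mul (hV k).le]
          exact Real.rpow_le_rpow (le_min hmr0.le (Real.rpow_nonneg (hV k).le _))
            (min_le_right _ _) hs0.le
    refine (ENNReal.tsum_le_tsum hk).trans ?_
    rw [ENNReal.tsum_mul_right]
    gcongr
    have hM : 0 < mr ^ (-1 / e) := Real.rpow_pos_of_pos hmr0 _
    refine ENNReal.tsum_le_of_sum_range_le fun n => ?_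
    rw [← ENNReal.ofReal_sum_of_nonneg]
    · refine ENNReal.ofReal_le_ofReal ((sum_mul_min_rpow_le hv hε0 hM n).trans (le_of_eq ?_))
      rw [← Real.rpow_mul hmr0.le]
      congr 2
      field_simp
    · intro i _
      exact mul_nonneg (hv i).le (le_min (Real.rpow_nonneg hM.le _) (Real.rpow_nonneg (hV i).le _))
  set A := ∑' k, ∑' j, ENNReal.ofReal (v k ^ (-(p - 1))) * a k j ^ p with hA
  have hholder : ∑' k, ∑' j, a k j * ν k j ≤ A ^ (1 / p) *
      (∑' k, ∑' j, ENNReal.ofReal (v k) * ν k j ^ p') ^ (1 / p') := by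
    have := tsum_mul_le_Lp_mul_Lq
      (fun x : ℕ × ℕ => ENNReal.ofReal (v x.1 ^ (-((p - 1) / p))) * a x.1 x.2)
      (fun x : ℕ × ℕ => ENNReal.ofReal (v x.1 ^ ((p - 1) / p)) * ν x.1 x.2) hconj
    rw [ENNReal.tsum_prod', ENNReal.tsum_prod', ENNReal.tsum_prod'] at this
    have e1 : ∀ k j, ENNReal.ofReal (v k ^ (-((p - 1) / p))) * a k j *
        (ENNReal.ofReal (v k ^ ((p - 1) / p)) * ν k j) = a k j * ν k j := fun k j => by
      rw [mul_mul_mul_comm, ← ENNReal.ofReal_mul (Real.rpow_nonneg (hv k).le _),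
        ← Real.rpow_add (hv k)]
      simp
    have e2 : ∀ k j, (ENNReal.ofReal (v k ^ (-((p - 1) / p))) * a k j) ^ p
        = ENNReal.ofReal (v k ^ (-(p - 1))) * a k j ^ p := fun k j => by
      rw [ENNReal.mul_rpow_of_nonneg _ _ hp0.le,
        ENNReal.ofReal_rpow_of_nonneg (Real.rpow_nonneg (hv k).le _) hp0.le,
        ← Real.rpow_mul (hv k).le]
      congr 3
      field_simp
    have e3 : ∀ k j, (ENNReal.ofReal (v k ^ ((p - 1) / p)) * ν k j) ^ p'
        = ENNReal.ofReal (v k) * ν k j ^ p' := fun k j => by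
      rw [ENNReal.mul_rpow_of_nonneg _ _ hconj.symm.nonneg,
        ENNReal.ofReal_rpow_of_nonneg (Real.rpow_nonneg (hv _).le _) hconj.symm.nonneg,
        ← Real.rpow_mul (hv _).le]
      congr 2
      rw [hp']
      field_simp
      simp
    simpa only [e1, e2, e3] using this
  have hmain : t * m ≤ A ^ (1 / p) * (ENNReal.ofReal ((1 + 1 / ε) * mr ^ (ε / e)) * m) ^
      (1 / p') := by
    calc t * m = ∫⁻ x in E, t ∂μ := by simp [hm]
      _ ≤ ∫⁻ x in E, ∑ k ∈ Finset.range (N x + 1), a k (c k x) ∂μ :=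
        setLIntegral_mono' hE htE
      _ = ∑' k, ∑' j, a k j * ν k j := setLIntegral_tree hT a E
      _ ≤ _ := hholder
      _ ≤ _ := by
        have := hconj.symm.pos
        gcongr
  have hK : 1 + 1 / ε = q / (q - p) := by
    rw [hε]; field_simp; ring
  have hq' : (1 + ε / e) * (1 / p') = 1 - 1 / q := by
    rw [hε, he, hp']; field_simp; ring
  have hmain2 : t * m ≤ A ^ (1 / p) * ENNReal.ofReal (q / (q - p)) ^ (1 / p') * m ^ (1 - 1 / q) :=
      by
    refine hmain.trans (le_of_eq ?_)
    rw [hK, ENNReal.ofReal_mul (by positivity), ← ENNReal.ofReal_rpow_of_pos hmr0, ← hmof,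
      mul_assoc (ENNReal.ofReal _), ENNReal.mul_rpow_of_nonneg _ _
        (by have := hconj.symm.pos; positivity),
      ← mul_assoc]
    congr 1
    nth_rewrite 2 [← ENNReal.rpow_one m]
    rw [← ENNReal.rpow_add _ _ h0 hmtop, ← ENNReal.rpow_mul, add_comm, hq']
  -- Dividing by `m ^ (1 - 1 / q)` is where finiteness of `μ` and `m ≠ 0` are needed.
  have hmain3 : t * m ^ (1 / q) ≤ A ^ (1 / p) * ENNReal.ofReal (q / (q - p)) ^ (1 / p') := by
    have h1 : m ^ (1 - 1 / q) ≠ 0 := by simp [h0, hmtop]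
    have h2 : m ^ (1 - 1 / q) ≠ ⊤ := by simp [h0, hmtop]
    rw [← ENNReal.mul_le_mul_iff_left h1 h2]
    refine le_trans (le_of_eq ?_) hmain2
    rw [mul_assoc, ← ENNReal.rpow_add _ _ h0 hmtop]
    simp
  calc t ^ q * m = (t * m ^ (1 / q)) ^ q := by
        rw [ENNReal.mul_rpow_of_nonneg _ _ hq0.le, ← ENNReal.rpow_mul]
        field_simp
        simp
    _ ≤ (A ^ (1 / p) * ENNReal.ofReal (q / (q - p)) ^ (1 / p')) ^ q := by gcongr
    _ = _ := by
      rw [ENNReal.mul_rpow_of_nonneg _ _ hq0.le, ← ENNReal.rpow_mul, ← ENNReal.rpow_mul, mul_comm]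
      congr 2
      · rw [hp', he]; field_simp
      · field_simp

lemma measurable_tree {X : Type*} [MeasurableSpace X] {N : X → ℕ}
    {c : ℕ → X → ℕ} (hT : ∀ k j, MeasurableSet (treeCell N c k j)) (a : ℕ → ℕ → ℝ≥0∞) :
    Measurable fun x => ∑ k ∈ Finset.range (N x + 1), a k (c k x) := by
  simp_rw [← tsum_treeCell_indicator N c a]
  exact Measurable.tsum fun k => Measurable.tsum fun j => measurable_const.indicator (hT k j)

/-! ### Dyadic truncation and the strong type estimate -/

/-- The part of `s` between the levels `2 ^ i` and `2 ^ (i + 1)`. -/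
def layer (i : ℕ) (s : ℝ≥0) : ℝ≥0 := min (s - 2 ^ i) (2 ^ i)

lemma layer_mono (i : ℕ) : Monotone (layer i) := fun _ _ h =>
  min_le_min_right _ (tsub_le_tsub_right h _)

lemma coe_layer (i : ℕ) (s : ℝ≥0) :
    ((layer i s : ℝ≥0) : ℝ) = min (s : ℝ) (2 ^ (i + 1)) - min (s : ℝ) (2 ^ i) := by
  have h2 : (2 : ℝ) ^ (i + 1) = 2 ^ i + 2 ^ i := by ring
  rcases le_total s (2 ^ i) with h | h
  · have h' : (s : ℝ) ≤ 2 ^ i := by exact_mod_cast h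
    rw [layer, tsub_eq_zero_of_le h, min_eq_left h',
        min_eq_left (by linarith : (s : ℝ) ≤ 2 ^ (i + 1))]
    simp
  · have h' : (2 : ℝ) ^ i ≤ s := by exact_mod_cast h
    rw [layer, NNReal.coe_min, NNReal.coe_sub h, min_eq_right h']
    push_cast
    rw [h2, ← min_sub_sub_right, add_sub_cancel_right]

/-- The increments telescope: a layer is the difference of the cutoffs at two consecutive powers of
two, and each cutoff is monotone and `1`-Lipschitz. -/
lemma sum_layer_sub_layer_le (n : ℕ) {s t : ℝ≥0} (h : s ≤ t) :
    ∑ i ∈ Finset.range n, (layer i t - layer i s) ≤ t - s := by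
  rw [← NNReal.coe_le_coe, NNReal.coe_sum, NNReal.coe_sub h]
  have h' : (s : ℝ) ≤ t := h
  calc ∑ i ∈ Finset.range n, ((layer i t - layer i s : ℝ≥0) : ℝ)
      = ∑ i ∈ Finset.range n, ((min (t : ℝ) (2 ^ (i + 1)) - min (s : ℝ) (2 ^ (i + 1)))
          - (min (t : ℝ) (2 ^ i) - min (s : ℝ) (2 ^ i))) := by
        refine Finset.sum_congr rfl fun i _ => ?_
        rw [NNReal.coe_sub (layer_mono i h), coe_layer, coe_layer]
        ring
    _ = (min (t : ℝ) (2 ^ n) - min (s : ℝ) (2 ^ n))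
          - (min (t : ℝ) (2 ^ 0) - min (s : ℝ) (2 ^ 0)) :=
        Finset.sum_range_sub (fun i => min (t : ℝ) (2 ^ i) - min (s : ℝ) (2 ^ i)) n
    _ ≤ t - s := by
      have h1 : min (s : ℝ) (2 ^ 0) ≤ min (t : ℝ) (2 ^ 0) := min_le_min_right _ h'
      rcases le_total (s : ℝ) (2 ^ n) with h2 | h2
      · rw [min_eq_left h2]
        linarith [min_le_left (t : ℝ) (2 ^ n)]
      · rw [min_eq_right h2]
        linarith [min_le_right (t : ℝ) (2 ^ n)]

lemma tsum_rpow_le_rpow_of_sum_le {p : ℝ} (hp : 1 ≤ p) (f : ℕ → ℝ≥0) {s : ℝ≥0}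
    (h : ∀ n, ∑ i ∈ Finset.range n, f i ≤ s) :
    ∑' i, (f i : ℝ≥0∞) ^ p ≤ (s : ℝ≥0∞) ^ p := by
  have hp0 : 0 ≤ p - 1 := by linarith
  have h1 : ∑' i, (f i : ℝ≥0∞) ≤ s :=
    ENNReal.tsum_le_of_sum_range_le fun n => by exact_mod_cast h n
  have h2 : ∀ i, (f i : ℝ≥0∞) ≤ s := fun i => (ENNReal.le_tsum i).trans h1
  have := tsum_rpow_le_of_le (fun i => (f i : ℝ≥0∞)) hp0 h2 h1
  have h3 : (s : ℝ≥0∞) ^ (p - 1) * s = s ^ p := by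
    nth_rewrite 2 [← ENNReal.rpow_one (s : ℝ≥0∞)]
    rw [← ENNReal.rpow_add_of_nonneg _ _ hp0 zero_le_one]
    simp
  simpa [h3] using this

/-- The sum of `a` over the strict ancestors of the cell `j` of generation `k`. -/
def ancestorSum (a : ℕ → ℕ → ℝ≥0) : ℕ → ℕ → ℝ≥0
  | 0, _ => 0
  | k + 1, j => ancestorSum a k (j / 2) + a k (j / 2)

lemma ancestorSum_cell {X : Type*} {c : ℕ → X → ℕ} (hc : ∀ k x, c (k + 1) x / 2 = c k x)
    (a : ℕ → ℕ → ℝ≥0) (k : ℕ) (x : X) :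
    ancestorSum a k (c k x) = ∑ m ∈ Finset.range k, a m (c m x) := by
  induction k with
  | zero => simp [ancestorSum]
  | succ k ih => rw [ancestorSum, hc, ih, Finset.sum_range_succ]

/-- For `u > 2`, the index `i` with `2^(i+1) < u ≤ 2^(i+2)` already suffices, because `u ≤ 4 * 2^i`.
-/
lemma rpow_le_add_tsum_layers {q : ℝ} (hq : 0 < q) (u : ℝ≥0) :
    (u : ℝ≥0∞) ^ q ≤ 2 ^ q + ∑' i : ℕ, 4 ^ q *
        (if 2 ^ (i + 1) < u then (2 ^ i : ℝ≥0∞) ^ q else 0) := by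
  rcases le_or_gt u 2 with h | h
  · refine le_add_right ?_
    gcongr
    exact_mod_cast h
  · have hex : ∃ n : ℕ, u ≤ 2 ^ (n + 1) := by
      obtain ⟨n, hn⟩ := pow_unbounded_of_one_lt u (one_lt_two)
      exact ⟨n, hn.le.trans (pow_le_pow_right₀ one_le_two (Nat.le_succ n))⟩
    classical
    have hn := Nat.find_spec hex
    set n := Nat.find hex with hndef
    obtain ⟨i, hi⟩ : ∃ i, n = i + 1 := by
      refine Nat.exists_eq_succ_of_ne_zero fun h0 => ?_
      rw [h0] at hn
      simp at hn
      exact absurd hn (not_le.2 h)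
    have hlt : 2 ^ (i + 1) < u := not_le.1 (Nat.find_min hex (show i < Nat.find hex by omega))
    refine le_add_left (le_trans ?_ (ENNReal.le_tsum i))
    rw [if_pos hlt, ← ENNReal.mul_rpow_of_nonneg _ _ hq.le]
    gcongr
    rw [hi] at hn
    have : u ≤ 4 * 2 ^ i := hn.trans (le_of_eq (by ring))
    exact_mod_cast this

/-- The tree sum `u` is cut into dyadic layers and the weak type bound is applied to each. Since `p
≥ 1`, the `p`-energies of the layers add up to at most that of `a`, so the weak bounds sum to a
strong one. The part `u ≤ 2` is controlled by the mass of the root cell. -/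
theorem tree_embedding {p q : ℝ} (hp : 1 < p) (hpq : p < q) {v : ℕ → ℝ} (hv : ∀ k, 0 < v k) :
    ∃ C : ℝ≥0, ∀ {X : Type} [MeasurableSpace X] {μ : Measure X} {N : X → ℕ} {c : ℕ → X → ℕ},
    (∀ k j, MeasurableSet (treeCell N c k j)) → (∀ x, c 0 x = 0) →
    (∀ k x, c (k + 1) x / 2 = c k x) → (∀ k j, μ (treeCell N c k j) ≤
      ENNReal.ofReal ((∑ i ∈ Finset.range (k + 1), v i) ^ (-(q * (p - 1) / p)))) →
    ∀ a : ℕ → ℕ → ℝ≥0, (∑' k, ∑' j, ENNReal.ofReal (v k ^ (-(p - 1))) * (a k j : ℝ≥0∞) ^ p) ≤ 1 →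
      ∫⁻ x, (∑ k ∈ Finset.range (N x + 1), (a k (c k x) : ℝ≥0∞)) ^ q ∂μ ≤ C := by
  have hp0 : 0 < p := by linarith
  have hq0 : 0 < q := by linarith
  set K := ENNReal.ofReal (q / (q - p)) ^ (q * (p - 1) / p) with hK
  set φ0 := ENNReal.ofReal ((∑ i ∈ Finset.range (0 + 1), v i) ^ (-(q * (p - 1) / p)))
  have hCtop : 2 ^ q * φ0 + 4 ^ q * K ≠ ⊤ := by
    finiteness
  refine ⟨(2 ^ q * φ0 + 4 ^ q * K).toNNReal, fun {X} _ {μ N c} hT hc0 hc hφ a ha => ?_⟩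
  rw [ENNReal.coe_toNNReal hCtop]
  have huniv : μ univ ≤ φ0 := by
    refine (measure_mono ?_).trans (hφ 0 0)
    intro x _
    simp [treeCell, hc0]
  have hμ : μ univ ≠ ⊤ := ne_top_of_le_ne_top ENNReal.ofReal_ne_top huniv
  set u : X → ℝ≥0 := fun x => ∑ k ∈ Finset.range (N x + 1), a k (c k x) with hu
  have huc : ∀ x, (u x : ℝ≥0∞) = ∑ k ∈ Finset.range (N x + 1), (a k (c k x) : ℝ≥0∞) := fun x => by
    simp [hu]
  have hmeas : Measurable fun x => (u x : ℝ≥0∞) := by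
    simp_rw [huc]
    exact measurable_tree hT (fun k j => (a k j : ℝ≥0∞))
  -- Increments of `layer i` of the running sum, so that the tree sum of `b i` is `layer i (u x)`,
  -- which is at least `2^i` on `E i`.
  set b : ℕ → ℕ → ℕ → ℝ≥0 := fun i k j =>
    layer i (ancestorSum a k j + a k j) - layer i (ancestorSum a k j) with hb
  set A : ℕ → ℝ≥0∞ := fun i =>
    ∑' k, ∑' j, ENNReal.ofReal (v k ^ (-(p - 1))) * (b i k j : ℝ≥0∞) ^ p with hA
  have hAsum : ∑' i, A i ≤ 1 := by
    refine le_trans ?_ ha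
    rw [hA, ENNReal.tsum_comm]
    refine ENNReal.tsum_le_tsum fun k => ?_
    rw [ENNReal.tsum_comm]
    refine ENNReal.tsum_le_tsum fun j => ?_
    rw [ENNReal.tsum_mul_left]
    gcongr
    refine tsum_rpow_le_rpow_of_sum_le hp.le _ fun n => ?_
    exact (sum_layer_sub_layer_le n le_self_add).trans (le_of_eq (add_tsub_cancel_left _ _))
  set E : ℕ → Set X := fun i => {x | (2 : ℝ≥0) ^ (i + 1) < u x} with hE
  have hEm : ∀ i, MeasurableSet (E i) := fun i => by
    have : E i = {x | (2 : ℝ≥0∞) ^ (i + 1) < u x} := by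
      ext x
      simp only [hE, Set.mem_ofPred_eq]
      rw [← ENNReal.coe_lt_coe]
      norm_num
    rw [this]
    exact measurableSet_lt measurable_const hmeas
  have hweak : ∀ i, (2 ^ i : ℝ≥0∞) ^ q * μ (E i) ≤ K * A i := by
    intro i
    refine (tree_weak_type hp hpq hv hT hμ hφ (fun k j => (b i k j : ℝ≥0∞)) (hEm i)
      (t := 2 ^ i) fun x hx => ?_).trans ?_
    · have h1 : ∑ k ∈ Finset.range (N x + 1), b i k (c k x) = layer i (u x) := by
        have h2 : Monotone fun n => layer i (∑ m ∈ Finset.range n, a m (c m x)) :=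
          (layer_mono i).comp (monotone_nat_of_le_succ fun n => by
            rw [Finset.sum_range_succ]; exact le_self_add)
        have h3 := Finset.sum_range_tsub h2 (N x + 1)
        simp only [Finset.range_zero, Finset.sum_empty] at h3
        have h4 : layer i 0 = 0 := by simp [layer]
        rw [h4, tsub_zero] at h3
        rw [← h3]
        refine Finset.sum_congr rfl fun k _ => ?_
        simp only [hb]
        rw [ancestorSum_cell hc, Finset.sum_range_succ]
      have h5 : (2 : ℝ≥0) ^ i ≤ layer i (u x) := by
        have hx' : (2 : ℝ≥0) ^ (i + 1) < u x := hx
        refine le_min (le_tsub_of_add_le_left ?_) le_rfl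
        rw [← mul_two, ← pow_succ]
        exact hx'.le
      rw [← h1] at h5
      exact_mod_cast h5
    · refine mul_le_mul_right ?_ K
      -- The normalization gives `A i ≤ 1`, so the exponent `q / p ≥ 1` can be lowered to `1` and
      -- the bounds become summable in `i`.
      have h1 : A i ≤ 1 := (ENNReal.le_tsum i).trans hAsum
      calc A i ^ (q / p) ≤ A i ^ (1 : ℝ) :=
            ENNReal.rpow_le_rpow_of_exponent_ge h1 ((one_le_div hp0).2 hpq.le)
        _ = A i := ENNReal.rpow_one _
  calc ∫⁻ x, (∑ k ∈ Finset.range (N x + 1), (a k (c k x) : ℝ≥0∞)) ^ q ∂μ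
      ≤ ∫⁻ x, (2 ^ q + ∑' i : ℕ, 4 ^ q * (E i).indicator (fun _ => (2 ^ i : ℝ≥0∞) ^ q) x) ∂μ := by
        refine lintegral_mono fun x => ?_
        rw [← huc]
        exact rpow_le_add_tsum_layers hq0 (u x)
    _ = 2 ^ q * μ univ + ∑' i : ℕ, 4 ^ q * ((2 ^ i : ℝ≥0∞) ^ q * μ (E i)) := by
        rw [lintegral_add_left measurable_const, lintegral_const, lintegral_tsum fun i =>
          ((measurable_const.indicator (hEm i)).const_mul _).aemeasurable]
        congr 1
        refine tsum_congr fun i => ?_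
        rw [lintegral_const_mul _ (measurable_const.indicator (hEm i)),
          lintegral_indicator_const (hEm i)]
    _ ≤ 2 ^ q * φ0 + ∑' i : ℕ, 4 ^ q * (K * A i) := by
        exact add_le_add (mul_le_mul_right huniv _)
          (ENNReal.tsum_le_tsum fun i => mul_le_mul_right (hweak i) _)
    _ ≤ 2 ^ q * φ0 + 4 ^ q * K := by
        rw [ENNReal.tsum_mul_left, ENNReal.tsum_mul_left]
        gcongr
        exact mul_le_of_le_one_right' hAsum

/-- Homogeneity removes the normalization of the energy, and rescaling `μ` absorbs the constant `B`.
-/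
theorem tree_embedding_of_le {p q : ℝ} (hp : 1 < p) (hpq : p < q) {v : ℕ → ℝ} (hv : ∀ k, 0 < v k)
    (B : ℝ≥0) :
    ∃ C : ℝ≥0, ∀ {X : Type} [MeasurableSpace X] {μ : Measure X} {N : X → ℕ} {c : ℕ → X → ℕ},
    (∀ k j, MeasurableSet (treeCell N c k j)) → (∀ x, c 0 x = 0) →
    (∀ k x, c (k + 1) x / 2 = c k x) → (∀ k j, μ (treeCell N c k j) ≤
      B * ENNReal.ofReal ((∑ i ∈ Finset.range (k + 1), v i) ^ (-(q * (p - 1) / p)))) →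
    ∀ a : ℕ → ℕ → ℝ≥0∞,
      ∫⁻ x, (∑ k ∈ Finset.range (N x + 1), a k (c k x)) ^ q ∂μ ≤
        C * (∑' k, ∑' j, ENNReal.ofReal (v k ^ (-(p - 1))) * a k j ^ p) ^ (q / p) := by
  have hp0 : 0 < p := by linarith
  have hq0 : 0 < q := by linarith
  obtain ⟨C, hC⟩ := tree_embedding hp hpq hv
  -- `B + 1` is inverted to rescale `μ`, so it has to be nonzero. The last `+ 1` keeps the constant
  -- nonzero when the energy is infinite.
  refine ⟨(B + 1) * C + 1, fun {X} _ {μ N c} hT hc0 hc hφ a => ?_⟩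
  set A := ∑' k, ∑' j, ENNReal.ofReal (v k ^ (-(p - 1))) * a k j ^ p with hA
  have hvne : ∀ k, ENNReal.ofReal (v k ^ (-(p - 1))) ≠ 0 := fun k => by
    simpa using Real.rpow_pos_of_pos (hv k) _
  rcases eq_or_ne A 0 with h0 | h0
  · have ha : ∀ k j, a k j = 0 := by
      intro k j
      have h1 := (ENNReal.tsum_eq_zero.1 ((ENNReal.tsum_eq_zero.1 h0) k)) j
      rcases mul_eq_zero.1 h1 with h2 | h2
      · exact absurd h2 (hvne k)
      · exact (ENNReal.rpow_eq_zero_iff_of_pos hp0).1 h2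
    simp [ha, hq0]
  rcases eq_or_ne A ⊤ with htop | htop
  · rw [htop, ENNReal.top_rpow_of_pos (by positivity), ENNReal.mul_top (by simp)]
    exact le_top
  set s := A ^ (1 / p) with hs
  have hs0 : s ≠ 0 := by simp [hs, h0, htop]
  have hs_fin : s ≠ ⊤ := by simp [hs, h0, htop]
  have hsp : s ^ p = A := by rw [hs, ← ENNReal.rpow_mul]; field_simp; simp
  have hle : ∀ k j, ENNReal.ofReal (v k ^ (-(p - 1))) * a k j ^ p ≤ A := fun k j =>
    (ENNReal.le_tsum j).trans (ENNReal.le_tsum (f := fun k => ∑' j, _) k)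
  have hatop : ∀ k j, a k j ≠ ⊤ := fun k j h => by
    have := hle k j
    rw [h, ENNReal.top_rpow_of_pos hp0, ENNReal.mul_top (hvne k), top_le_iff] at this
    exact htop this
  set b : ℕ → ℕ → ℝ≥0 := fun k j => (a k j / s).toNNReal with hb
  have hbc : ∀ k j, (b k j : ℝ≥0∞) = a k j / s := fun k j =>
    ENNReal.coe_toNNReal (ENNReal.div_ne_top (hatop k j) hs0)
  have hB0 : ((B + 1 : ℝ≥0) : ℝ≥0∞) ≠ 0 := by simp
  have hbsum : ∑' k, ∑' j, ENNReal.ofReal (v k ^ (-(p - 1))) * (b k j : ℝ≥0∞) ^ p ≤ 1 := by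
    simp_rw [hbc, ENNReal.div_rpow_of_nonneg _ _ hp0.le, hsp, ← mul_div_assoc,
      div_eq_mul_inv, ENNReal.tsum_mul_right]
    rw [← hA, ENNReal.mul_inv_cancel h0 htop]
  have h1 := hC (μ := ((B + 1 : ℝ≥0) : ℝ≥0∞)⁻¹ • μ) hT hc0 hc (fun k j => by
    rw [Measure.smul_apply, smul_eq_mul, mul_comm, ← div_eq_mul_inv]
    refine ENNReal.div_le_of_le_mul' ((hφ k j).trans ?_)
    gcongr
    exact le_self_add) b hbsum
  rw [lintegral_smul_measure, smul_eq_mul, mul_comm, ← div_eq_mul_inv,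
    ENNReal.div_le_iff hB0 ENNReal.coe_ne_top] at h1
  calc ∫⁻ x, (∑ k ∈ Finset.range (N x + 1), a k (c k x)) ^ q ∂μ
      = ∫⁻ x, s ^ q * (∑ k ∈ Finset.range (N x + 1), (b k (c k x) : ℝ≥0∞)) ^ q ∂μ := by
        refine lintegral_congr fun x => ?_
        rw [← ENNReal.mul_rpow_of_nonneg _ _ hq0.le, Finset.mul_sum]
        congr 1
        refine Finset.sum_congr rfl fun k _ => ?_
        rw [hbc, ENNReal.mul_div_cancel hs0 hs_fin]
    _ = s ^ q * ∫⁻ x, (∑ k ∈ Finset.range (N x + 1), (b k (c k x) : ℝ≥0∞)) ^ q ∂μ := by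
        rw [lintegral_const_mul]
        exact (measurable_tree hT (fun k j => (b k j : ℝ≥0∞))).pow_const q
    _ ≤ s ^ q * (C * (B + 1 : ℝ≥0)) := mul_le_mul_right h1 _
    _ ≤ ((B + 1) * C + 1 : ℝ≥0) * A ^ (q / p) := by
        rw [hs, ← ENNReal.rpow_mul, show 1 / p * q = q / p by ring, mul_comm]
        gcongr
        push_cast
        rw [mul_comm]
        exact le_self_add

lemma rpow_sum_le_sum_rpow {θ : ℝ} (hθ : 0 < θ) (hθ1 : θ ≤ 1) (s : Finset ℕ) (f : ℕ → ℝ≥0∞) :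
    (∑ k ∈ s, f k) ^ θ ≤ ∑ k ∈ s, f k ^ θ := by
  classical
  induction s using Finset.induction_on with
  | empty => simp [hθ]
  | insert a s ha ih =>
    rw [Finset.sum_insert ha, Finset.sum_insert ha]
    exact (ENNReal.rpow_add_le_add_rpow _ _ hθ.le hθ1).trans (add_le_add le_rfl ih)

/-- The tree embedding for geometric weights, for all exponents `0 < p < q`. -/
theorem tree_embedding_geometric {p q σ : ℝ} (hp : 0 < p) (hpq : p < q) (hσ : 0 < σ) (B : ℝ≥0) :
    ∃ C : ℝ≥0, ∀ {X : Type} [MeasurableSpace X] {μ : Measure X} {N : X → ℕ} {c : ℕ → X → ℕ},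
    (∀ k j, MeasurableSet (treeCell N c k j)) → (∀ x, c 0 x = 0) →
    (∀ k x, c (k + 1) x / 2 = c k x) → (∀ k j, μ (treeCell N c k j) ≤
      B * ENNReal.ofReal ((2 : ℝ) ^ (-(k * (q * σ))))) →
    ∀ a : ℕ → ℕ → ℝ≥0∞,
      ∫⁻ x, (∑ k ∈ Finset.range (N x + 1), a k (c k x)) ^ q ∂μ ≤
        C * (∑' (k : ℕ), ∑' j, ENNReal.ofReal ((2 : ℝ) ^ (-(k * (p * σ)))) * a k j ^ p) ^
          (q / p) := by
  have hq : 0 < q := hp.trans hpq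
  -- As `θ ≤ 1`, `(∑ a)^θ ≤ ∑ a^θ`; and `θ ≤ p / 2` makes `P = p / θ ≥ 2`. The theorem for exponents
  -- above one is applied to `a^θ` with `P` and `Q`.
  set θ := min 1 (p / 2) with hθdef
  have hθ : 0 < θ := lt_min one_pos (by positivity)
  have hθ1 : θ ≤ 1 := min_le_left _ _
  have hθp : θ ≤ p / 2 := min_le_right _ _
  set P := p / θ with hP
  set Q := q / θ with hQ
  have hP1 : 1 < P := by rw [hP, lt_div_iff₀ hθ]; linarith
  have hPQ : P < Q := by rw [hP, hQ]; gcongr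
  have hP1' : 0 < P - 1 := by linarith
  -- Chosen so that `(x^k)^(-(P-1)) = 2^(-kpσ)`. The partial sums of `x^k` are at most `K * x^k`,
  -- and `(x^k)^(-e) = 2^(-kqσ)` matches the hypothesis on the cells.
  set x : ℝ := (2 : ℝ) ^ (σ * p / (P - 1)) with hx
  have hx1 : 1 < x := Real.one_lt_rpow one_lt_two (by positivity)
  have hx0 : 0 < x := by linarith
  set K : ℝ := x / (x - 1) with hK
  have hK0 : 0 < K := div_pos hx0 (by linarith)
  set e := Q * (P - 1) / P with he
  have he0 : 0 < e := div_pos (mul_pos (by linarith) hP1') (by linarith)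
  have hxk : ∀ (k : ℕ) (r : ℝ), (x ^ k) ^ r = (2 : ℝ) ^ (k * (σ * p / (P - 1) * r)) := fun k r => by
    rw [hx, ← Real.rpow_natCast, ← Real.rpow_mul (by positivity), ← Real.rpow_mul (by positivity)]
    congr 1; ring
  obtain ⟨C, hC⟩ := tree_embedding_of_le hP1 hPQ (v := fun k => x ^ k) (fun k => by positivity)
    (B * (K ^ e).toNNReal)
  refine ⟨C, fun {X} _ {μ N c} hT hc0 hc hφ a => ?_⟩
  have h1 := hC hT hc0 hc (μ := μ) (fun k j => by
    refine (hφ k j).trans ?_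
    rw [ENNReal.coe_mul, mul_assoc]
    gcongr
    change _ ≤ ENNReal.ofReal (K ^ e) * _
    rw [← ENNReal.ofReal_mul (by positivity)]
    refine ENNReal.ofReal_le_ofReal ?_
    have hV : ∑ i ∈ Finset.range (k + 1), x ^ i ≤ K * x ^ k := by
      rw [geom_sum_eq hx1.ne', hK, div_mul_eq_mul_div, ← pow_succ']
      have : 0 < x - 1 := by linarith
      gcongr
      linarith
    have hV0 : 0 < ∑ i ∈ Finset.range (k + 1), x ^ i :=
      Finset.sum_pos (fun i _ => by positivity) (by simp)
    calc (2 : ℝ) ^ (-(k * (q * σ))) = K ^ e * (K * x ^ k) ^ (-e) := by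
          rw [Real.mul_rpow hK0.le (by positivity), ← mul_assoc (K ^ e), ← Real.rpow_add hK0, hxk]
          simp only [add_neg_cancel, Real.rpow_zero, one_mul]
          congr 1
          have h2 : σ * p / (P - 1) * e = q * σ := by
            rw [he]
            have : P ≠ 0 := by linarith
            field_simp
            rw [hP, hQ]
            field_simp
          rw [mul_neg, h2]; ring
      _ ≤ _ := by
          gcongr K ^ e * ?_
          exact Real.rpow_le_rpow_of_nonpos hV0 hV (by linarith)) (fun k j => a k j ^ θ)
  have h2 : ∀ y : ℝ≥0∞, (y ^ θ) ^ Q = y ^ q := fun y => by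
    rw [← ENNReal.rpow_mul, hQ, mul_div_cancel₀ _ hθ.ne']
  have h3 : ∀ y : ℝ≥0∞, (y ^ θ) ^ P = y ^ p := fun y => by
    rw [← ENNReal.rpow_mul, hP, mul_div_cancel₀ _ hθ.ne']
  refine le_trans (lintegral_mono fun y => ?_) (h1.trans (le_of_eq ?_))
  · rw [← h2]
    have : 0 ≤ Q := by positivity
    gcongr
    exact rpow_sum_le_sum_rpow hθ hθ1 _ _
  · simp_rw [h3, hxk]
    have h4 : Q / P = q / p := by rw [hQ, hP]; field_simp
    rw [h4]
    congr 3
    funext k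
    refine tsum_congr fun j => ?_
    congr 4
    field_simp

/-- The tree embedding for the unweighted sum. -/
theorem tree_embedding_unweighted {p q : ℝ} (hp : 1 < p) (hpq : p < q) (B : ℝ≥0) :
    ∃ C : ℝ≥0, ∀ {X : Type} [MeasurableSpace X] {μ : Measure X} {N : X → ℕ} {c : ℕ → X → ℕ},
    (∀ k j, MeasurableSet (treeCell N c k j)) → (∀ x, c 0 x = 0) →
    (∀ k x, c (k + 1) x / 2 = c k x) → (∀ k j, μ (treeCell N c k j) ≤
      B * ENNReal.ofReal (((k : ℝ) + 1) ^ ((1 / p - 1) * q))) →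
    ∀ a : ℕ → ℕ → ℝ≥0∞,
      ∫⁻ x, (∑ k ∈ Finset.range (N x + 1), a k (c k x)) ^ q ∂μ ≤
        C * (∑' k, ∑' j, a k j ^ p) ^ (q / p) := by
  obtain ⟨C, hC⟩ := tree_embedding_of_le hp hpq (v := fun _ => 1) (fun _ => one_pos) B
  refine ⟨C, fun {X} _ {μ N c} hT hc0 hc hφ a => ?_⟩
  have := hC hT hc0 hc (μ := μ) (fun k j => by
    refine (hφ k j).trans (le_of_eq ?_)
    have h1 : (1 / p - 1) * q = -(q * (p - 1) / p) := by field_simp; ring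
    rw [h1]; simp) a
  simpa using this

/-! ### Mean value estimates for analytic functions -/

lemma lintegral_Ioo_ofReal_id {r : ℝ} (hr : 0 ≤ r) :
    ∫⁻ ρ in Ioo 0 r, ENNReal.ofReal ρ = ENNReal.ofReal (r ^ 2 / 2) := by
  rw [Measure.restrict_congr_set Ioo_ae_eq_Ioc, ← ofReal_integral_eq_lintegral_ofReal]
  · rw [← intervalIntegral.integral_of_le hr]; simp
  · exact (continuous_id.integrableOn_Icc (a := 0) (b := r)).mono_set Ioc_subset_Icc_self
  · exact (ae_restrict_mem measurableSet_Ioc).mono fun x hx => hx.1.le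

lemma two_pi_mul_enorm_le_lintegral_circle {h : ℂ → ℂ} {c : ℂ} {r ρ : ℝ} (hρ : 0 < ρ) (hρr : ρ < r)
    (hh : DifferentiableOn ℂ h (Metric.ball c r)) :
    ENNReal.ofReal (2 * Real.pi) * ‖h c‖ₑ ≤
      ∫⁻ θ in Ioo (-Real.pi) Real.pi, ‖h (circleMap c ρ θ)‖ₑ := by
  have h1 : Real.circleAverage h c ρ = h c := by
    refine DiffContOnCl.circleAverage ?_
    rw [abs_of_pos hρ]
    exact (hh.mono (Metric.closedBall_subset_ball hρr)).diffContOnCl_ball subset_rfl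
  have h2 : ∫ θ in (-Real.pi)..Real.pi, h (circleMap c ρ θ) = (2 * Real.pi : ℝ) • h c := by
    rw [← h1, Real.circleAverage_def, smul_smul, mul_inv_cancel₀ (by positivity), one_smul]
    have hper : Function.Periodic (fun θ => h (circleMap c ρ θ)) (2 * Real.pi) := fun θ => by
      simp only [periodic_circleMap c ρ θ]
    have := hper.intervalIntegral_add_eq (-Real.pi) 0
    rw [zero_add, show -Real.pi + 2 * Real.pi = Real.pi by ring] at this
    exact this
  calc ENNReal.ofReal (2 * Real.pi) * ‖h c‖ₑ = ‖(2 * Real.pi : ℝ) • h c‖ₑ := by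
        rw [enorm_smul, Real.enorm_of_nonneg (by positivity)]
    _ = ‖∫ θ in Ioc (-Real.pi) Real.pi, h (circleMap c ρ θ)‖ₑ := by
        rw [← h2, intervalIntegral.integral_of_le (by linarith [Real.pi_pos])]
    _ ≤ _ := by
        rw [Measure.restrict_congr_set Ioo_ae_eq_Ioc]
        exact enorm_integral_le_lintegral_enorm _

lemma measurable_indicator_of_continuousOn {F : ℂ → ℝ≥0∞} {s : Set ℂ} (hs : IsOpen s)
    (hF : ContinuousOn F s) : Measurable (s.indicator F) := by
  classical
  rw [← piecewise_eq_indicator]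
  exact hF.measurable_piecewise continuousOn_const hs.measurableSet

/-- The mean value property on circles, integrated over the radius in polar coordinates. -/
lemma enorm_mul_le_lintegral_ball {h : ℂ → ℂ} {c : ℂ} {r : ℝ} (hr : 0 < r)
    (hh : DifferentiableOn ℂ h (Metric.ball c r)) :
    ENNReal.ofReal (Real.pi * r ^ 2) * ‖h c‖ₑ ≤ ∫⁻ z in Metric.ball c r, ‖h z‖ₑ := by
  set H : ℂ → ℝ≥0∞ := fun z => (Metric.ball c r).indicator (fun z => ‖h z‖ₑ) (c + z) with hH
  have hHm : Measurable H :=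
    (measurable_indicator_of_continuousOn Metric.isOpen_ball hh.continuousOn.enorm).comp
      (measurable_const_add c)
  have h1 : ∫⁻ z in Metric.ball c r, ‖h z‖ₑ = ∫⁻ z, H z := by
    rw [lintegral_add_left_eq_self (fun z => (Metric.ball c r).indicator (fun z => ‖h z‖ₑ) z) c,
      lintegral_indicator Metric.isOpen_ball.measurableSet]
  have hHm2 : Measurable fun p : ℝ × ℝ =>
      ENNReal.ofReal p.1 • H (Complex.polarCoord.symm p) := by
    have : Measurable (fun p : ℝ × ℝ => Complex.polarCoord.symm p) := by
      have he : (fun p : ℝ × ℝ => Complex.polarCoord.symm p)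
        = fun p : ℝ × ℝ => (p.1 * (Real.cos p.2 + Real.sin p.2 * Complex.I) : ℂ) :=
        funext fun p => Complex.polarCoord_symm_apply p
      rw [he]
      fun_prop
    exact (ENNReal.measurable_ofReal.comp measurable_fst).smul (hHm.comp this)
  rw [h1, ← Complex.lintegral_comp_polarCoord_symm, polarCoord_target, Measure.volume_eq_prod,
    ← Measure.prod_restrict, lintegral_prod _ hHm2.aemeasurable]
  have hin : ∀ ρ ∈ Ioo 0 r, ENNReal.ofReal ρ * (ENNReal.ofReal (2 * Real.pi) * ‖h c‖ₑ) ≤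
      ∫⁻ θ in Ioo (-Real.pi) Real.pi, ENNReal.ofReal ρ • H (Complex.polarCoord.symm (ρ, θ)) := by
    intro ρ hρ
    refine (mul_le_mul_right (two_pi_mul_enorm_le_lintegral_circle hρ.1 hρ.2 hh) _).trans ?_
    rw [← lintegral_const_mul' _ _ ENNReal.ofReal_ne_top]
    refine lintegral_mono fun θ => ?_
    have e1 : c + Complex.polarCoord.symm (ρ, θ) = circleMap c ρ θ := by
      rw [Complex.polarCoord_symm_apply, circleMap, Complex.exp_mul_I]
      push_cast; rfl
    have e2 : circleMap c ρ θ ∈ Metric.ball c r := by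
      rw [Metric.mem_ball, Metric.mem_sphere.1 (circleMap_mem_sphere c hρ.1.le θ)]
      exact hρ.2
    simp only [hH, e1, indicator_of_mem e2, smul_eq_mul, le_refl]
  calc ENNReal.ofReal (Real.pi * r ^ 2) * ‖h c‖ₑ
      = ∫⁻ ρ in Ioo 0 r, ENNReal.ofReal ρ * (ENNReal.ofReal (2 * Real.pi) * ‖h c‖ₑ) := by
        rw [lintegral_mul_const' _ _ (ENNReal.mul_ne_top ENNReal.ofReal_ne_top enorm_ne_top),
          lintegral_Ioo_ofReal_id hr.le, ← mul_assoc, ← ENNReal.ofReal_mul (by positivity)]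
        congr 2; ring
    _ ≤ ∫⁻ ρ in Ioo 0 r, ∫⁻ θ in Ioo (-Real.pi) Real.pi,
        ENNReal.ofReal ρ • H (Complex.polarCoord.symm (ρ, θ)) :=
          setLIntegral_mono' measurableSet_Ioo hin
    _ ≤ _ := lintegral_mono_set fun x hx => hx.1

/-- The trick: where `|h|^p (R - |z - c|)^2` is largest, `|h|` is comparable to its maximum on a
ball, so that the mean value inequality for `|h|` gives the one for `|h|^p`. -/
lemma enorm_rpow_mul_le_lintegral_closedBall {p : ℝ} (hp : 0 < p) (hp1 : p ≤ 1) {h : ℂ → ℂ} {c : ℂ}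
    {R : ℝ} (hR : 0 < R) (hh : DifferentiableOn ℂ h (Metric.closedBall c R)) :
    ENNReal.ofReal (R ^ 2) * ‖h c‖ₑ ^ p ≤
      4 ^ (1 / p) * ∫⁻ z in Metric.ball c R, ‖h z‖ₑ ^ p := by
  have hcont : ContinuousOn (fun z => ‖h z‖ ^ p * (R - ‖z - c‖) ^ 2) (Metric.closedBall c R) :=
    (hh.continuousOn.norm.rpow_const fun _ _ => Or.inr hp.le).mul (by fun_prop)
  obtain ⟨z₀, hz₀, hmax⟩ := (isCompact_closedBall c R).exists_isMaxOn
    ⟨c, Metric.mem_closedBall_self hR.le⟩ hcont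
  set d := R - ‖z₀ - c‖ with hd
  have hcm : ‖h c‖ ^ p * R ^ 2 ≤ ‖h z₀‖ ^ p * d ^ 2 := by
    have := hmax (Metric.mem_closedBall_self (x := c) hR.le)
    simpa using this
  have hd0 : 0 ≤ d := by
    have := mem_closedBall_iff_norm.1 hz₀
    linarith
  rcases eq_or_ne (‖h z₀‖ ^ p * d ^ 2) 0 with h0 | h0
  · have hc0 : ‖h c‖ ^ p = 0 := by
      have h1 : 0 ≤ ‖h c‖ ^ p := by positivity
      have h2 : 0 < R ^ 2 := by positivity
      nlinarith
    have hc1 : h c = 0 := by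
      have := (Real.rpow_eq_zero (norm_nonneg _) hp.ne').1 hc0
      simpa using this
    simp [hc1, hp]
  have hd1 : 0 < d := lt_of_le_of_ne hd0 fun e => h0 (by rw [← e]; simp)
  have hz1 : 0 < ‖h z₀‖ := by
    refine lt_of_le_of_ne (norm_nonneg _) fun e => h0 ?_
    rw [← e, Real.zero_rpow hp.ne', zero_mul]
  have hsub : Metric.ball z₀ (d / 2) ⊆ Metric.ball c R := by
    refine Metric.ball_subset_ball' ?_
    rw [dist_eq_norm]; linarith
  have hnear : ∀ z ∈ Metric.ball z₀ (d / 2), ‖h z‖ ^ p ≤ 4 * ‖h z₀‖ ^ p := by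
    intro z hz
    have h1 : ‖h z‖ ^ p * (R - ‖z - c‖) ^ 2 ≤ ‖h z₀‖ ^ p * d ^ 2 :=
      hmax (Metric.ball_subset_closedBall (hsub hz))
    have h2 : d / 2 ≤ R - ‖z - c‖ := by
      have h3 : ‖z - c‖ ≤ ‖z - z₀‖ + ‖z₀ - c‖ := norm_sub_le_norm_sub_add_norm_sub _ _ _
      have h4 := mem_ball_iff_norm.1 hz
      linarith
    have h3 : ‖h z‖ ^ p * (d / 2) ^ 2 ≤ ‖h z₀‖ ^ p * d ^ 2 := by
      refine le_trans ?_ h1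
      gcongr
    have h4 : 0 < d ^ 2 := by positivity
    nlinarith
  -- `|h| ≤ |h|^p (4^(1/p) |h z₀|)^(1-p)` near `z₀`
  have hnear2 : ∀ z ∈ Metric.ball z₀ (d / 2),
      ‖h z‖ₑ ≤ ENNReal.ofReal (4 ^ (1 / p - 1) * ‖h z₀‖ ^ (1 - p)) * ‖h z‖ₑ ^ p := by
    intro z hz
    rcases eq_or_ne (h z) 0 with e | e
    · simp [e]
    have hz0 : 0 < ‖h z‖ := norm_pos_iff.2 e
    rw [← ofReal_norm, ENNReal.ofReal_rpow_of_pos hz0, ← ENNReal.ofReal_mul (by positivity)]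
    refine ENNReal.ofReal_le_ofReal ?_
    have h1 : ‖h z‖ ^ (1 - p) ≤ 4 ^ (1 / p - 1) * ‖h z₀‖ ^ (1 - p) := by
      have h2 := Real.rpow_le_rpow (by positivity) (hnear z hz)
        (show 0 ≤ (1 - p) / p from div_nonneg (by linarith) hp.le)
      rw [Real.mul_rpow (by norm_num) (by positivity), ← Real.rpow_mul hz0.le,
        ← Real.rpow_mul hz1.le] at h2
      have e1 : p * ((1 - p) / p) = 1 - p := by field_simp
      have e2 : (1 - p) / p = 1 / p - 1 := by field_simp
      rwa [e1, e2] at h2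
    calc ‖h z‖ = ‖h z‖ ^ (1 - p) * ‖h z‖ ^ p := by
          rw [← Real.rpow_add hz0]; simp
      _ ≤ _ := by gcongr
  set I := ∫⁻ z in Metric.ball c R, ‖h z‖ₑ ^ p with hI
  have hmv := enorm_mul_le_lintegral_ball (half_pos hd1)
    (hh.mono (hsub.trans Metric.ball_subset_closedBall))
  have hmv2 : ENNReal.ofReal (Real.pi * (d / 2) ^ 2) * ‖h z₀‖ₑ ≤
      ENNReal.ofReal (4 ^ (1 / p - 1) * ‖h z₀‖ ^ (1 - p)) * I := by
    refine hmv.trans ((setLIntegral_mono' Metric.isOpen_ball.measurableSet hnear2).trans ?_)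
    rw [lintegral_const_mul' _ _ ENNReal.ofReal_ne_top]
    exact mul_le_mul_right (lintegral_mono_set hsub) _
  set t := ‖h z₀‖ with ht
  have ht1 : 0 < t ^ (1 - p) := Real.rpow_pos_of_pos hz1 _
  have hsplit : t = t ^ (1 - p) * t ^ p := by rw [← Real.rpow_add hz1]; simp
  -- The factor `t ^ (1 - p)` occurs on both sides of the mean value inequality at `z₀` and cancels.
  -- The constant is `4 * 4^(1/p - 1) = 4^(1/p)`, and `4π(d/2)² ≥ d²`.
  have hfin : ENNReal.ofReal (d ^ 2 * t ^ p) ≤ 4 ^ (1 / p) * I := by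
    have h1 : ENNReal.ofReal (t ^ (1 - p)) * ENNReal.ofReal (d ^ 2 * t ^ p) ≤
        ENNReal.ofReal (t ^ (1 - p)) * (4 ^ (1 / p) * I) := by
      calc ENNReal.ofReal (t ^ (1 - p)) * ENNReal.ofReal (d ^ 2 * t ^ p)
          = ENNReal.ofReal (d ^ 2 * t) := by
            rw [← ENNReal.ofReal_mul ht1.le]; congr 1; nth_rewrite 3 [hsplit]; ring
        _ ≤ ENNReal.ofReal (4 * (Real.pi * (d / 2) ^ 2) * t) := by
            refine ENNReal.ofReal_le_ofReal ?_
            have : d ^ 2 * 1 ≤ d ^ 2 * Real.pi := by gcongr; linarith [Real.pi_gt_three]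
            gcongr
            linarith
        _ = ENNReal.ofReal 4 * (ENNReal.ofReal (Real.pi * (d / 2) ^ 2) * ‖h z₀‖ₑ) := by
            rw [← ofReal_norm, ← ENNReal.ofReal_mul (by positivity),
              ← ENNReal.ofReal_mul (by positivity)]
            congr 1; ring
        _ ≤ ENNReal.ofReal 4 * (ENNReal.ofReal (4 ^ (1 / p - 1) * t ^ (1 - p)) * I) := by gcongr
        _ = _ := by
            rw [← mul_assoc, ← mul_assoc, ← ENNReal.ofReal_mul (by positivity), ← mul_assoc,
              ENNReal.ofReal_mul (by positivity), mul_comm (ENNReal.ofReal (4 * _))]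
            congr 2
            rw [Real.rpow_sub_one (by norm_num), mul_div_cancel₀ _ (by norm_num),
              ← ENNReal.ofReal_rpow_of_pos (by norm_num)]
            norm_num
    exact (ENNReal.mul_le_mul_iff_right (by simpa using ht1) ENNReal.ofReal_ne_top).1 h1
  refine le_trans ?_ hfin
  rw [← ofReal_norm, ENNReal.ofReal_rpow_of_nonneg (norm_nonneg _) hp.le,
    ← ENNReal.ofReal_mul (by positivity)]
  exact ENNReal.ofReal_le_ofReal (by linarith)

lemma exists_enorm_rpow_mul_le_lintegral {p : ℝ} (hp : 0 < p) :
    ∃ C : ℝ≥0, ∀ {h : ℂ → ℂ} {c : ℂ} {R : ℝ}, 0 < R →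
      DifferentiableOn ℂ h (Metric.closedBall c R) →
      ENNReal.ofReal (R ^ 2) * ‖h c‖ₑ ^ p ≤ C * ∫⁻ z in Metric.ball c R, ‖h z‖ₑ ^ p := by
  obtain ⟨n, hn⟩ := exists_nat_gt p
  have hn0 : (0 : ℝ) < n := hp.trans hn
  have htop : (4 : ℝ≥0∞) ^ (1 / (p / n)) ≠ ⊤ :=
    ENNReal.rpow_ne_top_of_nonneg (by positivity) (by norm_num)
  refine ⟨((4 : ℝ≥0∞) ^ (1 / (p / n))).toNNReal, fun {h c R} hR hh => ?_⟩
  rw [ENNReal.coe_toNNReal htop]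
  -- For large exponents, `|h|^p = |h^n|^(p/n)` with `p / n ≤ 1` and `h^n` analytic.
  have h1 := enorm_rpow_mul_le_lintegral_closedBall (p := p / n) (by positivity)
    ((div_le_one hn0).2 hn.le) hR (hh.pow n)
  have h2 : ∀ z, ‖(h ^ n) z‖ₑ ^ (p / n) = ‖h z‖ₑ ^ p := fun z => by
    rw [Pi.pow_apply, enorm_pow, ← ENNReal.rpow_natCast, ← ENNReal.rpow_mul]
    congr 1; field_simp
  simpa only [h2] using h1

/-! ### The Volterra operator as an embedding problem -/

lemma isOpen_unitDisk : IsOpen unitDisk := Metric.isOpen_ball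

lemma mem_unitDisk {z : ℂ} : z ∈ unitDisk ↔ ‖z‖ < 1 := by simp [unitDisk]

/-- The integrand `f g'` has a primitive `F` on the disk with `F 0 = 0`; the fundamental theorem of
calculus along the segment identifies `volterra g f` with `F` there. -/
lemma volterra_spec {f g : ℂ → ℂ} (hf : f ∈ analyticDisk) (hg : g ∈ analyticDisk) :
    volterra g f ∈ analyticDisk ∧ volterra g f 0 = 0 ∧
      ∀ z ∈ unitDisk, deriv (volterra g f) z = f z * deriv g z := by
  have hfg : DifferentiableOn ℂ (fun z => f z * deriv g z) unitDisk :=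
    DifferentiableOn.mul hf (DifferentiableOn.deriv hg isOpen_unitDisk)
  obtain ⟨F, hF0, hF⟩ := (DifferentiableOn.isExactOn_ball hfg).with_val_at 0 0
  have heq : ∀ z ∈ unitDisk, volterra g f z = F z := by
    intro z hz
    have hmem : ∀ t ∈ uIcc (0 : ℝ) 1, (t : ℂ) * z ∈ unitDisk := by
      intro t ht
      rw [uIcc_of_le zero_le_one] at ht
      rw [mem_unitDisk] at hz ⊢
      rw [norm_mul, Complex.norm_real, Real.norm_of_nonneg ht.1]
      exact lt_of_le_of_lt (mul_le_of_le_one_left (norm_nonneg _) ht.2) hz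
    have hder : ∀ t ∈ uIcc (0 : ℝ) 1, HasDerivAt (fun t : ℝ => F (t * z))
        (f (t * z) * deriv g (t * z) * z) t := by
      intro t ht
      have h1 : HasDerivAt (fun w : ℂ => F (w * z)) (f (t * z) * deriv g (t * z) * z) (t : ℂ) := by
        have := (hF _ (hmem t ht)).comp (t : ℂ) (hasDerivAt_mul_const z)
        exact this
      exact h1.comp_ofReal
    have hcont : ContinuousOn (fun t : ℝ => f (t * z) * deriv g (t * z) * z) (uIcc 0 1) := by
      refine ContinuousOn.mul ?_ continuousOn_const
      exact hfg.continuousOn.comp (by fun_prop) hmem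
    have := intervalIntegral.integral_eq_sub_of_hasDerivAt hder hcont.intervalIntegrable
    simpa [volterra, hF0] using this
  have hev : ∀ z ∈ unitDisk, volterra g f =ᶠ[nhds z] F := fun z hz =>
    Filter.eventuallyEq_of_mem (isOpen_unitDisk.mem_nhds hz) heq
  refine ⟨fun z hz => ?_, by simp [volterra], fun z hz => ?_⟩
  · exact ((hF z hz).congr_of_eventuallyEq (hev z hz)).differentiableAt.differentiableWithinAt
  · exact ((hF z hz).congr_of_eventuallyEq (hev z hz)).deriv

lemma measurable_weight (α : ℝ) : Measurable (weight α) := by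
  unfold weight
  fun_prop

lemma ae_areaMeasure_mem : ∀ᵐ z ∂areaMeasure, z ∈ unitDisk :=
  Measure.ae_smul_measure (ae_restrict_mem isOpen_unitDisk.measurableSet) _

lemma lintegral_volterraMeasure {q : ℝ} (hq : 0 < q) (β : ℝ) (g : ℂ → ℂ) (F : ℂ → ℝ≥0∞) :
    ∫⁻ z, F z ∂volterraMeasure g q β = ∫⁻ z, weight β z * ‖deriv g z‖ₑ ^ q * F z ∂areaMeasure := by
  rw [volterraMeasure, lintegral_withDensity_eq_lintegral_mul_non_measurable]
  · rfl
  · exact (measurable_weight β).mul ((measurable_deriv g).enorm.pow_const q)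
  · refine Filter.Eventually.of_forall fun z => ENNReal.mul_lt_top ENNReal.ofReal_lt_top ?_
    exact ENNReal.rpow_lt_top_of_nonneg hq.le enorm_ne_top

lemma dirichletNorm_volterra {q : ℝ} (hq : 0 < q) (β : ℝ) {f g : ℂ → ℂ} (hf : f ∈ analyticDisk)
    (hg : g ∈ analyticDisk) :
    dirichletNorm q β (volterra g f) = (∫⁻ z, ‖f z‖ₑ ^ q ∂volterraMeasure g q β) ^ (1 / q) := by
  obtain ⟨_, h0, hd⟩ := volterra_spec hf hg
  rw [dirichletNorm, h0, lintegral_volterraMeasure hq, enorm_zero, ENNReal.zero_rpow_of_pos hq,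
    zero_add]
  congr 1
  refine lintegral_congr_ae (ae_areaMeasure_mem.mono fun z hz => ?_)
  simp only []
  rw [hd z hz, enorm_mul, ENNReal.mul_rpow_of_nonneg _ _ hq.le]
  ring

/-- The operator is bounded if and only if the Dirichlet space embeds into `L^q(μ)`. -/
lemma isBoundedOperator_volterra_iff {q : ℝ} (hq : 0 < q) (p α β : ℝ) {g : ℂ → ℂ}
    (hg : g ∈ analyticDisk) :
    IsBoundedOperator (volterra g) p α q β ↔ ∃ C : ℝ≥0, ∀ f ∈ dirichletSpace p α,
      ∫⁻ z, ‖f z‖ₑ ^ q ∂volterraMeasure g q β ≤ C * dirichletNorm p α f ^ q := by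
  have key : ∀ (C : ℝ≥0) (f : ℂ → ℂ), f ∈ analyticDisk →
      (dirichletNorm q β (volterra g f) ≤ C * dirichletNorm p α f ↔
      ∫⁻ z, ‖f z‖ₑ ^ q ∂volterraMeasure g q β ≤ (C ^ q : ℝ≥0) * dirichletNorm p α f ^ q) := by
    intro C f hf
    rw [dirichletNorm_volterra hq β hf hg, one_div, ENNReal.rpow_inv_le_iff hq,
      ENNReal.mul_rpow_of_nonneg _ _ hq.le, ENNReal.coe_rpow_of_nonneg _ hq.le]
  constructor
  · rintro ⟨C, hC⟩
    exact ⟨C ^ q, fun f hf => (key C f hf.1).1 (hC f hf).2⟩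
  · rintro ⟨C, hC⟩
    refine ⟨C ^ (1 / q), fun f hf => ?_⟩
    have h1 : dirichletNorm q β (volterra g f) ≤ (C ^ (1 / q) : ℝ≥0) * dirichletNorm p α f := by
      rw [key _ f hf.1, ← NNReal.rpow_mul, one_div_mul_cancel hq.ne', NNReal.rpow_one]
      exact hC f hf
    exact ⟨⟨(volterra_spec hf.1 hg).1, h1.trans_lt (ENNReal.mul_lt_top ENNReal.coe_lt_top hf.2)⟩,
        h1⟩

lemma volterraMeasure_univ {q : ℝ} (hq : 0 < q) (β : ℝ) (g : ℂ → ℂ) :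
    volterraMeasure g q β univ = ∫⁻ z, ‖deriv g z‖ₑ ^ q * weight β z ∂areaMeasure := by
  have := lintegral_volterraMeasure hq β g (fun _ => 1)
  simp only [lintegral_const, one_mul, mul_one] at this
  rw [this]
  exact lintegral_congr fun z => mul_comm _ _

lemma isFiniteMeasure_volterraMeasure_iff {q : ℝ} (hq : 0 < q) (β : ℝ) {g : ℂ → ℂ}
    (hg : g ∈ analyticDisk) :
    IsFiniteMeasure (volterraMeasure g q β) ↔ g ∈ dirichletSpace q β := by
  rw [isFiniteMeasure_iff, volterraMeasure_univ hq, dirichletSpace]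
  change _ ↔ g ∈ analyticDisk ∧ _
  rw [and_iff_right hg, dirichletNorm, ENNReal.rpow_lt_top_iff_of_pos (by positivity),
    ENNReal.add_lt_top, and_iff_right (ENNReal.rpow_lt_top_of_nonneg hq.le enorm_ne_top)]

lemma dirichletNorm_const_one {p : ℝ} (hp : 0 < p) (α : ℝ) :
    (fun _ => 1) ∈ dirichletSpace p α ∧ dirichletNorm p α (fun _ => 1) = 1 := by
  have : dirichletNorm p α (fun _ => 1) = 1 := by simp [dirichletNorm, hp]
  exact ⟨⟨differentiableOn_const _, by rw [this]; simp⟩, this⟩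

/-- Test the embedding on the constant function `1`. -/
lemma isFiniteMeasure_of_isBoundedOperator {p q α β : ℝ} (hp : 0 < p) (hq : 0 < q) {g : ℂ → ℂ}
    (hg : g ∈ analyticDisk) (h : IsBoundedOperator (volterra g) p α q β) :
    IsFiniteMeasure (volterraMeasure g q β) := by
  obtain ⟨C, hC⟩ := (isBoundedOperator_volterra_iff hq p α β hg).1 h
  obtain ⟨h1, h2⟩ := dirichletNorm_const_one hp α
  have := hC _ h1
  rw [h2] at this
  rw [isFiniteMeasure_iff]
  simp only [enorm_one, ENNReal.one_rpow, lintegral_const, one_mul, mul_one] at this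
  exact this.trans_lt ENNReal.coe_lt_top

/-! ### Exponential coordinates on the disk -/

/-- The covering map of the punctured disk by the upper half plane. -/
def cover (ζ : ℂ) : ℂ := Complex.exp (2 * Real.pi * Complex.I * ζ)

/-- The angular coordinate, in `[0, 1)`. -/
def discX (z : ℂ) : ℝ := Int.fract (Complex.arg z / (2 * Real.pi))

/-- The coordinate in the direction of the radius, positive on the punctured disk. -/
def discY (z : ℂ) : ℝ := -Real.log ‖z‖ / (2 * Real.pi)

lemma norm_cover (ζ : ℂ) : ‖cover ζ‖ = Real.exp (-(2 * Real.pi * ζ.im)) := by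
  rw [cover, Complex.norm_exp]
  congr 1
  simp

lemma norm_cover_lt_one {ζ : ℂ} (h : 0 < ζ.im) : ‖cover ζ‖ < 1 := by
  rw [norm_cover, Real.exp_lt_one_iff]
  have := Real.pi_pos
  simp only [Left.neg_neg_iff]
  positivity

lemma cover_discX_discY {z : ℂ} (hz : z ≠ 0) : cover ⟨discX z, discY z⟩ = z := by
  have h1 : 2 * Real.pi * Complex.I * (⟨discX z, discY z⟩ : ℂ) =
      (Real.log ‖z‖ : ℂ) + Complex.arg z * Complex.I
        - (⌊Complex.arg z / (2 * Real.pi)⌋ : ℤ) * (2 * Real.pi * Complex.I) := by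
    rw [Complex.mk_eq_add_mul_I, discX, discY, Int.fract]
    push_cast
    field_simp
    ring_nf
    rw [Complex.I_sq]
    ring
  rw [cover, h1, Complex.exp_sub, Complex.exp_int_mul_two_pi_mul_I, div_one, Complex.exp_add,
    ← Complex.ofReal_exp, Real.exp_log (norm_pos_iff.2 hz), Complex.norm_mul_exp_arg_mul_I]

lemma hasDerivAt_cover (ζ : ℂ) : HasDerivAt cover (2 * Real.pi * Complex.I * cover ζ) ζ := by
  have := (hasDerivAt_const_mul (x := ζ) (2 * Real.pi * Complex.I)).cexp
  rw [mul_comm]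
  exact this

lemma injOn_cover (a : ℝ) : InjOn cover {ζ | ζ.re ∈ Ico a (a + 1)} := by
  intro ζ hζ ξ hξ h
  obtain ⟨n, hn⟩ := Complex.exp_eq_exp_iff_exists_int.1 h
  have h2 : (2 * Real.pi * Complex.I : ℂ) ≠ 0 := Complex.two_pi_I_ne_zero
  have h3 : ζ = ξ + n := by
    refine mul_left_cancel₀ h2 ?_
    rw [hn]; ring
  have h4 : ζ.re = ξ.re + n := by rw [h3]; simp
  have h5 : (n : ℝ) < 1 := by have := hζ.2; have := hξ.1; linarith
  have h6 : (-1 : ℝ) < n := by have := hζ.1; have := hξ.2; linarith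
  have h7 : n = 0 := by
    have h5' : n < 1 := by exact_mod_cast h5
    have h6' : -1 < n := by exact_mod_cast h6
    omega
  rw [h3, h7]; simp

/-- Change of variables: `cover` is injective on a vertical strip of width one and its real Jacobian
is `|cover'|² = (2π |cover|)²`. The factor `π` undoes the normalization of the area. -/
lemma lintegral_cover_le (a : ℝ) (G : ℂ → ℝ≥0∞) {S : Set ℂ} (hS : MeasurableSet S)
    (hSa : ∀ ζ ∈ S, ζ.re ∈ Ico a (a + 1) ∧ 0 < ζ.im) :
    ∫⁻ ζ in S, ENNReal.ofReal ((2 * Real.pi * ‖cover ζ‖) ^ 2) * G (cover ζ) ≤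
      ENNReal.ofReal Real.pi * ∫⁻ z, G z ∂areaMeasure := by
  have h1 : ∀ ζ ∈ S, HasFDerivWithinAt cover
      ((ContinuousLinearMap.toSpanSingleton ℂ
        (2 * Real.pi * Complex.I * cover ζ)).restrictScalars ℝ) S ζ := fun ζ _ =>
    (hasDerivAt_cover ζ).hasFDerivAt.restrictScalars ℝ |>.hasFDerivWithinAt
  have h2 := lintegral_image_eq_lintegral_abs_det_fderiv_mul volume hS h1
    ((injOn_cover a).mono fun ζ hζ => (hSa ζ hζ).1) G
  have h3 : ∀ w : ℂ, ((ContinuousLinearMap.toSpanSingleton ℂ w).restrictScalars ℝ).det = ‖w‖ ^ 2 :=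
      by
    intro w
    have : (((ContinuousLinearMap.toSpanSingleton ℂ w).restrictScalars ℝ : ℂ →L[ℝ] ℂ) : ℂ →ₗ[ℝ] ℂ)
        = (LinearMap.toSpanSingleton ℂ ℂ w).restrictScalars ℝ := rfl
    rw [ContinuousLinearMap.det, this, LinearMap.det_restrictScalars, Algebra.norm_complex_eq]
    simp [Complex.normSq_eq_norm_sq]
  have h4 : cover '' S ⊆ unitDisk := by
    rintro _ ⟨ζ, hζ, rfl⟩
    exact mem_unitDisk.2 (norm_cover_lt_one (hSa ζ hζ).2)
  calc ∫⁻ ζ in S, ENNReal.ofReal ((2 * Real.pi * ‖cover ζ‖) ^ 2) * G (cover ζ)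
      = ∫⁻ z in cover '' S, G z := by
        rw [h2]
        refine lintegral_congr fun ζ => ?_
        rw [h3, abs_of_nonneg (by positivity)]
        simp [abs_of_pos Real.pi_pos]
    _ ≤ ∫⁻ z in unitDisk, G z := lintegral_mono_set h4
    _ = _ := by
        rw [areaMeasure, lintegral_smul_measure, smul_eq_mul, ← mul_assoc,
          ENNReal.mul_inv_cancel (by simpa using Real.pi_pos) ENNReal.ofReal_ne_top, one_mul]

/-- The angular cell of generation `k`. -/
def discCell (k : ℕ) (z : ℂ) : ℕ := ⌊2 ^ k * discX z⌋₊

/-- The generation of a point, determined by `2⁻¹ ^ (n + 1) < discY z ≤ 2⁻¹ ^ n`. -/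
def discGen (z : ℂ) : ℕ := ⌊Real.logb 2 (1 / discY z)⌋₊

/-- The part of the disk that the tree covers. -/
def outerDisk : Set ℂ := {z | 0 < discY z ∧ discY z ≤ 1}

lemma discX_mem (z : ℂ) : discX z ∈ Ico (0 : ℝ) 1 := ⟨Int.fract_nonneg _, Int.fract_lt_one _⟩

lemma discCell_zero (z : ℂ) : discCell 0 z = 0 := by
  rw [discCell, pow_zero, one_mul, Nat.floor_eq_zero]
  exact (discX_mem z).2

lemma discCell_succ_div_two (k : ℕ) (z : ℂ) : discCell (k + 1) z / 2 = discCell k z := by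
  rw [discCell, discCell]
  have := Nat.floor_div_natCast (2 ^ (k + 1) * discX z) 2
  rw [← this]
  congr 1
  push_cast
  ring

lemma discCell_lt (k : ℕ) (z : ℂ) : discCell k z < 2 ^ k := by
  rw [discCell, Nat.floor_lt (by have := (discX_mem z).1; positivity)]
  push_cast
  exact mul_lt_of_lt_one_right (by positivity) (discX_mem z).2

lemma discCell_mem (k : ℕ) (z : ℂ) :
    (discCell k z : ℝ) / 2 ^ k ≤ discX z ∧ discX z < (discCell k z + 1) / 2 ^ k := by
  have h0 : 0 ≤ 2 ^ k * discX z := by have := (discX_mem z).1; positivity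
  constructor
  · rw [div_le_iff₀ (by positivity), mul_comm]
    exact Nat.floor_le h0
  · rw [lt_div_iff₀ (by positivity), mul_comm]
    exact Nat.lt_floor_add_one _

/-- On `outerDisk` the logarithm in `discGen` is nonnegative, so the natural-number floor is the
true floor. -/
lemma le_discGen_iff {z : ℂ} (hz : z ∈ outerDisk) (k : ℕ) : k ≤ discGen z ↔ discY z ≤ 2⁻¹ ^ k := by
  have h1 : 0 ≤ Real.logb 2 (1 / discY z) :=
    Real.logb_nonneg one_lt_two ((one_le_div hz.1).2 hz.2)
  rw [discGen, Nat.le_floor_iff h1, Real.le_logb_iff_rpow_le one_lt_two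
      (by have := hz.1; positivity),
    Real.rpow_natCast, le_div_comm₀ (by positivity) hz.1, inv_pow, one_div]

lemma measurable_discX : Measurable discX := by
  unfold discX
  exact measurable_fract.comp (Complex.measurable_arg.div_const _)

lemma measurable_discY : Measurable discY := by
  unfold discY
  fun_prop

lemma measurableSet_outerDisk : MeasurableSet outerDisk :=
  (measurableSet_lt measurable_const measurable_discY).inter
    (measurableSet_le measurable_discY measurable_const)

lemma measurableSet_treeCell_disc (k j : ℕ) : MeasurableSet (treeCell discGen discCell k j) := by
  have h1 : Measurable discGen := by
    unfold discGen Real.logb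
    have := measurable_discY
    fun_prop
  have h2 : Measurable (discCell k) := by
    unfold discCell
    have := measurable_discX
    fun_prop
  exact (h1 measurableSet_Ici).inter (h2 (measurableSet_singleton j))

lemma mem_outerDisk {z : ℂ} (hz : z ∈ outerDisk) : z ≠ 0 ∧ z ∈ unitDisk := by
  have h0 : z ≠ 0 := by
    rintro rfl
    have := hz.1
    simp [discY] at this
  refine ⟨h0, ?_⟩
  rw [← cover_discX_discY h0]
  exact mem_unitDisk.2 (norm_cover_lt_one hz.1)

lemma norm_le_half_of_one_le_im {ζ : ℂ} (h : 1 ≤ ζ.im) : ‖cover ζ‖ ≤ 1 / 2 := by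
  rw [norm_cover, Real.exp_neg, ← one_div]
  refine one_div_le_one_div_of_le (by norm_num) ?_
  have h1 := Real.add_one_le_exp (2 * Real.pi * ζ.im)
  have := Real.pi_gt_three
  nlinarith

lemma norm_le_half_of_not_mem_outerDisk {z : ℂ} (hz : z ∈ unitDisk) (h : z ∉ outerDisk) :
    ‖z‖ ≤ 1 / 2 := by
  rcases eq_or_ne z 0 with h0 | h0
  · simp [h0]
  have h1 : 0 < discY z := by
    have := Real.log_neg (norm_pos_iff.2 h0) (mem_unitDisk.1 hz)
    have := Real.pi_pos
    exact div_pos (by linarith) (by positivity)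
  have h2 : 1 ≤ discY z := by
    by_contra h3
    exact h ⟨h1, (not_le.1 h3).le⟩
  rw [← cover_discX_discY h0]
  exact norm_le_half_of_one_le_im h2

/-! ### Whitney decomposition -/

/-- The Whitney box of generation `k` and index `j` in the upper half plane. -/
def whitneyBox (k j : ℕ) : Set ℂ :=
  {ζ | ζ.re ∈ Icc ((j : ℝ) / 2 ^ k) ((j + 1) / 2 ^ k) ∧ ζ.im ∈ Icc ((2 : ℝ)⁻¹ ^ (k + 1)) (2⁻¹ ^ k)}

/-- The enlarged Whitney box. -/
def whitneyBoxEnlarged (k j : ℕ) : Set ℂ :=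
  {ζ | ζ.re ∈ Ico (((j : ℝ) - 1) / 2 ^ k) ((j + 2) / 2 ^ k) ∧
    ζ.im ∈ Icc ((2 : ℝ)⁻¹ ^ k / 4) (2⁻¹ ^ k * 2)}

/-- The oscillation of `f` on the image of a Whitney box. -/
def whitneyOsc (f : ℂ → ℂ) (k j : ℕ) : ℝ≥0∞ :=
  if j < 2 ^ k then
    ENNReal.ofReal (2⁻¹ ^ k) * ⨆ ζ ∈ whitneyBox k j, ‖deriv f (cover ζ) * (2 * Real.pi * cover ζ)‖ₑ
  else 0

lemma hasDerivAt_comp_cover {f : ℂ → ℂ} (hf : f ∈ analyticDisk) {ζ : ℂ} (hζ : 0 < ζ.im) :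
    HasDerivAt (fun ζ => f (cover ζ)) (deriv f (cover ζ) *
        (2 * Real.pi * Complex.I * cover ζ)) ζ := by
  have h1 : DifferentiableAt ℂ f (cover ζ) :=
    DifferentiableOn.differentiableAt hf
      (isOpen_unitDisk.mem_nhds (mem_unitDisk.2 (norm_cover_lt_one hζ)))
  exact h1.hasDerivAt.comp ζ (hasDerivAt_cover ζ)

lemma enorm_mul_two_pi_I (w z : ℂ) :
    ‖w * (2 * Real.pi * Complex.I * z)‖ₑ = ‖w * (2 * Real.pi * z)‖ₑ := by
  have h : ‖Complex.I‖ₑ = 1 := by rw [← ofReal_norm]; simp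
  simp [enorm_mul, h]

lemma im_pos_of_mem_whitneyBox {k j : ℕ} {ζ : ℂ} (h : ζ ∈ whitneyBox k j) : 0 < ζ.im :=
  lt_of_lt_of_le (by positivity) h.2.1

/-- Mean value inequality for `f ∘ cover` on the convex box: the two points lie on a vertical
segment of length at most `2⁻¹ ^ k`. -/
lemma enorm_cover_le_add_whitneyOsc {f : ℂ → ℂ} (hf : f ∈ analyticDisk) {k j : ℕ} (hj : j < 2 ^ k)
    {x y₁ y₂ : ℝ} (hx : x ∈ Icc ((j : ℝ) / 2 ^ k) ((j + 1) / 2 ^ k))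
    (h₁ : y₁ ∈ Icc ((2 : ℝ)⁻¹ ^ (k + 1)) (2⁻¹ ^ k))
        (h₂ : y₂ ∈ Icc ((2 : ℝ)⁻¹ ^ (k + 1)) (2⁻¹ ^ k)) :
    ‖f (cover ⟨x, y₁⟩)‖ₑ ≤ ‖f (cover ⟨x, y₂⟩)‖ₑ + whitneyOsc f k j := by
  rw [whitneyOsc, if_pos hj]
  set S := ⨆ ζ ∈ whitneyBox k j, ‖deriv f (cover ζ) * (2 * Real.pi * cover ζ)‖ₑ with hS
  rcases eq_or_ne S ⊤ with htop | htop
  · rw [htop, ENNReal.mul_top (by simp), add_top]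
    exact le_top
  have hconv : Convex ℝ (whitneyBox k j) := by
    have : whitneyBox k j = Complex.reLm ⁻¹' (Icc ((j : ℝ) / 2 ^ k) ((j + 1) / 2 ^ k)) ∩
      Complex.imLm ⁻¹' (Icc ((2 : ℝ)⁻¹ ^ (k + 1)) (2⁻¹ ^ k)) := rfl
    rw [this]
    exact ((convex_Icc _ _).linear_preimage _).inter ((convex_Icc _ _).linear_preimage _)
  have hle : ∀ ζ ∈ whitneyBox k j,
      ‖deriv f (cover ζ) * (2 * Real.pi * Complex.I * cover ζ)‖ ≤ S.toReal := by
    intro ζ hζ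
    rw [← toReal_enorm, enorm_mul_two_pi_I]
    refine ENNReal.toReal_mono htop ?_
    exact le_iSup₂ (f := fun ζ _ => ‖deriv f (cover ζ) * (2 * Real.pi * cover ζ)‖ₑ) ζ hζ
  have hmv := hconv.norm_image_sub_le_of_norm_hasDerivWithin_le
    (fun ζ hζ => (hasDerivAt_comp_cover hf (im_pos_of_mem_whitneyBox hζ)).hasDerivWithinAt) hle
    (x := ⟨x, y₂⟩) (y := ⟨x, y₁⟩) ⟨hx, h₂⟩ ⟨hx, h₁⟩
  have hdist : ‖(⟨x, y₁⟩ : ℂ) - ⟨x, y₂⟩‖ ≤ 2⁻¹ ^ k := by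
    have : (⟨x, y₁⟩ : ℂ) - ⟨x, y₂⟩ = ((y₁ - y₂ : ℝ) : ℂ) * Complex.I := by
      apply Complex.ext <;> simp
    rw [this, norm_mul, Complex.norm_I, mul_one, Complex.norm_real, Real.norm_eq_abs, abs_le]
    have h3 : (0 : ℝ) ≤ 2⁻¹ ^ (k + 1) := by positivity
    constructor <;> linarith [h₁.1, h₁.2, h₂.1, h₂.2]
  have h4 : ‖f (cover ⟨x, y₁⟩) - f (cover ⟨x, y₂⟩)‖ₑ ≤ ENNReal.ofReal (2⁻¹ ^ k) * S := by
    rw [← ENNReal.ofReal_toReal htop, ← ENNReal.ofReal_mul (by positivity), ← ofReal_norm]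
    refine ENNReal.ofReal_le_ofReal (hmv.trans ?_)
    rw [mul_comm]
    gcongr
  calc ‖f (cover ⟨x, y₁⟩)‖ₑ = ‖f (cover ⟨x, y₂⟩) + (f (cover ⟨x, y₁⟩) - f (cover ⟨x, y₂⟩))‖ₑ := by
        congr 1; ring
    _ ≤ _ := (enorm_add_le _ _).trans (by gcongr)

/-- Descend vertically from height `1` through the heights `2⁻¹ ^ n` to the height of `z`. Each step
stays in the box of the ancestor cell of its generation. -/
lemma enorm_le_add_sum_whitneyOsc {f : ℂ → ℂ} (hf : f ∈ analyticDisk) {z : ℂ} (hz : z ∈ outerDisk) :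
    ‖f z‖ₑ ≤ ‖f (cover ⟨discX z, 1⟩)‖ₑ +
      ∑ k ∈ Finset.range (discGen z + 1), whitneyOsc f k (discCell k z) := by
  have hx : ∀ k, discX z ∈ Icc ((discCell k z : ℝ) / 2 ^ k) ((discCell k z + 1) / 2 ^ k) := fun k =>
    ⟨(discCell_mem k z).1, (discCell_mem k z).2.le⟩
  have hpow : ∀ k : ℕ, (2 : ℝ)⁻¹ ^ (k + 1) ≤ 2⁻¹ ^ k := fun k =>
    pow_le_pow_of_le_one (by norm_num) (by norm_num) (Nat.le_succ k)
  have hstep : ∀ n, ‖f (cover ⟨discX z, 2⁻¹ ^ n⟩)‖ₑ ≤ ‖f (cover ⟨discX z, 1⟩)‖ₑ +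
      ∑ k ∈ Finset.range n, whitneyOsc f k (discCell k z) := by
    intro n
    induction n with
    | zero => simp
    | succ n ih =>
      rw [Finset.sum_range_succ, ← add_assoc]
      exact (enorm_cover_le_add_whitneyOsc hf (discCell_lt n z) (hx n) ⟨le_rfl, hpow n⟩
        ⟨hpow n, le_rfl⟩).trans (add_le_add ih le_rfl)
  rw [Finset.sum_range_succ, ← add_assoc]
  nth_rewrite 1 [← cover_discX_discY (mem_outerDisk hz).1]
  refine (enorm_cover_le_add_whitneyOsc hf (discCell_lt (discGen z) z) (hx _) ⟨?_, ?_⟩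
        ⟨hpow _, le_rfl⟩).trans (add_le_add (hstep _) le_rfl)
  · by_contra h
    have := (le_discGen_iff hz (discGen z + 1)).2 (not_le.1 h).le
    omega
  · exact (le_discGen_iff hz _).1 le_rfl

lemma rpow_le_mul_rpow_of_comparable {x y K : ℝ} (hx : 0 < x) (hy : 0 < y) (hK : 1 ≤ K)
    (hxy : x ≤ K * y) (hyx : y ≤ K * x) (α : ℝ) : x ^ α ≤ K ^ |α| * y ^ α := by
  have hK0 : 0 < K := by linarith
  rcases le_total 0 α with h | h
  · rw [abs_of_nonneg h, ← Real.mul_rpow hK0.le hy.le]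
    exact Real.rpow_le_rpow hx.le hxy h
  · have h1 : y / K ≤ x := by rw [div_le_iff₀ hK0]; linarith
    rw [abs_of_nonpos h]
    calc x ^ α ≤ (y / K) ^ α := Real.rpow_le_rpow_of_nonpos (by positivity) h1 h
      _ = _ := by rw [Real.div_rpow hy.le hK0.le, Real.rpow_neg hK0.le]; field_simp

lemma ball_subset_whitneyBoxEnlarged {k j : ℕ} {ζ : ℂ} (hζ : ζ ∈ whitneyBox k j) :
    Metric.ball ζ (2⁻¹ ^ k / 4) ⊆ whitneyBoxEnlarged k j := by
  intro w hw
  have h1 := mem_ball_iff_norm.1 hw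
  have hre := abs_lt.1 ((Complex.abs_re_le_norm (w - ζ)).trans_lt h1)
  have him := abs_lt.1 ((Complex.abs_im_le_norm (w - ζ)).trans_lt h1)
  simp only [Complex.sub_re, Complex.sub_im] at hre him
  obtain ⟨⟨ha, hb⟩, hc, hd⟩ := hζ
  have h2 : (2 : ℝ)⁻¹ ^ k = 1 / 2 ^ k := by rw [inv_pow, one_div]
  have h3 : (2 : ℝ)⁻¹ ^ (k + 1) = 2⁻¹ ^ k / 2 := by rw [pow_succ]; ring
  have e1 : ((j : ℝ) - 1) / 2 ^ k = j / 2 ^ k - 2⁻¹ ^ k := by rw [h2]; ring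
  have e2 : ((j : ℝ) + 2) / 2 ^ k = (j + 1) / 2 ^ k + 2⁻¹ ^ k := by rw [h2]; ring
  refine ⟨⟨?_, ?_⟩, ?_, ?_⟩
  · rw [e1]; linarith
  · rw [e2]; linarith
  · linarith
  · linarith

/-- The sub-mean value property on balls of radius `2⁻¹ ^ k / 4`, which stay in the enlarged box,
where `ζ.im` is comparable to `2⁻¹ ^ k`. -/
lemma exists_whitneyOsc_rpow_le {p : ℝ} (hp : 0 < p) (α : ℝ) :
    ∃ C : ℝ≥0, ∀ f ∈ analyticDisk, ∀ k j : ℕ,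
      ENNReal.ofReal ((2 : ℝ) ^ (-(k * (α + 2 - p)))) * whitneyOsc f k j ^ p ≤
        if j < 2 ^ k then C * ∫⁻ ζ in whitneyBoxEnlarged k j,
          ‖deriv f (cover ζ) * (2 * Real.pi * cover ζ)‖ₑ ^ p * ENNReal.ofReal (ζ.im ^ α) else 0 :=
            by
  obtain ⟨C, hC⟩ := exists_enorm_rpow_mul_le_lintegral hp
  refine ⟨(16 * 4 ^ |α| : ℝ).toNNReal * C, fun f hf k j => ?_⟩
  rw [whitneyOsc]
  split_ifs with hj
  swap
  · simp [hp]
  set F : ℂ → ℂ := fun ζ => deriv f (cover ζ) * (2 * Real.pi * cover ζ) with hF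
  set J := ∫⁻ ζ in whitneyBoxEnlarged k j, ‖F ζ‖ₑ ^ p * ENNReal.ofReal (ζ.im ^ α) with hJ
  have hFd : DifferentiableOn ℂ F {ζ | 0 < ζ.im} := by
    intro ζ hζ
    have h1 : DifferentiableAt ℂ (deriv f) (cover ζ) :=
      (DifferentiableOn.deriv hf isOpen_unitDisk).differentiableAt
        (isOpen_unitDisk.mem_nhds (mem_unitDisk.2 (norm_cover_lt_one hζ)))
    have h2 := (hasDerivAt_cover ζ).differentiableAt
    exact ((h1.comp ζ h2).mul (h2.const_mul (2 * Real.pi : ℂ))).differentiableWithinAt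
  have hr : (0 : ℝ) < 2⁻¹ ^ k := by positivity
  set r : ℝ := 2⁻¹ ^ k with hrdef
  have h2r : (2 : ℝ) ^ (-(k : ℝ)) = r := by
    rw [hrdef, Real.rpow_neg (by norm_num), Real.rpow_natCast, inv_pow]
  have hball : ∀ ζ ∈ whitneyBox k j,
      ENNReal.ofReal (r ^ 2) * ‖F ζ‖ₑ ^ p ≤ 16 * C * ∫⁻ ζ in whitneyBoxEnlarged k j, ‖F ζ‖ₑ ^ p :=
        by
    intro ζ hζ
    have hsub := ball_subset_whitneyBoxEnlarged hζ
    have h1 : DifferentiableOn ℂ F (Metric.closedBall ζ (r / 4)) := by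
      refine hFd.mono fun w hw => ?_
      have h2 := (Complex.abs_im_le_norm (w - ζ)).trans (mem_closedBall_iff_norm.1 hw)
      have h3 := (abs_le.1 h2).1
      have h4 := hζ.2.1
      rw [pow_succ] at h4
      simp only [Complex.sub_im] at h3
      change 0 < w.im
      linarith
    calc ENNReal.ofReal (r ^ 2) * ‖F ζ‖ₑ ^ p
        = 16 * (ENNReal.ofReal ((r / 4) ^ 2) * ‖F ζ‖ₑ ^ p) := by
          rw [← mul_assoc, show (16 : ℝ≥0∞) = ENNReal.ofReal 16 by simp,
            ← ENNReal.ofReal_mul (by norm_num)]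
          congr 2; ring
      _ ≤ 16 * (C * ∫⁻ ζ in Metric.ball ζ (r / 4), ‖F ζ‖ₑ ^ p) :=
          mul_le_mul_right (hC (by positivity) h1) _
      _ ≤ 16 * (C * ∫⁻ ζ in whitneyBoxEnlarged k j, ‖F ζ‖ₑ ^ p) := by gcongr
      _ = _ := by rw [mul_assoc]
  have hsup : ENNReal.ofReal (r ^ 2) * (⨆ ζ ∈ whitneyBox k j, ‖F ζ‖ₑ) ^ p ≤
      16 * C * ∫⁻ ζ in whitneyBoxEnlarged k j, ‖F ζ‖ₑ ^ p := by
    have h0 : ENNReal.ofReal (r ^ 2) ≠ 0 := by simpa using hr.ne'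
    rw [mul_comm, ← ENNReal.le_div_iff_mul_le (Or.inl h0) (Or.inl ENNReal.ofReal_ne_top),
      ← ENNReal.le_rpow_inv_iff hp]
    refine iSup₂_le fun ζ hζ => ?_
    rw [ENNReal.le_rpow_inv_iff hp, ENNReal.le_div_iff_mul_le (Or.inl h0)
      (Or.inl ENNReal.ofReal_ne_top), mul_comm]
    exact hball ζ hζ
  have hweight : ENNReal.ofReal (r ^ α) * ∫⁻ ζ in whitneyBoxEnlarged k j, ‖F ζ‖ₑ ^ p ≤
      ENNReal.ofReal (4 ^ |α|) * J := by
    rw [← lintegral_const_mul' _ _ ENNReal.ofReal_ne_top, hJ,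
      ← lintegral_const_mul' _ _ ENNReal.ofReal_ne_top]
    have hm : MeasurableSet (whitneyBoxEnlarged k j) :=
      (Complex.measurable_re measurableSet_Ico).inter (Complex.measurable_im measurableSet_Icc)
    refine setLIntegral_mono' hm fun ζ hζ => ?_
    have h1 : 0 < ζ.im := lt_of_lt_of_le (by positivity) hζ.2.1
    have h2 := rpow_le_mul_rpow_of_comparable hr h1 (by norm_num : (1 : ℝ) ≤ 4)
      (by linarith [hζ.2.1]) (by linarith [hζ.2.2]) α
    calc ENNReal.ofReal (r ^ α) * ‖F ζ‖ₑ ^ p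
        ≤ ENNReal.ofReal (4 ^ |α| * ζ.im ^ α) * ‖F ζ‖ₑ ^ p := by gcongr
      _ = _ := by rw [ENNReal.ofReal_mul (by positivity)]; ring
  -- With `r = 2^(-k)`, the tree weight times the `r^p` from the oscillation is the Dirichlet weight
  -- `r^α` times the area factor `r^2`.
  have hexp : (2 : ℝ) ^ (-(k * (α + 2 - p))) * r ^ p = r ^ α * r ^ 2 := by
    have : (2 : ℝ) ^ (-(k * (α + 2 - p))) = r ^ (α + 2 - p) := by
      rw [← h2r, ← Real.rpow_mul (by norm_num)]
      congr 1; ring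
    rw [this, ← Real.rpow_natCast r 2, ← Real.rpow_add hr, ← Real.rpow_add hr]
    congr 1
    push_cast
    ring
  calc ENNReal.ofReal ((2 : ℝ) ^ (-(k * (α + 2 - p)))) *
        (ENNReal.ofReal r * ⨆ ζ ∈ whitneyBox k j, ‖F ζ‖ₑ) ^ p
      = ENNReal.ofReal (r ^ α) * (ENNReal.ofReal (r ^ 2) * (⨆ ζ ∈ whitneyBox k j, ‖F ζ‖ₑ) ^ p) := by
        rw [ENNReal.mul_rpow_of_nonneg _ _ hp.le, ENNReal.ofReal_rpow_of_pos hr, ← mul_assoc,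
          ← ENNReal.ofReal_mul (by positivity), hexp, ← mul_assoc,
          ENNReal.ofReal_mul (by positivity)]
    _ ≤ ENNReal.ofReal (r ^ α) * (16 * C * ∫⁻ ζ in whitneyBoxEnlarged k j, ‖F ζ‖ₑ ^ p) := by gcongr
    _ = 16 * C * (ENNReal.ofReal (r ^ α) * ∫⁻ ζ in whitneyBoxEnlarged k j, ‖F ζ‖ₑ ^ p) := by ring
    _ ≤ 16 * C * (ENNReal.ofReal (4 ^ |α|) * J) := by gcongr
    _ = _ := by
      rw [ENNReal.coe_mul]
      change _ = ENNReal.ofReal (16 * 4 ^ |α|) * _ * _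
      rw [ENNReal.ofReal_mul (by norm_num)]
      norm_num
      ring

/-- A family of sets with bounded overlap along the naturals. -/
lemma tsum_indicator_le_of_diff_lt {s : Set ℕ} {m : ℕ} (hs : ∀ i ∈ s, ∀ j ∈ s, j < i + m)
    (c : ℝ≥0∞) : ∑' i, s.indicator (fun _ => c) i ≤ m * c := by
  classical
  rcases s.eq_empty_or_nonempty with h | h
  · simp [h]
  set n := sInf s with hn
  have hmem : n ∈ s := Nat.sInf_mem h
  rw [tsum_eq_sum (s := Finset.Ico n (n + m))]
  · refine (Finset.sum_le_card_nsmul _ _ c fun i _ => ?_).trans (by simp)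
    exact indicator_le_self' (fun _ _ => zero_le) i
  · intro i hi
    refine indicator_of_notMem (fun his => hi ?_) _
    exact Finset.mem_Ico.2 ⟨Nat.sInf_le his, hs n hmem i his⟩

/-- The part of the vertical strip over `[a, b)` below height two. -/
def lowStrip (a b : ℝ) : Set ℂ := {ζ | ζ.re ∈ Ico a b ∧ ζ.im ∈ Ioc 0 2}

lemma measurableSet_lowStrip (a b : ℝ) : MeasurableSet (lowStrip a b) :=
  (Complex.measurable_re measurableSet_Ico).inter (Complex.measurable_im measurableSet_Ioc)

lemma measurableSet_whitneyBoxEnlarged (k j : ℕ) : MeasurableSet (whitneyBoxEnlarged k j) :=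
  (Complex.measurable_re measurableSet_Ico).inter (Complex.measurable_im measurableSet_Icc)

/-- Within a generation at most three enlarged boxes contain a given point, and only four
consecutive generations can reach its height; hence `12 = 3 * 4`. The restriction `j < 2 ^ k` keeps
all boxes over `[-1, 2)`. -/
lemma tsum_whitneyBoxEnlarged_indicator_le (G : ℂ → ℝ≥0∞) (ζ : ℂ) :
    ∑' k, ∑' j, (if j < 2 ^ k then (whitneyBoxEnlarged k j).indicator G ζ else 0) ≤
      12 * (lowStrip (-1) 2).indicator G ζ := by
  set c := (lowStrip (-1) 2).indicator G ζ with hc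
  set T : Set ℕ := {k | ζ.im ∈ Icc ((2 : ℝ)⁻¹ ^ k / 4) (2⁻¹ ^ k * 2)} with hT
  have hin : ∀ k, ∑' j, (if j < 2 ^ k then (whitneyBoxEnlarged k j).indicator G ζ else 0) ≤
      T.indicator (fun _ => 3 * c) k := by
    intro k
    set s : Set ℕ := {j | j < 2 ^ k ∧ ζ ∈ whitneyBoxEnlarged k j} with hs
    have h2k : (0 : ℝ) < 2 ^ k := by positivity
    by_cases hk : k ∈ T
    · rw [indicator_of_mem hk]
      have hdiff : ∀ i ∈ s, ∀ j ∈ s, j < i + 3 := by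
        intro i hi j hj
        have h1 := hj.2.1.1
        have h2 := hi.2.1.2
        have h3 := h1.trans_lt h2
        rw [div_lt_div_iff_of_pos_right h2k] at h3
        have h4 : (j : ℝ) < i + 3 := by linarith
        exact_mod_cast h4
      refine le_trans (ENNReal.tsum_le_tsum fun j => ?_) (tsum_indicator_le_of_diff_lt hdiff c)
      split_ifs with hj
      · by_cases hζ : ζ ∈ whitneyBoxEnlarged k j
        · have hmem : j ∈ s := ⟨hj, hζ⟩
          rw [indicator_of_mem hζ, indicator_of_mem hmem, hc, indicator_of_mem]
          have hj' : (j : ℝ) + 1 ≤ 2 ^ k := by exact_mod_cast hj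
          have h1 : (1 : ℝ) ≤ 2 ^ k := one_le_pow₀ one_le_two
          have h3 : (2 : ℝ)⁻¹ ^ k ≤ 1 := pow_le_one₀ (by norm_num) (by norm_num)
          refine ⟨⟨le_trans ?_ hζ.1.1, lt_of_lt_of_le hζ.1.2 ?_⟩, lt_of_lt_of_le ?_ hζ.2.1,
            hζ.2.2.trans ?_⟩
          · rw [le_div_iff₀ h2k]
            have : (0 : ℝ) ≤ j := Nat.cast_nonneg j
            linarith
          · rw [div_le_iff₀ h2k]; linarith
          · positivity
          · linarith
        · rw [indicator_of_notMem hζ]; exact zero_le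
      · exact zero_le
    · rw [indicator_of_notMem hk]
      refine le_of_eq (ENNReal.tsum_eq_zero.2 fun j => ?_)
      split_ifs with hj
      · exact indicator_of_notMem (fun h => hk h.2) _
      · rfl
  have hdiff : ∀ i ∈ T, ∀ j ∈ T, j < i + 4 := by
    intro i hi j hj
    by_contra hlt
    have h1 := hi.1.trans hj.2
    have h2 : (2 : ℝ)⁻¹ ^ j ≤ 2⁻¹ ^ (i + 4) :=
      pow_le_pow_of_le_one (by norm_num) (by norm_num) (by omega)
    rw [pow_add] at h2
    have h3 : (0 : ℝ) < 2⁻¹ ^ i := by positivity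
    rw [show (2 : ℝ)⁻¹ ^ 4 = 1 / 16 by norm_num] at h2
    linarith
  calc _ ≤ ∑' k, T.indicator (fun _ => 3 * c) k := ENNReal.tsum_le_tsum hin
    _ ≤ (4 : ℕ) * (3 * c) := tsum_indicator_le_of_diff_lt hdiff _
    _ = 12 * c := by rw [← mul_assoc]; norm_num

/-- The integral part of the norm, without the value at the origin. -/
def dirichletIntegral (p α : ℝ) (f : ℂ → ℂ) : ℝ≥0∞ :=
  ∫⁻ z, ‖deriv f z‖ₑ ^ p * weight α z ∂areaMeasure

lemma dirichletNorm_rpow {p : ℝ} (hp : 0 < p) (α : ℝ) (f : ℂ → ℂ) :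
    dirichletNorm p α f ^ p = ‖f 0‖ₑ ^ p + dirichletIntegral p α f := by
  rw [dirichletNorm, ← ENNReal.rpow_mul, one_div_mul_cancel hp.ne', ENNReal.rpow_one]
  rfl

/-- `‖cover ζ‖² = exp(-t)` with `t = 4π ζ.im ≤ 8π`, and `t / (1 + t) ≤ 1 - exp(-t) ≤ t`. -/
lemma one_sub_norm_cover_sq_comparable {ζ : ℂ} (h : ζ.im ∈ Ioc 0 2) :
    0 < 1 - ‖cover ζ‖ ^ 2 ∧ ζ.im ≤ (1 + 8 * Real.pi) * (1 - ‖cover ζ‖ ^ 2) ∧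
      1 - ‖cover ζ‖ ^ 2 ≤ (1 + 8 * Real.pi) * ζ.im := by
  obtain ⟨h0, h2⟩ := h
  have hpi := Real.pi_gt_three
  set t := 4 * Real.pi * ζ.im with ht
  have ht0 : 0 < t := by positivity
  have hE : ‖cover ζ‖ ^ 2 = Real.exp (-t) := by
    rw [norm_cover, ← Real.exp_nat_mul]
    congr 1; push_cast; ring
  have h1 : Real.exp (-t) ≤ 1 / (1 + t) := by
    rw [Real.exp_neg, ← one_div]
    exact one_div_le_one_div_of_le (by positivity) (by linarith [Real.add_one_le_exp t])
  have h3 : 1 - t ≤ Real.exp (-t) := by linarith [Real.add_one_le_exp (-t)]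
  have h4 : t / (1 + t) ≤ 1 - Real.exp (-t) := by
    have : t / (1 + t) = 1 - 1 / (1 + t) := by field_simp; ring
    linarith
  have h5 : 0 < t / (1 + t) := by positivity
  have ht8 : t ≤ 8 * Real.pi := by rw [ht]; nlinarith
  rw [hE]
  refine ⟨by linarith, ?_, ?_⟩
  · calc ζ.im ≤ t := by rw [ht]; nlinarith
      _ = (1 + t) * (t / (1 + t)) := by field_simp
      _ ≤ (1 + 8 * Real.pi) * (1 - Real.exp (-t)) := by gcongr
  · calc 1 - Real.exp (-t) ≤ t := by linarith
      _ ≤ _ := by rw [ht]; gcongr; linarith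

/-- Below height two, `ζ.im` is comparable to `1 - |z|²` and `|z| ≥ exp(-4π)`, so up to constants
the integrand is the Dirichlet density times the Jacobian of `cover`. -/
lemma exists_lintegral_lowStrip_le (p α : ℝ) (hp : 0 < p) :
    ∃ C : ℝ≥0, ∀ (f : ℂ → ℂ) (a : ℝ), ∫⁻ ζ in lowStrip a (a + 1),
      ‖deriv f (cover ζ) * (2 * Real.pi * cover ζ)‖ₑ ^ p * ENNReal.ofReal (ζ.im ^ α) ≤
        C * dirichletIntegral p α f := by
  set K : ℝ := (2 * Real.pi) ^ p * (1 + 8 * Real.pi) ^ |α| /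
      (2 * Real.pi * Real.exp (-(4 * Real.pi))) ^ 2
    with hK
  have hK0 : 0 ≤ K := by positivity
  refine ⟨(K * Real.pi).toNNReal, fun f a => ?_⟩
  have hpt : ∀ ζ ∈ lowStrip a (a + 1),
      ‖deriv f (cover ζ) * (2 * Real.pi * cover ζ)‖ₑ ^ p * ENNReal.ofReal (ζ.im ^ α) ≤
      ENNReal.ofReal K * (ENNReal.ofReal ((2 * Real.pi * ‖cover ζ‖) ^ 2) *
        (‖deriv f (cover ζ)‖ₑ ^ p * weight α (cover ζ))) := by
    intro ζ hζ
    obtain ⟨hw0, hw1, hw2⟩ := one_sub_norm_cover_sq_comparable hζ.2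
    have hpi := Real.pi_pos
    have hα := rpow_le_mul_rpow_of_comparable hζ.2.1 hw0 (by linarith) hw1 hw2 α
    have hpos : 0 ≤ ζ.im ^ α := Real.rpow_nonneg hζ.2.1.le α
    have he1 : ‖cover ζ‖ ≤ 1 := (norm_cover_lt_one hζ.2.1).le
    have he2 : Real.exp (-(4 * Real.pi)) ≤ ‖cover ζ‖ := by
      rw [norm_cover]
      refine Real.exp_le_exp.2 ?_
      have := hζ.2.2
      nlinarith
    have hreal : (2 * Real.pi * ‖cover ζ‖) ^ p * ζ.im ^ α ≤
        K * ((2 * Real.pi * ‖cover ζ‖) ^ 2 * (1 - ‖cover ζ‖ ^ 2) ^ α) := by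
      have h1 : (2 * Real.pi * ‖cover ζ‖) ^ p ≤ (2 * Real.pi) ^ p :=
        Real.rpow_le_rpow (by positivity) (mul_le_of_le_one_right (by positivity) he1) hp.le
      have h2 : 1 ≤ (2 * Real.pi * ‖cover ζ‖) ^ 2 /
        (2 * Real.pi * Real.exp (-(4 * Real.pi))) ^ 2 := by
        rw [one_le_div (by positivity)]
        gcongr
      calc (2 * Real.pi * ‖cover ζ‖) ^ p * ζ.im ^ α
          ≤ (2 * Real.pi) ^ p * ((1 + 8 * Real.pi) ^ |α| * (1 - ‖cover ζ‖ ^ 2) ^ α) * 1 := by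
            rw [mul_one]
            gcongr
        _ ≤ (2 * Real.pi) ^ p * ((1 + 8 * Real.pi) ^ |α| * (1 - ‖cover ζ‖ ^ 2) ^ α) *
            ((2 * Real.pi * ‖cover ζ‖) ^ 2 / (2 * Real.pi * Real.exp (-(4 * Real.pi))) ^ 2) := by
            gcongr
        _ = _ := by rw [hK]; ring
    have hen : ‖(2 * Real.pi * cover ζ : ℂ)‖ₑ = ENNReal.ofReal (2 * Real.pi * ‖cover ζ‖) := by
      rw [← ofReal_norm]
      congr 1
      simp [abs_of_pos hpi]
    rw [enorm_mul, ENNReal.mul_rpow_of_nonneg _ _ hp.le, hen,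
      ENNReal.ofReal_rpow_of_nonneg (by positivity) hp.le, mul_assoc,
      ← ENNReal.ofReal_mul (by positivity), weight]
    calc _ ≤ ‖deriv f (cover ζ)‖ₑ ^ p * ENNReal.ofReal
          (K * ((2 * Real.pi * ‖cover ζ‖) ^ 2 * (1 - ‖cover ζ‖ ^ 2) ^ α)) := by gcongr
      _ = _ := by
        rw [ENNReal.ofReal_mul hK0, ENNReal.ofReal_mul (by positivity)]
        ring
  refine (setLIntegral_mono' (measurableSet_lowStrip _ _) hpt).trans ?_
  rw [lintegral_const_mul' _ _ ENNReal.ofReal_ne_top]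
  change _ ≤ ENNReal.ofReal (K * Real.pi) * _
  rw [ENNReal.ofReal_mul hK0, mul_assoc]
  exact mul_le_mul_right (lintegral_cover_le a (fun z => ‖deriv f z‖ₑ ^ p * weight α z)
    (measurableSet_lowStrip _ _) fun ζ hζ => ⟨hζ.1, hζ.2.1⟩) _

lemma exists_tsum_whitneyOsc_le {p : ℝ} (hp : 0 < p) (α : ℝ) :
    ∃ C : ℝ≥0, ∀ f ∈ analyticDisk,
      ∑' k : ℕ, ∑' j, ENNReal.ofReal ((2 : ℝ) ^ (-(k * (α + 2 - p)))) * whitneyOsc f k j ^ p ≤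
        C * dirichletIntegral p α f := by
  obtain ⟨C₁, h₁⟩ := exists_whitneyOsc_rpow_le hp α
  obtain ⟨C₂, h₂⟩ := exists_lintegral_lowStrip_le p α hp
  refine ⟨C₁ * (12 * (3 * C₂)), fun f hf => ?_⟩
  set G : ℂ → ℝ≥0∞ := fun ζ =>
    ‖deriv f (cover ζ) * (2 * Real.pi * cover ζ)‖ₑ ^ p * ENNReal.ofReal (ζ.im ^ α) with hG
  have hcov : Measurable cover :=
    (continuous_iff_continuousAt.2 fun ζ => (hasDerivAt_cover ζ).continuousAt).measurable
  have hGm : Measurable G := by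
    have := (measurable_deriv f).comp hcov
    exact (((this.mul (hcov.const_mul _)).enorm).pow_const p).mul
      (Complex.measurable_im.pow_const α).ennreal_ofReal
  have hm : ∀ k j, Measurable fun ζ =>
      (if j < 2 ^ k then (whitneyBoxEnlarged k j).indicator G ζ else 0) := fun k j => by
    split_ifs
    · exact hGm.indicator (measurableSet_whitneyBoxEnlarged k j)
    · exact measurable_const
  -- Three strips of width one, since `cover` is injective only on such strips.
  have hstrip : lowStrip (-1) 2 = (lowStrip (-1) (-1 + 1) ∪ lowStrip 0 (0 + 1)) ∪ lowStrip 1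
      (1 + 1) := by
    ext ζ
    have h1 : ∀ a b : ℝ, ζ ∈ lowStrip a b ↔ (a ≤ ζ.re ∧ ζ.re < b) ∧ ζ.im ∈ Ioc 0 2 :=
        fun a b => Iff.rfl
    simp only [mem_union, h1]
    constructor
    · rintro ⟨⟨ha, hb⟩, hc⟩
      rcases lt_or_ge ζ.re 0 with h | h
      · exact Or.inl (Or.inl ⟨⟨ha, by linarith⟩, hc⟩)
      rcases lt_or_ge ζ.re 1 with h' | h'
      · exact Or.inl (Or.inr ⟨⟨h, by linarith⟩, hc⟩)
      · exact Or.inr ⟨⟨h', by linarith⟩, hc⟩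
    · rintro ((⟨⟨ha, hb⟩, hc⟩ | ⟨⟨ha, hb⟩, hc⟩) | ⟨⟨ha, hb⟩, hc⟩) <;>
        exact ⟨⟨by linarith, by linarith⟩, hc⟩
  calc ∑' k : ℕ, ∑' j, ENNReal.ofReal ((2 : ℝ) ^ (-(k * (α + 2 - p)))) * whitneyOsc f k j ^ p
      ≤ ∑' k : ℕ, ∑' j, C₁ * ∫⁻ ζ, (if j < 2 ^ k then
        (whitneyBoxEnlarged k j).indicator G ζ else 0) := by
        refine ENNReal.tsum_le_tsum fun k => ENNReal.tsum_le_tsum fun j => ?_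
        refine (h₁ f hf k j).trans ?_
        split_ifs
        · rw [lintegral_indicator (measurableSet_whitneyBoxEnlarged k j)]
        · simp
    _ = C₁ * ∫⁻ ζ, ∑' k : ℕ, ∑' j,
          (if j < 2 ^ k then (whitneyBoxEnlarged k j).indicator G ζ else 0) := by
        rw [lintegral_tsum fun k => (Measurable.tsum (hm k)).aemeasurable,
          ← ENNReal.tsum_mul_left]
        refine tsum_congr fun k => ?_
        rw [lintegral_tsum fun j => (hm k j).aemeasurable, ENNReal.tsum_mul_left]
    _ ≤ C₁ * ∫⁻ ζ, 12 * (lowStrip (-1) 2).indicator G ζ := by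
        gcongr with ζ
        exact tsum_whitneyBoxEnlarged_indicator_le G ζ
    _ = C₁ * (12 * ∫⁻ ζ in lowStrip (-1) 2, G ζ) := by
        rw [lintegral_const_mul' _ _ (by norm_num),
          lintegral_indicator (measurableSet_lowStrip _ _)]
    _ ≤ C₁ * (12 * (3 * (C₂ * dirichletIntegral p α f))) := by
        gcongr
        rw [hstrip]
        refine (lintegral_union_le _ _ _).trans
          ((add_le_add (lintegral_union_le _ _ _) le_rfl).trans ?_)
        refine (add_le_add (add_le_add (h₂ f (-1)) (h₂ f 0)) (h₂ f 1)).trans (le_of_eq ?_)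
        ring
    _ = _ := by push_cast; ring

/-- The sub-mean value property on balls of radius `1/4` bounds `f'` on the half disk, since the
weight is bounded below for `|z| ≤ 3/4`. Integrating from `0` then bounds `f`. -/
lemma exists_enorm_le_of_norm_le_half {p : ℝ} (hp : 0 < p) (α : ℝ) :
    ∃ C : ℝ≥0, ∀ f ∈ analyticDisk, ∀ z, ‖z‖ ≤ 1 / 2 → ‖f z‖ₑ ≤ C * dirichletNorm p α f := by
  obtain ⟨C, hC⟩ := exists_enorm_rpow_mul_le_lintegral hp
  set K : ℝ≥0 := 16 * C * (4 ^ |α| * Real.pi).toNNReal with hK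
  refine ⟨1 + K ^ (1 / p), fun f hf z hz => ?_⟩
  have hder : ∀ w, ‖w‖ ≤ 1 / 2 → ‖deriv f w‖ₑ ^ p ≤ K * dirichletIntegral p α f := by
    intro w hw
    have hsub : Metric.closedBall w (1 / 4) ⊆ {z | ‖z‖ ≤ 3 / 4} := fun y hy => by
      have h1 := mem_closedBall_iff_norm.1 hy
      have h2 : ‖y‖ ≤ ‖y - w‖ + ‖w‖ := by simpa using norm_add_le (y - w) w
      change ‖y‖ ≤ 3 / 4
      linarith
    have hsub2 : Metric.closedBall w (1 / 4) ⊆ unitDisk := fun y hy => by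
      have : ‖y‖ ≤ 3 / 4 := hsub hy
      exact mem_unitDisk.2 (by linarith)
    have h1 := hC (R := 1 / 4) (by norm_num)
      ((DifferentiableOn.deriv hf isOpen_unitDisk).mono hsub2)
    have h2 : ∀ y ∈ Metric.ball w (1 / 4), ‖deriv f y‖ₑ ^ p ≤
        ENNReal.ofReal (4 ^ |α|) * (‖deriv f y‖ₑ ^ p * weight α y) := by
      intro y hy
      have hy1 : ‖y‖ ≤ 3 / 4 := hsub (Metric.ball_subset_closedBall hy)
      have hy0 := norm_nonneg y
      have h3 := rpow_le_mul_rpow_of_comparable one_pos (y := 1 - ‖y‖ ^ 2) (K := 4)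
        (by nlinarith) (by norm_num) (by nlinarith) (by nlinarith) α
      rw [Real.one_rpow] at h3
      calc ‖deriv f y‖ₑ ^ p = ‖deriv f y‖ₑ ^ p * ENNReal.ofReal 1 := by simp
        _ ≤ ‖deriv f y‖ₑ ^ p * ENNReal.ofReal (4 ^ |α| * (1 - ‖y‖ ^ 2) ^ α) := by gcongr
        _ = _ := by rw [weight, ENNReal.ofReal_mul (by positivity)]; ring
    have h4 : ∫⁻ y in Metric.ball w (1 / 4), ‖deriv f y‖ₑ ^ p ≤
        ENNReal.ofReal (4 ^ |α|) * (ENNReal.ofReal Real.pi * dirichletIntegral p α f) := by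
      refine (setLIntegral_mono' Metric.isOpen_ball.measurableSet h2).trans ?_
      rw [lintegral_const_mul' _ _ ENNReal.ofReal_ne_top]
      gcongr
      rw [dirichletIntegral, areaMeasure, lintegral_smul_measure, smul_eq_mul, ← mul_assoc,
          ENNReal.mul_inv_cancel (by simpa using Real.pi_pos) ENNReal.ofReal_ne_top, one_mul]
      exact lintegral_mono_set (Metric.ball_subset_closedBall.trans hsub2)
    calc ‖deriv f w‖ₑ ^ p = 16 * (ENNReal.ofReal ((1 / 4) ^ 2) * ‖deriv f w‖ₑ ^ p) := by
          rw [← mul_assoc, show (16 : ℝ≥0∞) = ENNReal.ofReal 16 by simp,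
            ← ENNReal.ofReal_mul (by norm_num)]
          norm_num
      _ ≤ 16 * (C * (ENNReal.ofReal (4 ^ |α|) *
        (ENNReal.ofReal Real.pi * dirichletIntegral p α f))) :=
          mul_le_mul_right (h1.trans (mul_le_mul_right h4 _)) _
      _ = _ := by
          rw [hK, ENNReal.coe_mul, ENNReal.coe_mul]
          change _ = _ * ENNReal.ofReal _ * _
          rw [ENNReal.ofReal_mul (by positivity)]
          push_cast
          ring
  set N := dirichletNorm p α f with hN
  have hNp := dirichletNorm_rpow hp α f
  have h0 : ‖f 0‖ₑ ≤ N := by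
    rw [← ENNReal.rpow_le_rpow_iff hp, hNp]
    exact le_self_add
  have hI : dirichletIntegral p α f ≤ N ^ p := by rw [hNp]; exact le_add_self
  rcases eq_or_ne N ⊤ with htop | htop
  · rw [htop, ENNReal.mul_top (by simp)]; exact le_top
  set M : ℝ≥0∞ := (K ^ (1 / p) : ℝ≥0) * N with hM
  have hMtop : M ≠ ⊤ := ENNReal.mul_ne_top ENNReal.coe_ne_top htop
  have hder2 : ∀ w ∈ Metric.closedBall (0 : ℂ) (1 / 2), ‖deriv f w‖ ≤ M.toReal := by
    intro w hw
    rw [← toReal_enorm]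
    refine ENNReal.toReal_mono hMtop ?_
    rw [← ENNReal.rpow_le_rpow_iff hp, hM, ENNReal.mul_rpow_of_nonneg _ _ hp.le,
      ← ENNReal.coe_rpow_of_nonneg _ hp.le, ← NNReal.rpow_mul, one_div_mul_cancel hp.ne',
        NNReal.rpow_one]
    refine (hder w (by simpa using hw)).trans ?_
    gcongr
  have hmv := (convex_closedBall (0 : ℂ) (1 / 2)).norm_image_sub_le_of_norm_deriv_le
    (f := f) (fun w hw => by
      refine DifferentiableOn.differentiableAt hf (isOpen_unitDisk.mem_nhds (mem_unitDisk.2 ?_))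
      have : ‖w‖ ≤ 1 / 2 := by simpa using hw
      linarith) hder2 (x := 0) (y := z) (by simp) (by simpa using hz)
  have h5 : ‖f z - f 0‖ₑ ≤ M := by
    rw [← ENNReal.ofReal_toReal hMtop, ← ofReal_norm]
    refine ENNReal.ofReal_le_ofReal (hmv.trans ?_)
    rw [sub_zero]
    exact mul_le_of_le_one_right ENNReal.toReal_nonneg (by linarith)
  calc ‖f z‖ₑ = ‖f 0 + (f z - f 0)‖ₑ := by congr 1; ring
    _ ≤ N + M := (enorm_add_le _ _).trans (add_le_add h0 h5)
    _ = _ := by rw [hM]; push_cast; ring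

/-- Functions in the Dirichlet space are dominated by sums along the dyadic tree. -/
theorem exists_tree_majorant {p : ℝ} (hp : 0 < p) (α : ℝ) :
    ∃ C : ℝ≥0, ∀ f ∈ analyticDisk,
      (∑' k : ℕ, ∑' j, ENNReal.ofReal ((2 : ℝ) ^ (-(k * (α + 2 - p)))) * whitneyOsc f k j ^ p ≤
        C * dirichletNorm p α f ^ p) ∧
      (∀ z ∈ outerDisk, ‖f z‖ₑ ≤ C * dirichletNorm p α f +
        ∑ k ∈ Finset.range (discGen z + 1), whitneyOsc f k (discCell k z)) ∧
      (∀ z ∈ unitDisk, z ∉ outerDisk → ‖f z‖ₑ ≤ C * dirichletNorm p α f) := by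
  obtain ⟨C₁, h₁⟩ := exists_tsum_whitneyOsc_le hp α
  obtain ⟨C₂, h₂⟩ := exists_enorm_le_of_norm_le_half hp α
  refine ⟨max C₁ C₂, fun f hf => ⟨(h₁ f hf).trans ?_, fun z hz => ?_, fun z hz hz' => ?_⟩⟩
  · rw [dirichletNorm_rpow hp]
    gcongr
    · exact le_max_left _ _
    · exact le_add_self
  · refine (enorm_le_add_sum_whitneyOsc hf hz).trans (add_le_add ?_ le_rfl)
    refine (h₂ f hf _ (norm_le_half_of_one_le_im le_rfl)).trans ?_
    gcongr
    exact le_max_right _ _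
  · refine (h₂ f hf z (norm_le_half_of_not_mem_outerDisk hz hz')).trans ?_
    gcongr
    exact le_max_right _ _

/-! ### Sufficiency of the Carleson conditions -/

lemma ae_volterraMeasure_mem (g : ℂ → ℂ) (q β : ℝ) : ∀ᵐ z ∂volterraMeasure g q β, z ∈ unitDisk :=
  (withDensity_absolutelyContinuous _ _).ae_le ae_areaMeasure_mem

lemma isArc_Icc {l : ℝ} (h0 : 0 < l) (h1 : l ≤ 1) (a : ℝ) :
    IsArc ((fun t : ℝ => Complex.exp (t * Complex.I)) '' Icc a (a + 2 * Real.pi * l)) l :=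
  ⟨h0, h1, a, _, Ioo_subset_Icc_self, subset_rfl, rfl⟩

lemma mem_carlesonSquare_Icc {l a t : ℝ} {z : ℂ} (hz : z ∈ unitDisk) (hzl : 1 - l ≤ ‖z‖)
    (ht : t ∈ Icc a (a + 2 * Real.pi * l)) (hzt : z = ‖z‖ * Complex.exp (t * Complex.I)) :
    z ∈ carlesonSquare ((fun t : ℝ => Complex.exp (t * Complex.I)) '' Icc a
        (a + 2 * Real.pi * l)) l :=
  ⟨‖z‖, _, ⟨t, ht, rfl⟩, hzl, mem_unitDisk.1 hz, hzt⟩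

/-- The shift by three generations pays for the factor `2π < 8` between `discY` and the distance to
the circle: `1 - |z| ≤ 2π * discY z ≤ 8 * 2⁻¹ ^ (k + 3) = 2⁻¹ ^ k`. -/
lemma treeCell_inter_outerDisk_subset (k j : ℕ) :
    treeCell discGen discCell (k + 3) j ∩ outerDisk ⊆ carlesonSquare
      ((fun t : ℝ => Complex.exp (t * Complex.I)) ''
        Icc (2 * Real.pi * (j / 2 ^ (k + 3)))
          (2 * Real.pi * (j / 2 ^ (k + 3)) + 2 * Real.pi * 2⁻¹ ^ k))
      (2⁻¹ ^ k) := by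
  rintro z ⟨⟨hk, hj⟩, hz⟩
  obtain ⟨hz0, hzD⟩ := mem_outerDisk hz
  have hpi4 := Real.pi_lt_four
  have hy := (le_discGen_iff hz _).1 hk
  obtain ⟨hx1, hx2⟩ := discCell_mem (k + 3) z
  rw [hj] at hx1 hx2
  have h8 : (2 : ℝ)⁻¹ ^ (k + 3) = 2⁻¹ ^ k / 8 := by rw [pow_add]; norm_num; ring
  have hnorm : ‖z‖ = Real.exp (-(2 * Real.pi * discY z)) := by
    nth_rewrite 1 [← cover_discX_discY hz0]
    exact norm_cover _
  refine mem_carlesonSquare_Icc (t := 2 * Real.pi * discX z) hzD ?_ ⟨?_, ?_⟩ ?_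
  · rw [hnorm]
    have := Real.add_one_le_exp (-(2 * Real.pi * discY z))
    rw [h8] at hy
    have h1 : 2 * Real.pi * discY z ≤ 8 * (2⁻¹ ^ k / 8) := by
      have := hz.1
      gcongr
      linarith
    linarith
  · gcongr
  · have h9 : ((j : ℝ) + 1) / 2 ^ (k + 3) = j / 2 ^ (k + 3) + 2⁻¹ ^ k / 8 := by
      rw [← h8, inv_pow]; ring
    rw [h9] at hx2
    rw [← mul_add]
    gcongr
    linarith
  · nth_rewrite 1 [← cover_discX_discY hz0]
    rw [hnorm, Complex.ofReal_exp, ← Complex.exp_add, cover]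
    congr 1
    rw [Complex.mk_eq_add_mul_I]
    push_cast
    ring_nf
    rw [Complex.I_sq]
    ring

lemma unitDisk_subset_carlesonSquare : unitDisk ⊆ carlesonSquare
    ((fun t : ℝ => Complex.exp (t * Complex.I)) '' Icc (-Real.pi)
        (-Real.pi + 2 * Real.pi * 1)) 1 := by
  intro z hz
  refine mem_carlesonSquare_Icc (t := Complex.arg z) hz (by simp) ⟨?_, ?_⟩ ?_
  · exact (Complex.neg_pi_lt_arg z).le
  · linarith [Complex.arg_le_pi z]
  · exact (Complex.norm_mul_exp_arg_mul_I z).symm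

lemma volterraMeasure_univ_le (g : ℂ → ℂ) (q β : ℝ) {s : Set ℂ} (hs : unitDisk ⊆ s) :
    volterraMeasure g q β univ ≤ volterraMeasure g q β s :=
  measure_mono_ae ((ae_volterraMeasure_mem g q β).mono fun _ hz _ => hs hz)

lemma IsCarleson.treeCell_le {g : ℂ → ℂ} {q β s : ℝ} (hs : 0 < s)
    (h : IsCarleson s (volterraMeasure g q β)) :
    ∃ B : ℝ≥0, volterraMeasure g q β univ ≤ B ∧ ∀ k j : ℕ,
      (volterraMeasure g q β).restrict outerDisk (treeCell discGen discCell k j) ≤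
        B * ENNReal.ofReal ((2 : ℝ) ^ (-(k * s))) := by
  obtain ⟨C, hC, h⟩ := h
  have huniv : volterraMeasure g q β univ ≤ ENNReal.ofReal C := by
    have := h _ _ (isArc_Icc one_pos le_rfl (-Real.pi))
    refine (volterraMeasure_univ_le g q β unitDisk_subset_carlesonSquare).trans (this.trans ?_)
    rw [Real.one_rpow, mul_one]
  have h8 : 1 ≤ (8 : ℝ) ^ s := Real.one_le_rpow (by norm_num) hs.le
  -- The factor `8 ^ s` compensates the shift by three generations; the first three generations are
  -- covered by the total mass.
  refine ⟨(C * 8 ^ s).toNNReal, huniv.trans ?_, fun k j => ?_⟩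
  · exact ENNReal.ofReal_le_ofReal (le_mul_of_one_le_right hC.le h8)
  change _ ≤ ENNReal.ofReal _ * _
  rw [← ENNReal.ofReal_mul (by positivity)]
  rw [Measure.restrict_apply (measurableSet_treeCell_disc k j)]
  have hpow : ∀ n : ℕ, (8 : ℝ) ^ s * 2 ^ (-(((n + 3 : ℕ) : ℝ) * s)) = (2⁻¹ ^ n) ^ s := fun n => by
    rw [show (8 : ℝ) = 2 ^ (3 : ℝ) by norm_num, ← Real.rpow_mul (by norm_num),
      ← Real.rpow_add (by norm_num), inv_pow, ← Real.rpow_natCast, ← Real.rpow_neg (by norm_num),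
      ← Real.rpow_mul (by norm_num)]
    congr 1
    push_cast
    ring
  rcases lt_or_ge k 3 with hk | hk
  · refine (measure_mono (subset_univ _)).trans (huniv.trans (ENNReal.ofReal_le_ofReal ?_))
    rw [mul_assoc]
    refine le_mul_of_one_le_right hC.le ?_
    have h1 := hpow 0
    rw [pow_zero, Real.one_rpow] at h1
    rw [← h1]
    gcongr
    norm_num
  · obtain ⟨n, rfl⟩ := Nat.exists_eq_add_of_le' hk
    refine (measure_mono (treeCell_inter_outerDisk_subset n j)).trans ((h _ _
      (isArc_Icc (by positivity) (pow_le_one₀ (by norm_num) (by norm_num)) _)).trans ?_)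
    rw [mul_assoc, hpow]

lemma volterraMeasure_closedBall_lt_top {g : ℂ → ℂ} (hg : g ∈ analyticDisk) {q : ℝ} (hq : 0 < q)
    (β : ℝ) : volterraMeasure g q β (Metric.closedBall 0 (1 / 2)) < ⊤ := by
  have hsub : Metric.closedBall (0 : ℂ) (1 / 2) ⊆ unitDisk :=
    Metric.closedBall_subset_ball (by norm_num)
  have hcont : ContinuousOn (fun z => (1 - ‖z‖ ^ 2) ^ β * ‖deriv g z‖ ^ q)
      (Metric.closedBall (0 : ℂ) (1 / 2)) := by
    refine ContinuousOn.mul (ContinuousOn.rpow_const (by fun_prop) fun z hz => Or.inl ?_)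
      (ContinuousOn.rpow_const ?_ fun z hz => Or.inr hq.le)
    · have := mem_unitDisk.1 (hsub hz)
      have := norm_nonneg z
      nlinarith
    · exact ((DifferentiableOn.deriv hg isOpen_unitDisk).continuousOn.mono hsub).norm
  obtain ⟨M, hM⟩ := (isCompact_closedBall (0 : ℂ) (1 / 2)).bddAbove_image hcont
  rw [volterraMeasure, withDensity_apply _ Metric.isClosed_closedBall.measurableSet]
  have hle : ∀ z ∈ Metric.closedBall (0 : ℂ) (1 / 2), weight β z * ‖deriv g z‖ₑ ^ q ≤
      ENNReal.ofReal M := by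
    intro z hz
    have h1 := hM (mem_image_of_mem _ hz)
    have h2 : 0 ≤ (1 - ‖z‖ ^ 2) ^ β := by
      refine Real.rpow_nonneg ?_ _
      have := mem_unitDisk.1 (hsub hz)
      have := norm_nonneg z
      nlinarith
    rw [weight, ← ofReal_norm, ENNReal.ofReal_rpow_of_nonneg (norm_nonneg _) hq.le,
      ← ENNReal.ofReal_mul h2]
    exact ENNReal.ofReal_le_ofReal h1
  refine (setLIntegral_mono' Metric.isClosed_closedBall.measurableSet hle).trans_lt ?_
  rw [setLIntegral_const]
  refine ENNReal.mul_lt_top ENNReal.ofReal_lt_top ?_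
  rw [areaMeasure, Measure.smul_apply, smul_eq_mul]
  refine ENNReal.mul_lt_top (ENNReal.inv_lt_top.2 (by simpa using Real.pi_pos)) ?_
  exact (Measure.restrict_apply_le _ _).trans_lt (measure_closedBall_lt_top)

lemma unitDisk_subset_half_squares : unitDisk ⊆ Metric.closedBall 0 (1 / 2) ∪
    (carlesonSquare ((fun t : ℝ => Complex.exp (t * Complex.I)) ''
      Icc (-Real.pi) (-Real.pi + 2 * Real.pi * (1 / 2))) (1 / 2) ∪
    carlesonSquare ((fun t : ℝ => Complex.exp (t * Complex.I)) ''
      Icc 0 (0 + 2 * Real.pi * (1 / 2))) (1 / 2)) := by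
  intro z hz
  rcases le_or_gt ‖z‖ (1 / 2) with h | h
  · exact Or.inl (by simpa using h)
  · refine Or.inr ?_
    have hz' := (Complex.norm_mul_exp_arg_mul_I z).symm
    have h1 := Complex.neg_pi_lt_arg z
    have h2 := Complex.arg_le_pi z
    rcases le_total (Complex.arg z) 0 with h3 | h3
    · exact Or.inl (mem_carlesonSquare_Icc hz (by linarith) ⟨h1.le, by linarith⟩ hz')
    · exact Or.inr (mem_carlesonSquare_Icc hz (by linarith) ⟨h3, by linarith⟩ hz')

/-- The condition says nothing about the full circle, so finiteness of the measure comes from a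
compact disk and the squares over two half circles. -/
lemma IsLogCarleson.treeCell_le {g : ℂ → ℂ} (hg : g ∈ analyticDisk) {q β e : ℝ} (hq : 0 < q)
    (he : e < 0) (h : IsLogCarleson e (volterraMeasure g q β)) :
    ∃ B : ℝ≥0, volterraMeasure g q β univ ≤ B ∧ ∀ k j : ℕ,
      (volterraMeasure g q β).restrict outerDisk (treeCell discGen discCell k j) ≤
        B * ENNReal.ofReal (((k : ℝ) + 1) ^ e) := by
  obtain ⟨C, hC, h⟩ := h
  have hfin : volterraMeasure g q β univ < ⊤ := by
    refine (volterraMeasure_univ_le g q β unitDisk_subset_half_squares).trans_lt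
      ((measure_union_le _ _).trans_lt (ENNReal.add_lt_top.2
        ⟨volterraMeasure_closedBall_lt_top hg hq β, (measure_union_le _ _).trans_lt
          (ENNReal.add_lt_top.2 ⟨?_, ?_⟩)⟩))
    · exact (h _ _ (isArc_Icc (by norm_num) (by norm_num) _) (by norm_num)).trans_lt
        ENNReal.ofReal_lt_top
    · exact (h _ _ (isArc_Icc (by norm_num) (by norm_num) _) (by norm_num)).trans_lt
        ENNReal.ofReal_lt_top
  set m := (volterraMeasure g q β univ).toReal with hm
  have hmof : volterraMeasure g q β univ = ENNReal.ofReal m := (ENNReal.ofReal_toReal hfin.ne).symm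
  have hm0 : 0 ≤ m := ENNReal.toReal_nonneg
  have hlog2 : 0 < Real.log 2 := Real.log_pos one_lt_two
  -- The first term serves the generations `k < 4`. The second uses `(n + 1) log 2 ≥ (log 2 / 5) (n
  -- + 5)` for `k = n + 4`; a shift by four, not three, keeps the arc shorter than the circle.
  set B := m * 4 ^ (-e) + C * (Real.log 2 / 5) ^ e with hB
  have h41 : 1 ≤ (4 : ℝ) ^ (-e) := Real.one_le_rpow (by norm_num) (by linarith)
  have hCe : 0 ≤ C * (Real.log 2 / 5) ^ e := by positivity
  have hB0 : 0 ≤ B := by positivity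
  refine ⟨B.toNNReal, ?_, fun k j => ?_⟩
  · rw [hmof]
    refine ENNReal.ofReal_le_ofReal ?_
    have := le_mul_of_one_le_right hm0 h41
    linarith
  change _ ≤ ENNReal.ofReal _ * _
  rw [← ENNReal.ofReal_mul hB0]
  rw [Measure.restrict_apply (measurableSet_treeCell_disc k j)]
  have hk0 : (0 : ℝ) < k + 1 := by positivity
  rcases lt_or_ge k 4 with hk | hk
  · refine (measure_mono (subset_univ _)).trans (hmof.le.trans (ENNReal.ofReal_le_ofReal ?_))
    have h1 : (4 : ℝ) ^ e ≤ ((k : ℝ) + 1) ^ e := by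
      refine Real.rpow_le_rpow_of_nonpos hk0 ?_ he.le
      have : (k : ℝ) + 1 ≤ 4 := by exact_mod_cast hk
      exact this
    have h2 : (4 : ℝ) ^ (-e) * 4 ^ e = 1 := by rw [← Real.rpow_add (by norm_num)]; simp
    calc m = m * 4 ^ (-e) * 4 ^ e := by rw [mul_assoc, h2, mul_one]
      _ ≤ B * ((k : ℝ) + 1) ^ e := by gcongr; linarith
  · obtain ⟨n, rfl⟩ := Nat.exists_eq_add_of_le' hk
    have hl1 : (2 : ℝ)⁻¹ ^ (n + 1) < 1 := pow_lt_one₀ (by norm_num) (by norm_num) (by omega)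
    refine (measure_mono (treeCell_inter_outerDisk_subset (n + 1) j)).trans ((h _ _
      (isArc_Icc (by positivity) hl1.le _) hl1).trans (ENNReal.ofReal_le_ofReal ?_))
    have hlog : Real.log (1 / 2⁻¹ ^ (n + 1)) = (n + 1) * Real.log 2 := by
      rw [inv_pow, one_div, inv_inv, Real.log_pow]; push_cast; rfl
    rw [hlog]
    have h3 : ((n + 1) * Real.log 2) ^ e ≤ (Real.log 2 / 5) ^ e * (((n + 4 : ℕ) : ℝ) + 1) ^ e := by
      rw [← Real.mul_rpow (by positivity) (by positivity)]
      refine Real.rpow_le_rpow_of_nonpos (by positivity) ?_ he.le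
      push_cast
      nlinarith
    calc C * ((n + 1) * Real.log 2) ^ e
        ≤ C * ((Real.log 2 / 5) ^ e * (((n + 4 : ℕ) : ℝ) + 1) ^ e) := by gcongr
      _ = C * (Real.log 2 / 5) ^ e * (((n + 4 : ℕ) : ℝ) + 1) ^ e := by ring
      _ ≤ B * (((n + 4 : ℕ) : ℝ) + 1) ^ e := by
        gcongr
        have : 0 ≤ m * 4 ^ (-e) := by positivity
        linarith

lemma add_rpow_le_two_rpow_mul {q : ℝ} (hq : 0 ≤ q) (a b : ℝ≥0∞) :
    (a + b) ^ q ≤ 2 ^ q * (a ^ q + b ^ q) := by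
  wlog h : a ≤ b generalizing a b
  · rw [add_comm a, add_comm (a ^ q)]
    exact this b a (le_of_not_ge h)
  calc (a + b) ^ q ≤ (2 * b) ^ q := by
        gcongr
        rw [two_mul]
        gcongr
    _ = 2 ^ q * b ^ q := ENNReal.mul_rpow_of_nonneg _ _ hq
    _ ≤ _ := by gcongr; exact le_add_self

/-- The Dirichlet space embeds into `L^q(μ)` if the tree sums do. -/
lemma isBoundedOperator_of_tree {p q α β : ℝ} (hp : 0 < p) (hq : 0 < q) {g : ℂ → ℂ}
    (hg : g ∈ analyticDisk) {B C : ℝ≥0} (hB : volterraMeasure g q β univ ≤ B)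
    (hC : ∀ a : ℕ → ℕ → ℝ≥0∞,
      ∫⁻ z in outerDisk, (∑ k ∈ Finset.range (discGen z + 1), a k (discCell k z)) ^ q
          ∂volterraMeasure g q β ≤
        C * (∑' (k : ℕ), ∑' j, ENNReal.ofReal ((2 : ℝ) ^ (-(k * (α + 2 - p)))) * a k j ^ p) ^
          (q / p)) :
    IsBoundedOperator (volterra g) p α q β := by
  rw [isBoundedOperator_volterra_iff hq p α β hg]
  obtain ⟨D, hD⟩ := exists_tree_majorant hp α
  refine ⟨2 ^ q * (D ^ q * B + C * D ^ (q / p)) + D ^ q * B, fun f hf => ?_⟩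
  obtain ⟨h1, h2, h3⟩ := hD f hf.1
  set N := dirichletNorm p α f with hN
  set μ := volterraMeasure g q β with hμ
  set u : ℂ → ℝ≥0∞ := fun z =>
    ∑ k ∈ Finset.range (discGen z + 1), whitneyOsc f k (discCell k z) with hu
  have hDN : (D * N) ^ q = (D ^ q : ℝ≥0) * N ^ q := by
    rw [ENNReal.mul_rpow_of_nonneg _ _ hq.le, ENNReal.coe_rpow_of_nonneg _ hq.le]
  have hin : ∫⁻ z in outerDisk, ‖f z‖ₑ ^ q ∂μ ≤
      2 ^ q * ((D * N) ^ q * B + C * (D * N ^ p) ^ (q / p)) := by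
    calc ∫⁻ z in outerDisk, ‖f z‖ₑ ^ q ∂μ
        ≤ ∫⁻ z in outerDisk, 2 ^ q * ((D * N) ^ q + u z ^ q) ∂μ := by
          refine setLIntegral_mono' measurableSet_outerDisk fun z hz => ?_
          refine le_trans ?_ (add_rpow_le_two_rpow_mul hq.le _ _)
          gcongr
          exact h2 z hz
      _ = 2 ^ q * ((D * N) ^ q * μ outerDisk + ∫⁻ z in outerDisk, u z ^ q ∂μ) := by
          rw [lintegral_const_mul' _ _ (by finiteness), lintegral_add_left measurable_const,
            setLIntegral_const]
      _ ≤ _ := by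
          have h5 : μ outerDisk ≤ B := (measure_mono (subset_univ _)).trans hB
          have h6 := hC (whitneyOsc f)
          have h7 : ∫⁻ z in outerDisk, u z ^ q ∂μ ≤ C * (D * N ^ p) ^ (q / p) := by
            refine h6.trans ?_
            gcongr
          gcongr
  have hout : ∫⁻ z in outerDiskᶜ, ‖f z‖ₑ ^ q ∂μ ≤ (D * N) ^ q * B := by
    calc ∫⁻ z in outerDiskᶜ, ‖f z‖ₑ ^ q ∂μ ≤ ∫⁻ z in outerDiskᶜ, (D * N) ^ q ∂μ := by
          refine setLIntegral_mono_ae' measurableSet_outerDisk.compl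
            ((ae_volterraMeasure_mem g q β).mono fun z hz hz' => ?_)
          gcongr
          exact h3 z hz hz'
      _ ≤ _ := by
          rw [setLIntegral_const]
          gcongr
          exact (measure_mono (subset_univ _)).trans hB
  rw [← lintegral_add_compl _ measurableSet_outerDisk]
  refine (add_le_add hin hout).trans (le_of_eq ?_)
  have hDNp : (D * N ^ p) ^ (q / p) = (D ^ (q / p) : ℝ≥0) * N ^ q := by
    rw [ENNReal.mul_rpow_of_nonneg _ _ (by positivity),
        ENNReal.coe_rpow_of_nonneg _ (by positivity),
      ← ENNReal.rpow_mul, mul_div_cancel₀ _ hp.ne']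
  have h2q : (2 : ℝ≥0∞) ^ q = ((2 ^ q : ℝ≥0) : ℝ≥0∞) := by
    rw [ENNReal.coe_rpow_of_nonneg _ hq.le]; rfl
  rw [hDN, hDNp, h2q]
  push_cast
  ring

theorem IsCarleson.isBoundedOperator {p q α β : ℝ} (hp : 0 < p) (hpq : p < q) (hpα : p < α + 2)
    {g : ℂ → ℂ} (hg : g ∈ analyticDisk)
    (h : IsCarleson (q * (α + 2 - p) / p) (volterraMeasure g q β)) :
    IsBoundedOperator (volterra g) p α q β := by
  have hq : 0 < q := hp.trans hpq
  have hσ : 0 < (α + 2 - p) / p := div_pos (by linarith) hp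
  obtain ⟨B, hB, hcell⟩ := h.treeCell_le (by have : 0 < α + 2 - p := by linarith
                                             positivity)
  obtain ⟨C, hC⟩ := tree_embedding_geometric hp hpq hσ B
  refine isBoundedOperator_of_tree hp hq hg (C := C) hB fun a => ?_
  have := hC (μ := (volterraMeasure g q β).restrict outerDisk) measurableSet_treeCell_disc
    discCell_zero discCell_succ_div_two (fun k j => by rw [← mul_div_assoc]; exact hcell k j) a
  rwa [mul_div_cancel₀ _ hp.ne'] at this

theorem IsLogCarleson.isBoundedOperator {p q α β : ℝ} (hα : -1 < α) (hpq : p < q) (hpα : p = α + 2)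
    {g : ℂ → ℂ} (hg : g ∈ analyticDisk)
    (h : IsLogCarleson ((1 / p - 1) * q) (volterraMeasure g q β)) :
    IsBoundedOperator (volterra g) p α q β := by
  have hp1 : 1 < p := by linarith
  have hp : 0 < p := by linarith
  have hq : 0 < q := hp.trans hpq
  have he : (1 / p - 1) * q < 0 :=
    mul_neg_of_neg_of_pos (by rw [sub_neg, div_lt_one hp]; exact hp1) hq
  obtain ⟨B, hB, hcell⟩ := h.treeCell_le hg hq he
  obtain ⟨C, hC⟩ := tree_embedding_unweighted hp1 hpq B
  refine isBoundedOperator_of_tree hp hq hg (C := C) hB fun a => ?_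
  have := hC (μ := (volterraMeasure g q β).restrict outerDisk) measurableSet_treeCell_disc
    discCell_zero discCell_succ_div_two hcell a
  have h0 : α + 2 - p = 0 := by linarith
  simpa [h0] using this

/-- A single term of the energy sum bounds the oscillation in generation `k` by a constant times
`x^k ‖f‖` with `x = 2^((α+2-p)/p) < 1`, so the sum along any branch is dominated by a geometric
series. -/
lemma exists_enorm_le_of_lt {p α : ℝ} (hp : 0 < p) (hpα : α + 2 < p) :
    ∃ C : ℝ≥0, ∀ f ∈ analyticDisk, ∀ z ∈ unitDisk, ‖f z‖ₑ ≤ C * dirichletNorm p α f := by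
  obtain ⟨D, hD⟩ := exists_tree_majorant hp α
  set x : ℝ≥0 := (2 : ℝ≥0) ^ ((α + 2 - p) / p) with hx
  have hx1 : x < 1 := NNReal.rpow_lt_one_of_one_lt_of_neg one_lt_two
      (div_neg_of_neg_of_pos (by linarith) hp)
  have hsum : ∑' k : ℕ, (x : ℝ≥0∞) ^ k ≠ ⊤ := by
    rw [ENNReal.tsum_geometric]
    refine ENNReal.inv_ne_top.2 (tsub_pos_of_lt ?_).ne'
    exact_mod_cast hx1
  refine ⟨D + D ^ (1 / p) * (∑' k : ℕ, (x : ℝ≥0∞) ^ k).toNNReal, fun f hf z hz => ?_⟩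
  obtain ⟨h1, h2, h3⟩ := hD f hf
  set N := dirichletNorm p α f with hN
  have hosc : ∀ k j, whitneyOsc f k j ≤ x ^ k * ((D ^ (1 / p) : ℝ≥0) * N) := by
    intro k j
    have h4 : ENNReal.ofReal ((2 : ℝ) ^ (-(k * (α + 2 - p)))) * whitneyOsc f k j ^ p ≤ D * N ^ p :=
      (ENNReal.le_tsum j).trans ((ENNReal.le_tsum (f := fun k : ℕ => ∑' j,
        ENNReal.ofReal ((2 : ℝ) ^ (-(k * (α + 2 - p)))) * whitneyOsc f k j ^ p) k).trans h1)
    have h5 : (x : ℝ≥0∞) ^ k = ENNReal.ofReal ((2 : ℝ) ^ (k * ((α + 2 - p) / p))) := by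
      rw [← ENNReal.coe_pow, hx, ← NNReal.rpow_mul_natCast, mul_comm]
      rw [ENNReal.ofReal, Real.toNNReal_rpow_of_nonneg (by norm_num)]
      simp
    rw [← ENNReal.rpow_le_rpow_iff hp, ENNReal.mul_rpow_of_nonneg _ _ hp.le,
      ENNReal.mul_rpow_of_nonneg _ _ hp.le, ← ENNReal.coe_rpow_of_nonneg _ hp.le, ← NNReal.rpow_mul,
      one_div_mul_cancel hp.ne', NNReal.rpow_one, h5,
      ENNReal.ofReal_rpow_of_nonneg (by positivity) hp.le, ← Real.rpow_mul (by norm_num)]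
    calc whitneyOsc f k j ^ p = ENNReal.ofReal ((2 : ℝ) ^ (k * ((α + 2 - p) / p) * p)) *
          (ENNReal.ofReal ((2 : ℝ) ^ (-(k * (α + 2 - p)))) * whitneyOsc f k j ^ p) := by
          rw [← mul_assoc, ← ENNReal.ofReal_mul (by positivity), ← Real.rpow_add (by norm_num)]
          have : k * ((α + 2 - p) / p) * p + -(k * (α + 2 - p)) = 0 := by field_simp; ring
          rw [this]; simp
      _ ≤ _ := by gcongr
  by_cases hzo : z ∈ outerDisk
  · refine (h2 z hzo).trans ?_
    calc _ ≤ D * N + ∑ k ∈ Finset.range (discGen z + 1), (x : ℝ≥0∞) ^ k *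
        ((D ^ (1 / p) : ℝ≥0) * N) := by
          gcongr with k
          exact hosc k _
      _ ≤ D * N + (∑' k : ℕ, (x : ℝ≥0∞) ^ k) * ((D ^ (1 / p) : ℝ≥0) * N) := by
          rw [← Finset.sum_mul]
          gcongr
          exact ENNReal.sum_le_tsum _
      _ = _ := by
          rw [ENNReal.coe_add, ENNReal.coe_mul, ENNReal.coe_toNNReal hsum]
          ring
  · refine (h3 z hz hzo).trans ?_
    gcongr
    exact le_self_add

theorem isBoundedOperator_of_isFiniteMeasure {p q α β : ℝ} (hp : 0 < p) (hq : 0 < q)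
    (hpα : α + 2 < p)
    {g : ℂ → ℂ} (hg : g ∈ analyticDisk) (h : IsFiniteMeasure (volterraMeasure g q β)) :
    IsBoundedOperator (volterra g) p α q β := by
  rw [isBoundedOperator_volterra_iff hq p α β hg]
  obtain ⟨D, hD⟩ := exists_enorm_le_of_lt hp hpα
  refine ⟨D ^ q * (volterraMeasure g q β univ).toNNReal, fun f hf => ?_⟩
  rw [ENNReal.coe_mul, ENNReal.coe_toNNReal (measure_ne_top _ _)]
  calc ∫⁻ z, ‖f z‖ₑ ^ q ∂volterraMeasure g q β
      ≤ ∫⁻ z, (D * dirichletNorm p α f) ^ q ∂volterraMeasure g q β := by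
        refine lintegral_mono_ae ((ae_volterraMeasure_mem g q β).mono fun z hz => ?_)
        gcongr
        exact hD f hf.1 z hz
    _ = _ := by
        rw [lintegral_const, ENNReal.mul_rpow_of_nonneg _ _ hq.le,
          ENNReal.coe_rpow_of_nonneg _ hq.le]
        ring

/-! ### Integral estimates for the test functions -/

lemma lintegral_one_sub_rpow {α R : ℝ} (hα : -1 < α) (hR : 0 < R) :
    ∫⁻ r in Ico (1 - R) 1, ENNReal.ofReal ((1 - r) ^ α) = ENNReal.ofReal (R ^ (α + 1) / (α + 1)) :=
        by
  have hint : IntervalIntegrable (fun r : ℝ => (1 - r) ^ α) volume (1 - R) 1 := by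
    have := (intervalIntegral.intervalIntegrable_rpow' (a := R) (b := 0) hα).comp_sub_left 1
    simpa using this
  rw [Measure.restrict_congr_set Ico_ae_eq_Ioc, ← ofReal_integral_eq_lintegral_ofReal]
  · rw [← intervalIntegral.integral_of_le (by linarith),
      intervalIntegral.integral_comp_sub_left (fun x => x ^ α) 1, integral_rpow (Or.inl hα)]
    congr 1
    rw [sub_self, sub_sub_cancel, Real.zero_rpow (by linarith), sub_zero]
  · exact (intervalIntegrable_iff_integrableOn_Ioc_of_le (by linarith)).1 hint
  · refine (ae_restrict_mem measurableSet_Ioc).mono fun r hr => ?_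
    exact Real.rpow_nonneg (by linarith [hr.2]) _

/-- The angle is bounded through the chord `|exp(iθ) - 1| = 2 |sin(θ/2)|` and Jordan's inequality.
-/
lemma abs_le_of_norm_sub_one_le {r θ R : ℝ} (hr : r < 1) (hr0 : 0 < r)
    (hθ : θ ∈ Ioo (-Real.pi) Real.pi)
    (h : ‖(r : ℂ) * Complex.exp (Complex.I * θ) - 1‖ ≤ R) : 1 - R ≤ r ∧ |θ| ≤ Real.pi * R := by
  have hn : ‖(r : ℂ) * Complex.exp (Complex.I * θ)‖ = r := by
    rw [norm_mul, Complex.norm_exp_I_mul_ofReal, mul_one, Complex.norm_real,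
        Real.norm_of_nonneg hr0.le]
  have h1 : 1 - r ≤ R := by
    have := norm_sub_norm_le (1 : ℂ) ((r : ℂ) * Complex.exp (Complex.I * θ))
    rw [hn, norm_one, norm_sub_rev] at this
    linarith
  refine ⟨by linarith, ?_⟩
  have h2 : ‖Complex.exp (Complex.I * θ) - 1‖ ≤ 2 * R := by
    have h3 : Complex.exp (Complex.I * θ) - 1 = ((1 - r : ℝ) : ℂ) * Complex.exp (Complex.I * θ) +
        ((r : ℂ) * Complex.exp (Complex.I * θ) - 1) := by push_cast; ring
    rw [h3]
    refine (norm_add_le _ _).trans ?_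
    rw [norm_mul, Complex.norm_exp_I_mul_ofReal, mul_one, Complex.norm_real,
      Real.norm_of_nonneg (by linarith)]
    linarith
  rw [Complex.norm_exp_I_mul_ofReal_sub_one, norm_mul, Real.norm_eq_abs, Real.norm_eq_abs,
    abs_two] at h2
  have hpi := Real.pi_pos
  have h4 := Real.mul_abs_le_abs_sin (x := θ / 2) (by
    rw [abs_div, abs_two]
    have := abs_lt.2 hθ
    linarith)
  rw [abs_div, abs_two] at h4
  have h5 : 2 / Real.pi * (|θ| / 2) = |θ| / Real.pi := by field_simp
  rw [h5] at h4
  have h6 : |θ| / Real.pi ≤ R := by linarith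
  rwa [div_le_iff₀ hpi, mul_comm] at h6

/-- In polar coordinates the region lies in `1 - R ≤ r < 1`, `|θ| ≤ πR`, where the weight is
comparable to `(1 - r)^α`; the two integrals contribute `R^(α+1)` and `R`. -/
lemma exists_lintegral_weight_near_one_le {α : ℝ} (hα : -1 < α) :
    ∃ C : ℝ, 0 < C ∧ ∀ R : ℝ, 0 < R → ∫⁻ z in unitDisk ∩ Metric.closedBall 1 R, weight α z ≤
      ENNReal.ofReal (C * R ^ (α + 2)) := by
  have hα1 : 0 < α + 1 := by linarith
  refine ⟨2 ^ |α| * (2 * Real.pi) / (α + 1), by positivity, fun R hR => ?_⟩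
  have hm : MeasurableSet (unitDisk ∩ Metric.closedBall 1 R) :=
    isOpen_unitDisk.measurableSet.inter Metric.isClosed_closedBall.measurableSet
  set A : ℝ → ℝ≥0∞ := (Ico (1 - R) 1).indicator fun r => ENNReal.ofReal
      (2 ^ |α| * (1 - r) ^ α) with hA
  set B : ℝ → ℝ≥0∞ := (Icc (-(Real.pi * R)) (Real.pi * R)).indicator fun _ => 1 with hB
  have hAm : Measurable A :=
    Measurable.indicator (by fun_prop) measurableSet_Ico
  have hBm : Measurable B := measurable_const.indicator measurableSet_Icc
  rw [← lintegral_indicator hm, ← Complex.lintegral_comp_polarCoord_symm, polarCoord_target]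
  have hpt : ∀ x ∈ Ioi (0 : ℝ) ×ˢ Ioo (-Real.pi) Real.pi, ENNReal.ofReal x.1 •
      (unitDisk ∩ Metric.closedBall 1 R).indicator (weight α) (Complex.polarCoord.symm x) ≤
      A x.1 * B x.2 := by
    rintro ⟨r, θ⟩ ⟨hr, hθ⟩
    have hr0 : 0 < r := hr
    have hz : Complex.polarCoord.symm (r, θ) = r * Complex.exp (Complex.I * θ) := by
      rw [Complex.polarCoord_symm_apply, mul_comm Complex.I, Complex.exp_mul_I]
      push_cast; rfl
    by_cases hmem : Complex.polarCoord.symm (r, θ) ∈ unitDisk ∩ Metric.closedBall 1 R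
    swap
    · rw [indicator_of_notMem hmem]; simp
    rw [indicator_of_mem hmem]
    have hn : ‖Complex.polarCoord.symm (r, θ)‖ = r := by
      rw [Complex.norm_polarCoord_symm, abs_of_pos hr0]
    have hr1 : r < 1 := by rw [← hn]; exact mem_unitDisk.1 hmem.1
    have h1 := mem_closedBall_iff_norm.1 hmem.2
    rw [hz] at h1
    obtain ⟨h2, h3⟩ := abs_le_of_norm_sub_one_le hr1 hr0 hθ h1
    have hB1 : B θ = 1 :=
      indicator_of_mem (show θ ∈ Icc (-(Real.pi * R)) (Real.pi * R) from abs_le.1 h3) _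
    have hA1 : A r = ENNReal.ofReal (2 ^ |α| * (1 - r) ^ α) :=
      indicator_of_mem (show r ∈ Ico (1 - R) 1 from ⟨h2, hr1⟩) _
    simp only [hB1, hA1, mul_one, smul_eq_mul]
    rw [weight, hn, ← ENNReal.ofReal_mul hr0.le]
    refine ENNReal.ofReal_le_ofReal ?_
    have h4 := rpow_le_mul_rpow_of_comparable (x := 1 - r ^ 2) (y := 1 - r) (K := 2) (by nlinarith)
      (by linarith) (by norm_num) (by nlinarith) (by nlinarith) α
    refine le_trans ?_ h4
    exact mul_le_of_le_one_left (Real.rpow_nonneg (by nlinarith) _) hr1.le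
  refine (setLIntegral_mono' (measurableSet_Ioi.prod measurableSet_Ioo) hpt).trans ?_
  calc ∫⁻ x in Ioi (0 : ℝ) ×ˢ Ioo (-Real.pi) Real.pi, A x.1 * B x.2
      ≤ ∫⁻ x : ℝ × ℝ, A x.1 * B x.2 := setLIntegral_le_lintegral _ _
    _ = (∫⁻ r, A r) * ∫⁻ θ, B θ := by
        rw [Measure.volume_eq_prod, lintegral_prod_mul hAm.aemeasurable hBm.aemeasurable]
    _ = ENNReal.ofReal (2 ^ |α| * (R ^ (α + 1) / (α + 1))) * ENNReal.ofReal (2 * Real.pi * R) := by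
        congr 1
        · rw [hA, lintegral_indicator measurableSet_Ico]
          simp_rw [ENNReal.ofReal_mul (show (0 : ℝ) ≤ 2 ^ |α| by positivity)]
          rw [lintegral_const_mul' _ _ ENNReal.ofReal_ne_top, lintegral_one_sub_rpow hα hR]
        · rw [hB, lintegral_indicator measurableSet_Icc, setLIntegral_const, one_mul,
          Real.volume_Icc]
          congr 1; ring
    _ = _ := by
        have h1 : R ^ (α + 2) = R ^ (α + 1) * R := by
          rw [← Real.rpow_add_one hR.ne']; congr 1; ring
        rw [← ENNReal.ofReal_mul (by positivity), h1]
        congr 1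
        ring

lemma exists_lintegral_weight_near_boundary_le {α : ℝ} (hα : -1 < α) :
    ∃ C : ℝ, 0 < C ∧ ∀ (ω : ℂ) (R : ℝ), ‖ω‖ = 1 → 0 < R →
      ∫⁻ z in Metric.closedBall ω R, weight α z ∂areaMeasure ≤ ENNReal.ofReal (C * R ^ (α + 2)) :=
        by
  obtain ⟨C, hC, h⟩ := exists_lintegral_weight_near_one_le hα
  have hpi := Real.pi_pos
  refine ⟨Real.pi⁻¹ * C, by positivity, fun ω R hω hR => ?_⟩
  have hm : ∀ w : ℂ, MeasurableSet (unitDisk ∩ Metric.closedBall w R) := fun w =>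
    isOpen_unitDisk.measurableSet.inter Metric.isClosed_closedBall.measurableSet
  obtain ⟨c, hc⟩ : ∃ c : Circle, (c : ℂ) = ω := ⟨⟨ω, mem_sphere_zero_iff_norm.2 hω⟩, rfl⟩
  set e := rotation c with he
  have heω : ∀ z, e z = ω * z := fun z => by rw [he, rotation_apply, hc]
  have hnorm : ∀ z, ‖ω * z‖ = ‖z‖ := fun z => by rw [norm_mul, hω, one_mul]
  -- The weight and the area are rotation invariant, so `ω` may be moved to `1`.
  have hrot : ∫⁻ z in unitDisk ∩ Metric.closedBall ω R, weight α z =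
      ∫⁻ z in unitDisk ∩ Metric.closedBall 1 R, weight α z := by
    rw [← lintegral_indicator (hm _), ← lintegral_indicator (hm _),
      ← e.measurePreserving.lintegral_comp_emb e.toHomeomorph.measurableEmbedding]
    refine lintegral_congr fun z => ?_
    rw [heω]
    have h1 : ω * z ∈ unitDisk ∩ Metric.closedBall ω R ↔ z ∈ unitDisk ∩ Metric.closedBall 1 R := by
      have h2 : ‖ω * z - ω‖ = ‖z - 1‖ := by rw [← mul_sub_one, hnorm]
      simp only [mem_inter_iff, mem_unitDisk, hnorm, mem_closedBall_iff_norm, h2]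
    by_cases hz : z ∈ unitDisk ∩ Metric.closedBall 1 R
    · rw [indicator_of_mem hz, indicator_of_mem (h1.2 hz), weight, weight, hnorm]
    · rw [indicator_of_notMem hz, indicator_of_notMem (mt h1.1 hz)]
  rw [areaMeasure, Measure.restrict_smul, lintegral_smul_measure, smul_eq_mul,
    Measure.restrict_restrict Metric.isClosed_closedBall.measurableSet, inter_comm, hrot, mul_assoc,
    ENNReal.ofReal_mul (by positivity), ENNReal.ofReal_inv_of_pos hpi]
  gcongr
  exact h R hR

/-- The Bergman type integral of a power of `1 - conj a * z`, `a = (1 - δ) ω`, as a sum over the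
dyadic distances from `ω`. -/
lemma exists_lintegral_test_le {α : ℝ} (hα : -1 < α) {t : ℝ} (ht : 0 < t) :
    ∃ C : ℝ, 0 < C ∧ ∀ (ω : ℂ) (δ : ℝ) (M : ℕ), ‖ω‖ = 1 → 0 < δ → δ ≤ 1 → 2 < 2 ^ (M + 1) * δ →
      ∫⁻ z, ‖(ω - (1 - δ) * z)⁻¹‖ₑ ^ t * weight α z ∂areaMeasure ≤
        ENNReal.ofReal (C * δ ^ (α + 2 - t) *
        ∑ n ∈ Finset.range (M + 1), ((2 : ℝ) ^ (α + 2 - t)) ^ n) := by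
  obtain ⟨C, hC, h⟩ := exists_lintegral_weight_near_boundary_le hα
  refine ⟨C * 4 ^ (α + 2), by positivity, fun ω δ M hω hδ hδ1 hM => ?_⟩
  have hpt : ∀ z ∈ unitDisk, ‖(ω - (1 - δ) * z)⁻¹‖ₑ ^ t * weight α z ≤
      ∑ n ∈ Finset.range (M + 1), ENNReal.ofReal ((2 ^ n * δ) ^ (-t)) *
        (Metric.closedBall ω (4 * (2 ^ n * δ))).indicator (weight α) z := by
    intro z hz
    have hz1 := mem_unitDisk.1 hz
    set d := ‖ω - (1 - δ) * z‖ with hd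
    have hn : ‖((1 : ℂ) - δ) * z‖ = (1 - δ) * ‖z‖ := by
      rw [norm_mul, ← Complex.ofReal_one, ← Complex.ofReal_sub, Complex.norm_real,
        Real.norm_of_nonneg (by linarith)]
    have hdδ : δ ≤ d := by
      have := norm_sub_norm_le ω ((1 - δ) * z)
      rw [hn, hω] at this
      nlinarith
    have hd2 : d ≤ 2 := by
      have := norm_sub_le ω ((1 - δ) * z)
      rw [hn, hω] at this
      nlinarith
    have hdist : ‖z - ω‖ ≤ 2 * d := by
      have h1 : z - ω = -(ω - (1 - δ) * z) + δ * z := by ring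
      have h2 : ‖(δ : ℂ) * z‖ ≤ δ := by
        rw [norm_mul, Complex.norm_real, Real.norm_of_nonneg hδ.le]
        exact mul_le_of_le_one_right hδ.le hz1.le
      rw [h1]
      refine (norm_add_le _ _).trans ?_
      rw [norm_neg]
      linarith
    have hd0 : 0 < d := hδ.trans_le hdδ
    -- the dyadic index of `d`
    have hex : ∃ n, d < 2 ^ (n + 1) * δ := ⟨M, lt_of_le_of_lt hd2 hM⟩
    classical
    set n := Nat.find hex with hn'
    have hn1 : d < 2 ^ (n + 1) * δ := Nat.find_spec hex
    have hn2 : 2 ^ n * δ ≤ d := by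
      rcases Nat.eq_zero_or_pos n with h0 | h0
      · rw [h0]; simpa using hdδ
      · have := Nat.find_min hex (show n - 1 < Nat.find hex by omega)
        rw [not_lt, Nat.sub_add_cancel h0] at this
        exact this
    -- The hypothesis on `M` enters here: `d ≤ 2 < 2^(M+1) * δ`, so the scales up to `M` exhaust the
    -- disk.
    have hnM : n ≤ M := Nat.find_min' hex (lt_of_le_of_lt hd2 hM)
    have hmem : z ∈ Metric.closedBall ω (4 * (2 ^ n * δ)) := by
      rw [mem_closedBall_iff_norm]
      rw [pow_succ] at hn1
      linarith
    refine le_trans ?_ (Finset.single_le_sum (f := fun n => ENNReal.ofReal ((2 ^ n * δ) ^ (-t)) *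
        (Metric.closedBall ω (4 * (2 ^ n * δ))).indicator (weight α) z) (fun _ _ => zero_le)
        (Finset.mem_range.2 (Nat.lt_succ_of_le hnM)))
    rw [indicator_of_mem hmem]
    gcongr
    rw [← ofReal_norm, norm_inv, ← hd, ENNReal.ofReal_rpow_of_pos (by positivity),
      Real.inv_rpow hd0.le, ← Real.rpow_neg hd0.le]
    refine ENNReal.ofReal_le_ofReal (Real.rpow_le_rpow_of_nonpos (by positivity) hn2 (by linarith))
  refine (lintegral_mono_ae (ae_areaMeasure_mem.mono hpt)).trans ?_
  rw [lintegral_finsetSum _ fun n _ => ((measurable_weight α).indicator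
    Metric.isClosed_closedBall.measurableSet).const_mul _]
  rw [Finset.mul_sum, ENNReal.ofReal_sum_of_nonneg fun n _ => by positivity]
  refine Finset.sum_le_sum fun n _ => ?_
  have hr : 0 < 2 ^ n * δ := by positivity
  rw [lintegral_const_mul' _ _ ENNReal.ofReal_ne_top,
    lintegral_indicator Metric.isClosed_closedBall.measurableSet]
  refine (mul_le_mul_right (h ω (4 * (2 ^ n * δ)) hω (by positivity)) _).trans (le_of_eq ?_)
  rw [← ENNReal.ofReal_mul (by positivity)]
  congr 1
  have h2 : ((2 : ℝ) ^ (α + 2 - t)) ^ n = (2 ^ n) ^ (α + 2 - t) := by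
    rw [← Real.rpow_mul_natCast (by norm_num), ← Real.rpow_natCast_mul (by norm_num), mul_comm]
  have h3 : (2 ^ n * δ) ^ (α + 2 - t) = (2 ^ n * δ) ^ (-t) * (2 ^ n * δ) ^ (α + 2) := by
    rw [← Real.rpow_add hr]; congr 1; ring
  rw [h2, Real.mul_rpow (by norm_num) hr.le, mul_assoc (C * 4 ^ (α + 2)),
    ← Real.mul_rpow hδ.le (by positivity), mul_comm δ, h3]
  ring

/-! ### Necessity of the Carleson conditions -/

/-- `ω` is the initial endpoint of the arc. The angular displacement costs `2πl`, the radial one and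
the factor `1 - l` cost `l` each, and `2π + 2 ≤ 9`. -/
lemma norm_sub_le_of_mem_carlesonSquare {I : Set ℂ} {l : ℝ} (hI : IsArc I l) :
    ∃ ω : ℂ, ‖ω‖ = 1 ∧ ∀ z ∈ carlesonSquare I l, ‖z‖ < 1 ∧ ‖ω - (1 - l) * z‖ ≤ 9 * l := by
  obtain ⟨hl0, hl1, a, J, -, hJ, rfl⟩ := hI
  refine ⟨Complex.exp (a * Complex.I), Complex.norm_exp_ofReal_mul_I a, ?_⟩
  rintro _ ⟨r, _, ⟨t, ht, rfl⟩, hr, hr1, rfl⟩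
  set ω := Complex.exp (a * Complex.I) with hω
  have hpi := Real.pi_lt_d2
  have hr0 : 0 ≤ r := by linarith
  have hw : ‖Complex.exp (t * Complex.I)‖ = 1 := Complex.norm_exp_ofReal_mul_I t
  have hn : ‖(r : ℂ) * Complex.exp (t * Complex.I)‖ = r := by
    rw [norm_mul, hw, mul_one, Complex.norm_real, Real.norm_of_nonneg hr0]
  have htJ := hJ ht
  have h1 : ‖Complex.exp (t * Complex.I) - ω‖ ≤ 2 * Real.pi * l := by
    have h2 : Complex.exp (t * Complex.I) - ω =
        ω * (Complex.exp (Complex.I * ((t - a : ℝ) : ℂ)) - 1) := by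
      rw [mul_sub_one, hω, ← Complex.exp_add]
      congr 2
      push_cast; ring
    rw [h2, norm_mul, hω, Complex.norm_exp_ofReal_mul_I, one_mul]
    refine Real.norm_exp_I_mul_ofReal_sub_one_le.trans ?_
    rw [Real.norm_of_nonneg (by linarith [htJ.1])]
    linarith [htJ.2]
  simp only [hn]
  refine ⟨hr1, ?_⟩
  have h3 : ω - (1 - l) * (r * Complex.exp (t * Complex.I)) =
      -(Complex.exp (t * Complex.I) - ω) + (((1 - r : ℝ) : ℂ) * Complex.exp (t * Complex.I)
        + l * (r * Complex.exp (t * Complex.I))) := by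
    push_cast; ring
  rw [h3]
  refine (norm_add_le _ _).trans ?_
  have h4 : ‖((1 - r : ℝ) : ℂ) * Complex.exp (t * Complex.I)
        + l * (r * Complex.exp (t * Complex.I))‖ ≤ l + l := by
    refine (norm_add_le _ _).trans (add_le_add ?_ ?_)
    · rw [norm_mul, hw, mul_one, Complex.norm_real, Real.norm_of_nonneg (by linarith)]
      linarith
    · rw [norm_mul, hn, Complex.norm_real, Real.norm_of_nonneg hl0.le]
      exact mul_le_of_le_one_right hl0.le hr1.le
  rw [norm_neg]
  nlinarith

lemma test_ne_zero {ω : ℂ} {δ : ℝ} (hω : ‖ω‖ = 1) (hδ : 0 < δ) (hδ1 : δ ≤ 1) {z : ℂ}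
    (hz : z ∈ unitDisk) : ω - (1 - δ) * z ≠ 0 := by
  intro h
  have h1 : ‖ω‖ = (1 - δ) * ‖z‖ := by
    rw [sub_eq_zero.1 h, norm_mul, ← Complex.ofReal_one, ← Complex.ofReal_sub, Complex.norm_real,
      Real.norm_of_nonneg (by linarith)]
  have := mem_unitDisk.1 hz
  have := norm_nonneg z
  rw [hω] at h1
  nlinarith

lemma norm_one_sub_le_one {δ : ℝ} (hδ : 0 < δ) (hδ1 : δ ≤ 1) : ‖(1 - δ : ℂ)‖ ≤ 1 := by
  rw [← Complex.ofReal_one, ← Complex.ofReal_sub, Complex.norm_real,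
      Real.norm_of_nonneg (by linarith)]
  linarith

lemma exists_dyadic_bound {δ : ℝ} (hδ : 0 < δ) :
    ∃ M : ℕ, 2 < 2 ^ (M + 1) * δ := by
  obtain ⟨n, hn⟩ := pow_unbounded_of_one_lt (2 / δ) (one_lt_two (α := ℝ))
  refine ⟨n, ?_⟩
  rw [div_lt_iff₀ hδ] at hn
  rw [pow_succ]
  nlinarith

/-- Norm estimate for the powers of the Cauchy kernel. -/
lemma exists_dirichletNorm_inv_pow_le {p α : ℝ} (hp : 0 < p) (hα : -1 < α) {n : ℕ}
    (hn : α + 2 < (n + 1) * p) :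
    ∃ C : ℝ, 0 < C ∧ ∀ (ω : ℂ) (δ : ℝ), ‖ω‖ = 1 → 0 < δ → δ ≤ 1 →
      (fun z => ((ω - (1 - δ) * z)⁻¹) ^ n) ∈ analyticDisk ∧
      dirichletNorm p α (fun z => ((ω - (1 - δ) * z)⁻¹) ^ n) ^ p ≤
        ENNReal.ofReal (C * δ ^ (α + 2 - (n + 1) * p)) := by
  set t := (n + 1) * p with ht
  have ht0 : 0 < t := by positivity
  obtain ⟨C, hC, h⟩ := exists_lintegral_test_le hα ht0
  set x : ℝ := 2 ^ (α + 2 - t) with hx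
  have hx0 : 0 < x := by positivity
  -- Here `hn` is used: the derivative decays with exponent `t = (n + 1) p > α + 2`, so the sum over
  -- dyadic distances is geometric.
  have hx1 : x < 1 := Real.rpow_lt_one_of_one_lt_of_neg one_lt_two (by linarith)
  have hC' : 0 < C * (1 - x)⁻¹ := mul_pos hC (inv_pos.2 (by linarith))
  refine ⟨1 + (n : ℝ) ^ p * (C * (1 - x)⁻¹), by positivity, fun ω δ hω hδ hδ1 => ?_⟩
  set f : ℂ → ℂ := fun z => ((ω - (1 - δ) * z)⁻¹) ^ n with hf
  have hder : ∀ z ∈ unitDisk, HasDerivAt f (n * ((ω - (1 - δ) * z)⁻¹) ^ (n + 1) * (1 - δ)) z := by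
    intro z hz
    have hne := test_ne_zero hω hδ hδ1 hz
    have h1 : HasDerivAt (fun z : ℂ => ω - (1 - δ) * z) (-(1 - δ)) z := by
      simpa using ((hasDerivAt_id z).const_mul (1 - δ : ℂ)).const_sub ω
    have h2 := (h1.fun_inv hne).fun_pow n
    have heq : n * ((ω - (1 - δ) * z)⁻¹) ^ (n + 1) * (1 - δ) =
        n * ((ω - (1 - δ) * z)⁻¹) ^ (n - 1) * (- -(1 - δ : ℂ) / (ω - (1 - δ) * z) ^ 2) := by
      rcases n with _ | n
      · simp
      · rw [Nat.add_sub_cancel, neg_neg, div_eq_mul_inv, ← inv_pow]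
        ring
    rw [heq]
    exact h2
  refine ⟨fun z hz => (hder z hz).differentiableAt.differentiableWithinAt, ?_⟩
  have hf0 : ‖f 0‖ₑ = 1 := by
    rw [← ofReal_norm]; simp [hf, hω]
  have hpt : ∀ z ∈ unitDisk, ‖deriv f z‖ₑ ^ p * weight α z ≤
      ENNReal.ofReal ((n : ℝ) ^ p) * (‖(ω - (1 - δ) * z)⁻¹‖ₑ ^ t * weight α z) := by
    intro z hz
    rw [(hder z hz).deriv, ← mul_assoc]
    gcongr
    have h1 : ‖(1 - δ : ℂ)‖ₑ ≤ 1 := by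
      rw [← ofReal_norm, ← ENNReal.ofReal_one]
      exact ENNReal.ofReal_le_ofReal (norm_one_sub_le_one hδ hδ1)
    have h2 : ‖(n : ℂ)‖ₑ = ENNReal.ofReal n := by rw [← ofReal_norm]; simp
    rw [enorm_mul, enorm_mul, enorm_pow, h2, ht, ENNReal.rpow_mul,
      ← ENNReal.ofReal_rpow_of_nonneg (by positivity) hp.le, ← ENNReal.mul_rpow_of_nonneg _ _ hp.le]
    refine ENNReal.rpow_le_rpow ?_ hp.le
    rw [show ((n : ℝ) + 1) = ((n + 1 : ℕ) : ℝ) by push_cast; rfl, ENNReal.rpow_natCast]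
    exact mul_le_of_le_one_right' h1
  have hI : dirichletIntegral p α f ≤
      ENNReal.ofReal ((n : ℝ) ^ p * (C * (1 - x)⁻¹) * δ ^ (α + 2 - t)) := by
    refine (lintegral_mono_ae (ae_areaMeasure_mem.mono hpt)).trans ?_
    rw [lintegral_const_mul' _ _ ENNReal.ofReal_ne_top, mul_assoc,
        ENNReal.ofReal_mul (by positivity)]
    gcongr
    obtain ⟨M, hM⟩ := exists_dyadic_bound hδ
    refine (h ω δ M hω hδ hδ1 hM).trans (ENNReal.ofReal_le_ofReal ?_)
    have h3 : ∑ n ∈ Finset.range (M + 1), x ^ n ≤ (1 - x)⁻¹ := by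
      rw [← tsum_geometric_of_lt_one hx0.le hx1]
      exact (summable_geometric_of_lt_one hx0.le hx1).sum_le_tsum _ fun _ _ => by positivity
    calc C * δ ^ (α + 2 - t) * ∑ n ∈ Finset.range (M + 1), x ^ n
        ≤ C * δ ^ (α + 2 - t) * (1 - x)⁻¹ := by gcongr
      _ = _ := by ring
  rw [dirichletNorm_rpow hp, hf0, ENNReal.one_rpow, add_mul,
      ENNReal.ofReal_add (by positivity) (by positivity)]
  refine add_le_add ?_ hI
  rw [one_mul, ← ENNReal.ofReal_one]
  exact ENNReal.ofReal_le_ofReal (Real.one_le_rpow_of_pos_of_le_one_of_nonpos hδ hδ1 (by linarith))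

lemma measure_mul_rpow_le {μ : Measure ℂ} {f : ℂ → ℂ} (hf : Measurable f) {q c : ℝ} (hq : 0 < q)
    (hc : 0 ≤ c) {S : Set ℂ} (hS : ∀ z ∈ S, c ≤ ‖f z‖) :
    ENNReal.ofReal (c ^ q) * μ S ≤ ∫⁻ z, ‖f z‖ₑ ^ q ∂μ := by
  refine le_trans ?_ (mul_meas_ge_le_lintegral (hf.enorm.pow_const q) (ENNReal.ofReal (c ^ q)))
  gcongr
  intro z hz
  change ENNReal.ofReal (c ^ q) ≤ ‖f z‖ₑ ^ q
  rw [← ENNReal.ofReal_rpow_of_nonneg hc hq.le, ← ofReal_norm]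
  gcongr
  exact hS z hz

lemma dirichletNorm_lt_top_of_rpow_le {p α r : ℝ} (hp : 0 < p) {f : ℂ → ℂ}
    (h : dirichletNorm p α f ^ p ≤ ENNReal.ofReal r) : dirichletNorm p α f < ⊤ :=
  (ENNReal.rpow_lt_top_iff_of_pos hp).1 (h.trans_lt ENNReal.ofReal_lt_top)

lemma dirichletNorm_rpow_le {p q α r : ℝ} (hp : 0 < p) (hq : 0 < q) (hr : 0 ≤ r) {f : ℂ → ℂ}
    (h : dirichletNorm p α f ^ p ≤ ENNReal.ofReal r) :
    dirichletNorm p α f ^ q ≤ ENNReal.ofReal (r ^ (q / p)) := by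
  rw [← ENNReal.ofReal_rpow_of_nonneg hr (by positivity)]
  calc dirichletNorm p α f ^ q = (dirichletNorm p α f ^ p) ^ (q / p) := by
        rw [← ENNReal.rpow_mul, mul_div_cancel₀ _ hp.ne']
    _ ≤ _ := by gcongr

/-- Test with the `n`-th power of the Cauchy kernel, `n` large and integral so that no branch is
chosen. On `S(I)` it is at least `(9l)^(-n)`, and the powers of `l` combine to the Carleson
exponent. -/
theorem IsBoundedOperator.isCarleson {p q α β : ℝ} (hα : -1 < α) (hp : 0 < p) (hq : 0 < q)
    {g : ℂ → ℂ} (hg : g ∈ analyticDisk) (h : IsBoundedOperator (volterra g) p α q β) :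
    IsCarleson (q * (α + 2 - p) / p) (volterraMeasure g q β) := by
  obtain ⟨D, hD⟩ := (isBoundedOperator_volterra_iff hq p α β hg).1 h
  obtain ⟨n, hn⟩ := exists_nat_gt ((α + 2) / p)
  have hn' : α + 2 < (n + 1) * p := by
    rw [div_lt_iff₀ hp] at hn
    linarith
  obtain ⟨C, hC, hnorm⟩ := exists_dirichletNorm_inv_pow_le hp hα hn'
  refine ⟨((D : ℝ) + 1) * C ^ (q / p) * 9 ^ (n * q), by positivity, fun I l hI => ?_⟩
  have hl0 := hI.1
  obtain ⟨ω, hω, hS⟩ := norm_sub_le_of_mem_carlesonSquare hI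
  obtain ⟨hfa, hfN⟩ := hnorm ω l hω hl0 hI.2.1
  set f : ℂ → ℂ := fun z => ((ω - (1 - l) * z)⁻¹) ^ n with hf
  have hfm : Measurable f := by fun_prop
  have hlow : ∀ z ∈ carlesonSquare I l, ((9 * l)⁻¹) ^ n ≤ ‖f z‖ := by
    intro z hz
    obtain ⟨h1, h2⟩ := hS z hz
    have h3 : 0 < ‖ω - (1 - l) * z‖ :=
      norm_pos_iff.2 (test_ne_zero hω hl0 hI.2.1 (mem_unitDisk.2 h1))
    rw [hf]
    simp only [norm_pow, norm_inv]
    gcongr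
  have h1 := measure_mul_rpow_le (μ := volterraMeasure g q β) hfm hq (by positivity) hlow
  have h2 := hD f ⟨hfa, dirichletNorm_lt_top_of_rpow_le hp hfN⟩
  have h3 := dirichletNorm_rpow_le (q := q) hp hq (by positivity) hfN
  have hc : (0 : ℝ) < (((9 * l)⁻¹) ^ n) ^ q := by positivity
  have h4 : ENNReal.ofReal ((((9 * l)⁻¹) ^ n) ^ q) * volterraMeasure g q β (carlesonSquare I l) ≤
      ENNReal.ofReal ((((9 * l)⁻¹) ^ n) ^ q) * ENNReal.ofReal
        (((D : ℝ) + 1) * C ^ (q / p) * 9 ^ (n * q) * l ^ (q * (α + 2 - p) / p)) := by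
    refine h1.trans (h2.trans ((mul_le_mul_right h3 _).trans ?_))
    have hDD : (D : ℝ≥0∞) = ENNReal.ofReal D := by simp
    rw [hDD, ← ENNReal.ofReal_mul (by positivity), ← ENNReal.ofReal_mul hc.le]
    refine ENNReal.ofReal_le_ofReal ?_
    have e1 : (C * l ^ (α + 2 - (n + 1) * p)) ^ (q / p) =
        C ^ (q / p) * l ^ ((α + 2 - (n + 1) * p) * (q / p)) := by
      rw [Real.mul_rpow hC.le (by positivity), ← Real.rpow_mul hl0.le]
    have e2 : (((9 * l)⁻¹) ^ n) ^ q = 9 ^ (-(n * q)) * l ^ (-(n * q)) := by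
      rw [← Real.rpow_natCast, ← Real.rpow_mul (by positivity), Real.inv_rpow (by positivity),
        ← Real.rpow_neg (by positivity), Real.mul_rpow (by norm_num) hl0.le]
    have e3 : (9 : ℝ) ^ (-(n * q)) * 9 ^ (n * q) = 1 := by
      rw [← Real.rpow_add (by norm_num)]; simp
    have e4 : l ^ (-(n * q)) * l ^ (q * (α + 2 - p) / p) =
        l ^ ((α + 2 - (n + 1) * p) * (q / p)) := by
      rw [← Real.rpow_add hl0]
      congr 1
      field_simp
      ring
    rw [e1, e2]
    calc (D : ℝ) * (C ^ (q / p) * l ^ ((α + 2 - (n + 1) * p) * (q / p)))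
        ≤ ((D : ℝ) + 1) * (C ^ (q / p) * l ^ ((α + 2 - (n + 1) * p) * (q / p))) := by
          gcongr
          linarith
      _ = ((D : ℝ) + 1) * C ^ (q / p) * (9 ^ (-(n * q)) * 9 ^ (n * q)) *
          (l ^ (-(n * q)) * l ^ (q * (α + 2 - p) / p)) := by rw [e3, e4]; ring
      _ = _ := by ring
  exact (ENNReal.mul_le_mul_iff_right (ENNReal.ofReal_pos.2 hc).ne' ENNReal.ofReal_ne_top).1 h4

/-- Norm estimate for the logarithm of the Cauchy kernel. -/
lemma exists_dirichletNorm_log_le {p α : ℝ} (hα : -1 < α) (hpα : p = α + 2) :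
    ∃ C : ℝ, 0 < C ∧ ∀ (ω : ℂ) (δ : ℝ) (M : ℕ), ‖ω‖ = 1 → 0 < δ → δ ≤ 1 → 2 < 2 ^ (M + 1) * δ →
      (fun z => Complex.log (1 - (1 - δ) * ω⁻¹ * z)) ∈ analyticDisk ∧
      dirichletNorm p α (fun z => Complex.log (1 - (1 - δ) * ω⁻¹ * z)) ^ p ≤
        ENNReal.ofReal (C * (M + 1)) := by
  have hp : 0 < p := by linarith
  obtain ⟨C, hC, h⟩ := exists_lintegral_test_le hα hp
  refine ⟨C, hC, fun ω δ M hω hδ hδ1 hM => ?_⟩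
  set f : ℂ → ℂ := fun z => Complex.log (1 - (1 - δ) * ω⁻¹ * z) with hf
  have hω0 : ω ≠ 0 := by rintro rfl; simp at hω
  have hder : ∀ z ∈ unitDisk, HasDerivAt f (-((1 - δ) * (ω - (1 - δ) * z)⁻¹)) z := by
    intro z hz
    have hlt : ‖(1 - δ) * ω⁻¹ * z‖ < 1 := by
      rw [norm_mul, norm_mul, norm_inv, hω, inv_one, mul_one]
      exact lt_of_le_of_lt (mul_le_of_le_one_left (norm_nonneg _) (norm_one_sub_le_one hδ hδ1))
        (mem_unitDisk.1 hz)
    have hslit : 1 - (1 - δ) * ω⁻¹ * z ∈ Complex.slitPlane := by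
      refine Or.inl ?_
      have := (Complex.abs_re_le_norm _).trans_lt hlt
      have := (abs_lt.1 this).2
      rw [Complex.sub_re, Complex.one_re]
      linarith
    have h1 : HasDerivAt (fun z : ℂ => 1 - (1 - δ) * ω⁻¹ * z) (-((1 - δ) * ω⁻¹)) z := by
      simpa using ((hasDerivAt_id z).const_mul ((1 - δ) * ω⁻¹ : ℂ)).const_sub 1
    convert h1.clog hslit using 1
    have e : ω - (1 - δ) * z = ω * (1 - (1 - δ) * ω⁻¹ * z) := by field_simp
    rw [e, mul_inv]
    field_simp
  refine ⟨fun z hz => (hder z hz).differentiableAt.differentiableWithinAt, ?_⟩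
  have hf0 : ‖f 0‖ₑ = 0 := by simp [hf]
  have hpt : ∀ z ∈ unitDisk, ‖deriv f z‖ₑ ^ p * weight α z ≤
      ‖(ω - (1 - δ) * z)⁻¹‖ₑ ^ p * weight α z := by
    intro z hz
    rw [(hder z hz).deriv]
    gcongr
    have h1 : ‖(1 - δ : ℂ)‖ₑ ≤ 1 := by
      rw [← ofReal_norm, ← ENNReal.ofReal_one]
      exact ENNReal.ofReal_le_ofReal (norm_one_sub_le_one hδ hδ1)
    rw [enorm_neg, enorm_mul]
    exact mul_le_of_le_one_left' h1
  rw [dirichletNorm_rpow hp, hf0, ENNReal.zero_rpow_of_pos hp, zero_add]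
  refine (lintegral_mono_ae (ae_areaMeasure_mem.mono hpt)).trans ((h ω δ M hω hδ hδ1 hM).trans ?_)
  -- At the critical exponent each of the `M + 1` dyadic distances contributes the same amount.
  have h0 : α + 2 - p = 0 := by linarith
  simp [h0]

/-- Provides a number of dyadic scales that reaches across the disk yet is at most a multiple of
`log (1/l)`. -/
lemma exists_dyadic_le_log {l : ℝ} (hl : 0 < l) (hl1 : l ≤ 1 / 81) :
    ∃ M : ℕ, 2 < 2 ^ (M + 1) * l ∧ (M : ℝ) + 1 ≤ 4 * Real.log (1 / l) := by
  have h2 : 1 / 2 ≤ Real.log 2 := by linarith [Real.log_two_gt_d9]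
  have hL : 1 ≤ Real.log (1 / l) := by
    rw [Real.le_log_iff_exp_le (by positivity)]
    have h3 : 81 ≤ 1 / l := by rw [le_div_iff₀ hl]; linarith
    linarith [Real.exp_one_lt_d9]
  have hx : Real.logb 2 (2 / l) = 1 + Real.log (1 / l) / Real.log 2 := by
    rw [Real.logb, show 2 / l = 2 * (1 / l) by ring, Real.log_mul (by norm_num) (by positivity)]
    field_simp
  have h0 : 0 ≤ Real.log (1 / l) / Real.log 2 := by positivity
  refine ⟨⌊Real.logb 2 (2 / l)⌋₊, ?_, ?_⟩
  · rw [← div_lt_iff₀ hl]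
    have h3 := Nat.lt_floor_add_one (Real.logb 2 (2 / l))
    rw [Real.logb_lt_iff_lt_rpow one_lt_two (by positivity)] at h3
    exact_mod_cast h3
  · have h3 := Nat.floor_le (show 0 ≤ Real.logb 2 (2 / l) by rw [hx]; linarith)
    have h4 : Real.log (1 / l) / Real.log 2 ≤ 2 * Real.log (1 / l) := by
      rw [div_le_iff₀ (by linarith)]
      nlinarith
    linarith

/-- On `S(I)` the logarithmic test function has size about `L = log (1/l)`, while its norm is at
most about `L^(1/p)`. Hence `L^q μ(S(I)) ≲ L^(q/p)`. -/
theorem IsBoundedOperator.isLogCarleson {p q α β : ℝ} (hα : -1 < α) (hq : 0 < q) (hpα : p = α + 2)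
    {g : ℂ → ℂ} (hg : g ∈ analyticDisk) (h : IsBoundedOperator (volterra g) p α q β) :
    IsLogCarleson ((1 / p - 1) * q) (volterraMeasure g q β) := by
  have hp1 : 1 < p := by linarith
  have hp : 0 < p := by linarith
  set e := (1 / p - 1) * q with he
  have he0 : e < 0 :=
    mul_neg_of_neg_of_pos (by rw [sub_neg, div_lt_one hp]; exact hp1) hq
  have hfin := isFiniteMeasure_of_isBoundedOperator hp hq hg h
  obtain ⟨D, hD⟩ := (isBoundedOperator_volterra_iff hq p α β hg).1 h
  obtain ⟨C, hC, hnorm⟩ := exists_dirichletNorm_log_le hα hpα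
  set m := (volterraMeasure g q β univ).toReal with hm
  have hmof : volterraMeasure g q β univ = ENNReal.ofReal m :=
    (ENNReal.ofReal_toReal (measure_ne_top _ _)).symm
  have hlog81 : 0 < Real.log 81 := Real.log_pos (by norm_num)
  refine ⟨m * Real.log 81 ^ (-e) + ((D : ℝ) + 1) * (C * 4) ^ (q / p) * 2 ^ q, by positivity,
    fun I l hI hl1 => ?_⟩
  have hl0 := hI.1
  set L := Real.log (1 / l) with hL
  have hL0 : 0 < L := Real.log_pos ((one_lt_div hl0).2 hl1)
  -- For `l ≤ 1/81` one has `log 9 ≤ L / 2`, so `|f| ≥ log (1 / (9l)) ≥ L / 2` on the square. For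
  -- longer arcs `L ≤ log 81` and `e < 0`, so `L^e` is bounded below and the finite total mass
  -- suffices.
  rcases le_or_gt l (1 / 81) with hl | hl
  · obtain ⟨M, hM1, hM2⟩ := exists_dyadic_le_log hl0 hl
    obtain ⟨ω, hω, hS⟩ := norm_sub_le_of_mem_carlesonSquare hI
    obtain ⟨hfa, hfN⟩ := hnorm ω l M hω hl0 hI.2.1 hM1
    set f : ℂ → ℂ := fun z => Complex.log (1 - (1 - l) * ω⁻¹ * z) with hf
    have hω0 : ω ≠ 0 := by rintro rfl; simp at hω
    have hfm : Measurable f := by fun_prop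
    have hlow : ∀ z ∈ carlesonSquare I l, L / 2 ≤ ‖f z‖ := by
      intro z hz
      obtain ⟨h1, h2⟩ := hS z hz
      have h3 : 0 < ‖ω - (1 - l) * z‖ :=
        norm_pos_iff.2 (test_ne_zero hω hl0 hI.2.1 (mem_unitDisk.2 h1))
      have h4 : ‖1 - (1 - l) * ω⁻¹ * z‖ = ‖ω - (1 - l) * z‖ := by
        have e1 : ω - (1 - l) * z = ω * (1 - (1 - l) * ω⁻¹ * z) := by field_simp
        rw [e1, norm_mul, hω, one_mul]
      have h5 : Real.log ‖ω - (1 - l) * z‖ ≤ -(L / 2) := by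
        have h6 : Real.log ‖ω - (1 - l) * z‖ ≤ Real.log (9 * l) := Real.log_le_log h3 h2
        have h7 : Real.log (9 * l) = Real.log 81 / 2 - L := by
          rw [hL, one_div, Real.log_inv, Real.log_mul (by norm_num) hl0.ne',
            show (81 : ℝ) = 9 ^ 2 by norm_num, Real.log_pow]
          push_cast; ring
        have h8 : Real.log 81 ≤ L := by
          refine Real.log_le_log (by norm_num) ?_
          rw [le_div_iff₀ hl0]; linarith
        linarith
      have h9 := Complex.abs_re_le_norm (f z)
      rw [hf, Complex.log_re, h4] at h9
      have := neg_abs_le (Real.log ‖ω - (1 - l) * z‖)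
      exact le_trans (by linarith) h9
    have h1 := measure_mul_rpow_le (μ := volterraMeasure g q β) hfm hq (by positivity) hlow
    have h2 := hD f ⟨hfa, dirichletNorm_lt_top_of_rpow_le hp hfN⟩
    have h3 := dirichletNorm_rpow_le (q := q) hp hq (by positivity) hfN
    have hc : (0 : ℝ) < (L / 2) ^ q := by positivity
    refine (ENNReal.mul_le_mul_iff_right (ENNReal.ofReal_pos.2 hc).ne' ENNReal.ofReal_ne_top).1
      (h1.trans (h2.trans ((mul_le_mul_right h3 _).trans ?_)))
    have hDD : (D : ℝ≥0∞) = ENNReal.ofReal D := by simp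
    rw [hDD, ← ENNReal.ofReal_mul (by positivity), ← ENNReal.ofReal_mul hc.le]
    refine ENNReal.ofReal_le_ofReal ?_
    have e1 : (L / 2) ^ q * 2 ^ q = L ^ q := by
      rw [← Real.mul_rpow (by positivity) (by norm_num)]; congr 1; ring
    have e2 : L ^ q * L ^ e = L ^ (q / p) := by
      rw [← Real.rpow_add hL0, he]; congr 1; ring
    calc (D : ℝ) * (C * (M + 1)) ^ (q / p) ≤ ((D : ℝ) + 1) * (C * (4 * L)) ^ (q / p) := by
          gcongr
          linarith
      _ = ((D : ℝ) + 1) * (C * 4) ^ (q / p) * L ^ (q / p) := by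
          rw [← mul_assoc C, Real.mul_rpow (by positivity) hL0.le]; ring
      _ = (L / 2) ^ q * ((((D : ℝ) + 1) * (C * 4) ^ (q / p) * 2 ^ q) * L ^ e) := by
          rw [← e2, ← e1]; ring
      _ ≤ _ := by
          gcongr
          have : 0 ≤ m * Real.log 81 ^ (-e) := by positivity
          linarith
  · refine (measure_mono (subset_univ _)).trans (hmof.le.trans (ENNReal.ofReal_le_ofReal ?_))
    have hLle : L ≤ Real.log 81 := by
      refine Real.log_le_log (by positivity) ?_
      rw [div_le_iff₀ hl0]; linarith
    have h1 : Real.log 81 ^ e ≤ L ^ e := Real.rpow_le_rpow_of_nonpos hL0 hLle he0.le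
    have h2 : Real.log 81 ^ (-e) * Real.log 81 ^ e = 1 := by
      rw [← Real.rpow_add hlog81]; simp
    calc m = m * Real.log 81 ^ (-e) * Real.log 81 ^ e := by rw [mul_assoc, h2, mul_one]
      _ ≤ _ := by
        gcongr
        have : 0 ≤ ((D : ℝ) + 1) * (C * 4) ^ (q / p) * 2 ^ q := by positivity
        linarith

end WeightedDirichlet

end

/-! ### The three cases combined -/

theorem mainTheorem1 (α β p q : ℝ) (hα : -1 < α) (hβ : -1 < β) (hp : 0 < p) (hpq : p < q)
    (g : ℂ → ℂ) (hg : g ∈ WeightedDirichlet.analyticDisk) :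
    (p < α + 2 →
      (WeightedDirichlet.IsBoundedOperator (WeightedDirichlet.volterra g) p α q β ↔
        WeightedDirichlet.IsCarleson (q * (α + 2 - p) / p)
          (WeightedDirichlet.volterraMeasure g q β))) ∧
    (p = α + 2 →
      (WeightedDirichlet.IsBoundedOperator (WeightedDirichlet.volterra g) p α q β ↔
        WeightedDirichlet.IsLogCarleson ((1 / p - 1) * q)
          (WeightedDirichlet.volterraMeasure g q β))) ∧
    (α + 2 < p →
      (WeightedDirichlet.IsBoundedOperator (WeightedDirichlet.volterra g) p α q β ↔
        IsFiniteMeasure (WeightedDirichlet.volterraMeasure g q β)) ∧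
      (IsFiniteMeasure (WeightedDirichlet.volterraMeasure g q β) ↔
        g ∈ WeightedDirichlet.dirichletSpace q β)) := by
  have hq : 0 < q := hp.trans hpq
  refine ⟨fun h => ⟨fun hb => hb.isCarleson hα hp hq hg,
      fun hc => hc.isBoundedOperator hp hpq h hg⟩,
    fun h => ⟨fun hb => hb.isLogCarleson hα hq h hg, fun hc => hc.isBoundedOperator hα hpq h hg⟩,
    fun h => ⟨⟨WeightedDirichlet.isFiniteMeasure_of_isBoundedOperator hp hq hg,
      WeightedDirichlet.isBoundedOperator_of_isFiniteMeasure hp hq h hg⟩,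
      WeightedDirichlet.isFiniteMeasure_volterraMeasure_iff hq β hg⟩⟩
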